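/- Let $d\in\mathbb N$, $d\ge 1$, let $\Omega\subseteq\mathbb R^d$ be a bounded domain, $T>0$ and $Q_T=(0,T)\times\Omega$. Write $(k*w)(t)=\int_0^t k(t-\tau)w(\tau)\,d\tau$. Assume: - (H$k$) $k\in L^1_{\mathrm{loc}}([0,\infty))$ is non-negative and non-increasing on $(0,\infty)$, and there are $p>1$ and $l\in L^p(0,T)$ ($l$ being a function on $(0,\infty)$) with $k*l=1$ a.e. in $(0,\infty)$. - (H$A$) $A\in L^\infty(Q_T;\mathbb R^{d\times d})$ and there is $\nu>0$ with $(A(t,x)\xi,\xi)\ge\nu|\xi|^2$ for all $\xi\in\mathbb R^d$ and a.e. $(t,x)\in Q_T$. - (H$\varphi$) $\varphi\in C^1(\mathbb R)$, $\varphi'\ge 0$, $\varphi(0)=0$, $\varphi$ is strictly increasing, and there are $\mu,R>0$ with $\varphi'(r)\ge\mu$ for all $|r|>R$. Put $b=\varphi^{-1}$. - (Hd) $u_0\in L^1(\Omega)$ and $f\in L^1(Q_T)$. For a Banach space $X$, ${}_0W^{1,1}(0,T;X)$ denotes the set of $w\in W^{1,1}(0,T;X)$ with $w(0)=0$. A *weak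 solution* of $$P(u_0,f):\quad \partial_t[k*(u-u_0)]-\operatorname{div}(A\nabla\varphi(u))=f\ \text{in }Q_T,\quad u=0\ \text{on }(0,T)\times\partial\Omega,\quad u(0,\cdot)=u_0$$ is a function $u\in L^2(0,T;L^2(\Omega))$ with $k*(u-u_0)\in{}_0W^{1,1}(0,T;H^{-1}(\Omega))$ and $\varphi(u)\in L^2(0,T;H^1_0(\Omega))$ such that $$\int_{Q_T}-\eta_t\,[k*(u-u_0)]+(A\nabla\varphi(u),\nabla\eta)\,dx\,dt=\int_{Q_T}f\eta\,dx\,dt$$ for every $\eta\in W^{1,1}(0,T;L^2(\Omega))\cap L^2(0,T;H^1_0(\Omega))$ with $\eta(T,\cdot)=0$ for which $\eta_t\,[k*(u-u_0)]$ and $f\eta$ are integrable over $Q_T$. Let $\mathcal P=\{S\in C^1(\mathbb R): 0\le S'\le 1,\ \operatorname{supp}S'\text{ compact},\ S(0)=0\}$ and $T_K(s)=\max(-K,\min(K,s))$. With $v_0=\varphi(u_0)$, a measurable function $v:Q_T\to\mathbb R$ is an *entropy solution* of $P(u_0,f)$ if $b(v)\in L^1(Q_T)$, $T_K(v)\in L^2(0,T;H^1_0(\Omega))$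 for all $K>0$, and $$-\int_{Q_T}\zeta_t\Big[k_1*\int_{v_0}^{v}S(\sigma-\phi)\,db(\sigma)\Big]+\int_{Q_T}\zeta\,\partial_t[k_2*(b(v)-b(v_0))]\,S(v-\phi)+\int_{Q_T}\zeta\,(A\nabla v,\nabla S(v-\phi))\le\int_{Q_T}\zeta f\,S(v-\phi)$$ for all $\phi\in H^1_0(\Omega)\cap L^\infty(\Omega)$, all $\zeta\in\mathcal D([0,T))$ with $\zeta\ge0$, all $S\in\mathcal P$, and all non-increasing non-negative $k_1,k_2\in L^1(0,T)$ with $k=k_1+k_2$ a.e. on $(0,T)$ and $k_2(0^+)<\infty$. Here $\nabla v$ is the generalized gradient, determined a.e. by $\nabla T_K(v)=\mathbf 1_{\{|v|<K\}}\nabla v$ for all $K>0$; it is part of the definition that $S(v-\phi)\in L^2(0,T;H^1_0(\Omega))$, that $k_2*(b(v)-b(v_0))\in{}_0W^{1,1}(0,T;L^1(\Omega))$, and that the four integrals converge absolutely. **Statement.** Assume (H$k$), (H$A$), (H$\varphi$) and (Hd). If $u$ is a weak solution of $P(u_0,f)$ with $k*(u-u_0)\in{}_0W^{1,1}(0,T;L^1(\Omega))$,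 then $v=\varphi(u)$ is an entropy solution of $P(u_0,f)$. -/

import Mathlib

open MeasureTheory Set Filter Topology
open scoped ENNReal ContDiff

namespace FracPME

noncomputable section

/-- `ℝ^d` with its Euclidean norm. -/
abbrev E (d : ℕ) : Type := EuclideanSpace ℝ (Fin d)

/-! ### Assumptions on the data -/

/-- The space-time cylinder `Q_T = (0,T) × Ω`. -/
def cyl {d : ℕ} (T : ℝ) (Ω : Set (E d)) : Set (ℝ × E d) := Ioo 0 T ×ˢ Ω

/-- Assumption on the kernel. Membership of `k` in `L¹_loc` is integrability on compact subsets
of `[0,∞)`. The identity `k ∗ l = 1` on `(0,∞)` is between classes of functions, hence a.e. -/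
structure HypKernel (T : ℝ) (k : ℝ → ℝ) : Prop where
  locInt : LocallyIntegrableOn k (Ici 0)
  nonneg : ∀ t, 0 < t → 0 ≤ k t
  antitone : AntitoneOn k (Ioi 0)
  exists_conj : ∃ (p : ℝ≥0∞) (l : ℝ → ℝ), 1 < p ∧ MemLp l p (volume.restrict (Ioo 0 T)) ∧
    ∀ᵐ t ∂(volume.restrict (Ioi (0 : ℝ))), ∫ τ in (0 : ℝ)..t, k (t - τ) * l τ = 1

/-- Assumption on the coefficients: bounded, measurable and uniformly elliptic on `Q_T`. -/
structure HypCoeff {d : ℕ} (T : ℝ) (Ω : Set (E d))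
    (A : ℝ → E d → Matrix (Fin d) (Fin d) ℝ) : Prop where
  bounded : ∀ i j, MemLp (fun z : ℝ × E d => A z.1 z.2 i j) ∞ (volume.restrict (cyl T Ω))
  elliptic : ∃ ν : ℝ, 0 < ν ∧ ∀ᵐ z ∂(volume.restrict (cyl T Ω)), ∀ ξ : E d,
    ν * ‖ξ‖ ^ 2 ≤ inner ℝ (Matrix.toEuclideanLin (A z.1 z.2) ξ) ξ

/-- Assumption on the nonlinearity. -/
structure HypPhi (φ : ℝ → ℝ) : Prop where
  contDiff : ContDiff ℝ 1 φ
  deriv_nonneg : ∀ r, 0 ≤ deriv φ r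
  map_zero : φ 0 = 0
  strictMono : StrictMono φ
  lower : ∃ μ R : ℝ, 0 < μ ∧ 0 < R ∧ ∀ r, R < |r| → μ ≤ deriv φ r

/-- Assumption on the data: `u₀ ∈ L¹(Ω)` and `f ∈ L¹(Q_T)`. -/
structure HypData {d : ℕ} (T : ℝ) (Ω : Set (E d)) (u₀ : E d → ℝ) (f : ℝ → E d → ℝ) : Prop where
  init : IntegrableOn u₀ Ω
  source : IntegrableOn (Function.uncurry f) (cyl T Ω)

/-! ### The inverse `b` of `φ` and its Stieltjes measure -/

theorem HypPhi.surjective {φ : ℝ → ℝ} (h : HypPhi φ) : Function.Surjective φ := by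
  obtain ⟨μ, R, hμ, hR, hl⟩ := h.lower
  have hc : Continuous φ := h.contDiff.continuous
  have hd : Differentiable ℝ φ := h.contDiff.differentiable (by norm_num)
  have up : ∀ x ∈ Ici R, ∀ y ∈ Ici R, x ≤ y → μ * (y - x) ≤ φ y - φ x := by
    refine (convex_Ici R).mul_sub_le_image_sub_of_le_deriv hc.continuousOn hd.differentiableOn ?_
    intro x hx
    rw [interior_Ici] at hx
    exact hl x (lt_of_lt_of_le hx (le_abs_self x))
  have dn : ∀ x ∈ Iic (-R), ∀ y ∈ Iic (-R), x ≤ y → μ * (y - x) ≤ φ y - φ x := by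
    refine (convex_Iic (-R)).mul_sub_le_image_sub_of_le_deriv hc.continuousOn
      hd.differentiableOn ?_
    intro x hx
    rw [interior_Iic] at hx
    refine hl x (lt_of_lt_of_le ?_ (neg_le_abs x))
    have : x < -R := hx
    linarith
  refine hc.surjective ?_ ?_
  · have h1 : Tendsto (fun y => φ R + μ * (y - R)) atTop atTop :=
      tendsto_atTop_add_const_left _ _
        ((tendsto_atTop_add_const_right _ (-R) tendsto_id).const_mul_atTop hμ)
    refine tendsto_atTop_mono' _ ?_ h1
    filter_upwards [eventually_ge_atTop R] with y hy
    have := up R self_mem_Ici y hy hy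
    linarith
  · have h1 : Tendsto (fun y => φ (-R) + μ * (y - -R)) atBot atBot :=
      tendsto_atBot_add_const_left _ _
        ((tendsto_atBot_add_const_right _ (- -R) tendsto_id).const_mul_atBot hμ)
    refine tendsto_atBot_mono' _ ?_ h1
    filter_upwards [eventually_le_atBot (-R)] with y hy
    have := dn y hy (-R) self_mem_Iic hy
    linarith

/-- `b = φ⁻¹`. -/
def bInv (φ : ℝ → ℝ) : ℝ → ℝ := Function.invFun φ

theorem HypPhi.apply_bInv {φ : ℝ → ℝ} (h : HypPhi φ) (s : ℝ) : φ (bInv φ s) = s :=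
  Function.rightInverse_invFun h.surjective s

theorem HypPhi.monotone_bInv {φ : ℝ → ℝ} (h : HypPhi φ) : Monotone (bInv φ) := by
  intro s t hst
  rw [← h.strictMono.le_iff_le, h.apply_bInv, h.apply_bInv]
  exact hst

/-- The Lebesgue-Stieltjes measure `db`. -/
def dB {φ : ℝ → ℝ} (h : HypPhi φ) : Measure ℝ := h.monotone_bInv.stieltjesFunction.measure

/-! ### Function spaces -/

/-- `ψ ∈ C_c^∞(Ω)`. -/
structure IsTest {d : ℕ} (Ω : Set (E d)) (ψ : E d → ℝ) : Prop where
  smooth : ContDiff ℝ ∞ ψ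
  compact : HasCompactSupport ψ
  support : tsupport ψ ⊆ Ω

/-- `H¹₀(Ω)`, as the space of pairs `(w, ∇w)`: the closure of the pairs `(ψ, ∇ψ)`,
`ψ ∈ C_c^∞(Ω)`, in `L²(Ω) × L²(Ω;ℝ^d)`. The product norm is equivalent to the usual one. -/
def H10 {d : ℕ} (Ω : Set (E d)) :
    Submodule ℝ (Lp ℝ 2 (volume.restrict Ω) × Lp (E d) 2 (volume.restrict Ω)) :=
  (Submodule.span ℝ {p | ∃ ψ : E d → ℝ, IsTest Ω ψ ∧
    p.1 =ᵐ[volume.restrict Ω] ψ ∧ p.2 =ᵐ[volume.restrict Ω] gradient ψ}).topologicalClosure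

/-- `w ∈ H¹₀(Ω)` with weak gradient `G`. -/
def MemH10 {d : ℕ} (Ω : Set (E d)) (w : E d → ℝ) (G : E d → E d) : Prop :=
  ∃ (hw : MemLp w 2 (volume.restrict Ω)) (hG : MemLp G 2 (volume.restrict Ω)),
    (hw.toLp w, hG.toLp G) ∈ H10 Ω

/-- `w ∈ L²(0,T;H¹₀(Ω))` with weak spatial gradient `G`. -/
structure MemL2H10 {d : ℕ} (T : ℝ) (Ω : Set (E d)) (w : ℝ → E d → ℝ) (G : ℝ → E d → E d) :
    Prop where
  memLp : MemLp (Function.uncurry w) 2 (volume.restrict (cyl T Ω))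
  memLp_grad : MemLp (Function.uncurry G) 2 (volume.restrict (cyl T Ω))
  slice : ∀ᵐ t ∂(volume.restrict (Ioo 0 T)), MemH10 Ω (w t) (G t)

/-- `w ∈ L¹(0,T;L^q(Ω))`. -/
structure MemL1Lq {d : ℕ} (q : ℝ≥0∞) (T : ℝ) (Ω : Set (E d)) (w : ℝ → E d → ℝ) : Prop where
  meas : AEStronglyMeasurable (Function.uncurry w) (volume.restrict (cyl T Ω))
  finite : ∫⁻ t in Ioo 0 T, eLpNorm (w t) q (volume.restrict Ω) < ⊤

/-- `w ∈ W^{1,1}(0,T;L^q(Ω))` with initial value `w(0) = w₀` and time derivative `w'`. -/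
structure MemW11 {d : ℕ} (q : ℝ≥0∞) (T : ℝ) (Ω : Set (E d)) (w : ℝ → E d → ℝ) (w₀ : E d → ℝ)
    (w' : ℝ → E d → ℝ) : Prop where
  init : MemLp w₀ q (volume.restrict Ω)
  deriv : MemL1Lq q T Ω w'
  eq_integral : ∀ᵐ z ∂(volume.restrict (cyl T Ω)),
    w z.1 z.2 = w₀ z.2 + ∫ s in (0 : ℝ)..z.1, w' s z.2

/-- `H¹₀(Ω)` as a normed space in its own right. -/
def H10Space {d : ℕ} (Ω : Set (E d)) : Type := H10 Ω

instance {d : ℕ} (Ω : Set (E d)) : NormedAddCommGroup (H10Space Ω) :=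
  inferInstanceAs (NormedAddCommGroup (H10 Ω))

instance {d : ℕ} (Ω : Set (E d)) : NormedSpace ℝ (H10Space Ω) :=
  inferInstanceAs (NormedSpace ℝ (H10 Ω))

/-- A pair `(w, ∇w)` in `H10 Ω`, as an element of the normed space. -/
def H10Space.mk {d : ℕ} {Ω : Set (E d)}
    (p : Lp ℝ 2 (volume.restrict Ω) × Lp (E d) 2 (volume.restrict Ω)) (hp : p ∈ H10 Ω) :
    H10Space Ω := (⟨p, hp⟩ : H10 Ω)

/-- `H^{-1}(Ω)`, the dual of `H¹₀(Ω)`. -/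
abbrev Hneg {d : ℕ} (Ω : Set (E d)) : Type := StrongDual ℝ (H10Space Ω)

/-- The functional `F ∈ H^{-1}(Ω)` is the function `w`: `⟨F,ψ⟩ = ∫_Ω w ψ` for all
`ψ ∈ C_c^∞(Ω)`. -/
def Represents {d : ℕ} (Ω : Set (E d)) (F : Hneg Ω) (w : E d → ℝ) : Prop :=
  ∀ (ψ : E d → ℝ) (p : Lp ℝ 2 (volume.restrict Ω) × Lp (E d) 2 (volume.restrict Ω))
    (hp : p ∈ H10 Ω), IsTest Ω ψ → p.1 =ᵐ[volume.restrict Ω] ψ →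
    p.2 =ᵐ[volume.restrict Ω] gradient ψ →
    IntegrableOn (fun x => w x * ψ x) Ω ∧ F (H10Space.mk p hp) = ∫ x in Ω, w x * ψ x

/-- `w ∈ ₀W^{1,1}(0,T;H^{-1}(Ω))`: `w(t) = ∫₀ᵗ F'(s) ds` for a.e. `t`, with
`F' ∈ L¹(0,T;H^{-1}(Ω))`. -/
def MemW11zeroHneg {d : ℕ} (T : ℝ) (Ω : Set (E d)) (w : ℝ → E d → ℝ) : Prop :=
  ∃ F' : ℝ → Hneg Ω, IntegrableOn F' (Ioo 0 T) ∧
    ∀ᵐ t ∂(volume.restrict (Ioo 0 T)), Represents Ω (∫ s in (0 : ℝ)..t, F' s) (w t)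

/-! ### Weak solutions -/

/-- `(k ∗ w)(t) = ∫₀ᵗ k(t-τ) w(τ) dτ`. -/
def conv {d : ℕ} (k : ℝ → ℝ) (w : ℝ → E d → ℝ) (t : ℝ) (x : E d) : ℝ :=
  ∫ τ in (0 : ℝ)..t, k (t - τ) * w τ x

/-- `u` is a weak solution of the problem with data `u₀`, `f`. The identity is required for those
admissible `η` for which its integrals converge absolutely (for bounded `u₀`, `f`, `u`, all
of them); the term with the gradients is always integrable. -/
def IsWeakSolution {d : ℕ} (T : ℝ) (Ω : Set (E d)) (k : ℝ → ℝ)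
    (A : ℝ → E d → Matrix (Fin d) (Fin d) ℝ) (φ : ℝ → ℝ) (u₀ : E d → ℝ) (f : ℝ → E d → ℝ)
    (u : ℝ → E d → ℝ) : Prop :=
  MemLp (Function.uncurry u) 2 (volume.restrict (cyl T Ω)) ∧
  MemW11zeroHneg T Ω (conv k (fun t x => u t x - u₀ x)) ∧
  ∃ G : ℝ → E d → E d, MemL2H10 T Ω (fun t x => φ (u t x)) G ∧
    ∀ (η : ℝ → E d → ℝ) (η₀ : E d → ℝ) (η' : ℝ → E d → ℝ) (Dη : ℝ → E d → E d),
      MemW11 2 T Ω η η₀ η' → MemL2H10 T Ω η Dη →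
      (∀ᵐ x ∂(volume.restrict Ω), η₀ x + ∫ s in (0 : ℝ)..T, η' s x = 0) →
      IntegrableOn (fun z : ℝ × E d =>
        η' z.1 z.2 * conv k (fun t x => u t x - u₀ x) z.1 z.2) (cyl T Ω) →
      IntegrableOn (fun z : ℝ × E d => f z.1 z.2 * η z.1 z.2) (cyl T Ω) →
      ∫ z in cyl T Ω, (-(η' z.1 z.2 * conv k (fun t x => u t x - u₀ x) z.1 z.2) +
          inner ℝ (Matrix.toEuclideanLin (A z.1 z.2) (G z.1 z.2)) (Dη z.1 z.2)) =
        ∫ z in cyl T Ω, f z.1 z.2 * η z.1 z.2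

/-! ### Entropy solutions -/

/-- The class `𝒫` of nonlinearities `S`. -/
structure ClassP (S : ℝ → ℝ) : Prop where
  contDiff : ContDiff ℝ 1 S
  deriv_nonneg : ∀ r, 0 ≤ deriv S r
  deriv_le_one : ∀ r, deriv S r ≤ 1
  compact : HasCompactSupport (deriv S)
  map_zero : S 0 = 0

/-- The truncation `T_K(s) = max(-K, min(K, s))`. -/
def trunc (K s : ℝ) : ℝ := max (-K) (min K s)

/-- `ζ ∈ 𝒟([0,T))` with `ζ ≥ 0`. -/
structure IsTimeTest (T : ℝ) (ζ : ℝ → ℝ) : Prop where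
  smooth : ContDiff ℝ ∞ ζ
  compact : HasCompactSupport ζ
  support : tsupport ζ ⊆ Iio T
  nonneg : ∀ t ∈ Ico 0 T, 0 ≤ ζ t

/-- `k = k₁ + k₂` on `(0,T)` with `k₁, k₂ ∈ L¹(0,T)` non-increasing, non-negative,
and `k₂(0⁺) < ∞`. -/
structure IsSplitting (T : ℝ) (k k₁ k₂ : ℝ → ℝ) : Prop where
  int₁ : IntegrableOn k₁ (Ioo 0 T)
  int₂ : IntegrableOn k₂ (Ioo 0 T)
  antitone₁ : AntitoneOn k₁ (Ioo 0 T)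
  antitone₂ : AntitoneOn k₂ (Ioo 0 T)
  nonneg₁ : ∀ t ∈ Ioo 0 T, 0 ≤ k₁ t
  nonneg₂ : ∀ t ∈ Ioo 0 T, 0 ≤ k₂ t
  add_eq : ∀ᵐ t ∂(volume.restrict (Ioo 0 T)), k t = k₁ t + k₂ t
  finite : ∃ c : ℝ, Tendsto k₂ (𝓝[>] 0) (𝓝 c)

/-- The entropy inequality for given `S`, `ϕ`, `ζ`, `k₁`, `k₂`. Here `G` stands for `∇v`; the
function `H` is the weak gradient of `S(v-ϕ)` and `g` is `∂_t[k₂ ∗ (b(v)-b(v₀))]`.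
All four integrals converge absolutely. -/
def EntropyIneq {d : ℕ} (T : ℝ) (Ω : Set (E d)) (A : ℝ → E d → Matrix (Fin d) (Fin d) ℝ)
    {φ : ℝ → ℝ} (hφ : HypPhi φ) (v₀ : E d → ℝ) (f : ℝ → E d → ℝ) (v : ℝ → E d → ℝ)
    (G : ℝ → E d → E d) (S : ℝ → ℝ) (ϕ : E d → ℝ) (ζ k₁ k₂ : ℝ → ℝ) : Prop :=
  ∃ (H : ℝ → E d → E d) (g : ℝ → E d → ℝ),
    MemL2H10 T Ω (fun t x => S (v t x - ϕ x)) H ∧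
    MemW11 1 T Ω (conv k₂ (fun t x => bInv φ (v t x) - bInv φ (v₀ x))) 0 g ∧
    IntegrableOn (fun z : ℝ × E d => deriv ζ z.1 *
      conv k₁ (fun t x => ∫ σ in (v₀ x)..(v t x), S (σ - ϕ x) ∂(dB hφ)) z.1 z.2) (cyl T Ω) ∧
    IntegrableOn (fun z : ℝ × E d => ζ z.1 * g z.1 z.2 * S (v z.1 z.2 - ϕ z.2)) (cyl T Ω) ∧
    IntegrableOn (fun z : ℝ × E d => ζ z.1 *
      inner ℝ (Matrix.toEuclideanLin (A z.1 z.2) (G z.1 z.2)) (H z.1 z.2)) (cyl T Ω) ∧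
    IntegrableOn (fun z : ℝ × E d => ζ z.1 * f z.1 z.2 * S (v z.1 z.2 - ϕ z.2)) (cyl T Ω) ∧
    -(∫ z in cyl T Ω, deriv ζ z.1 *
        conv k₁ (fun t x => ∫ σ in (v₀ x)..(v t x), S (σ - ϕ x) ∂(dB hφ)) z.1 z.2)
      + (∫ z in cyl T Ω, ζ z.1 * g z.1 z.2 * S (v z.1 z.2 - ϕ z.2))
      + (∫ z in cyl T Ω, ζ z.1 *
          inner ℝ (Matrix.toEuclideanLin (A z.1 z.2) (G z.1 z.2)) (H z.1 z.2))
      ≤ ∫ z in cyl T Ω, ζ z.1 * f z.1 z.2 * S (v z.1 z.2 - ϕ z.2)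

/-- `v` is an entropy solution of the problem with data `u₀`, `f`; here `v₀ = φ(u₀)`.
The function `G` is the generalized gradient `∇v`, i.e. `∇T_K(v) = 1_{|v|<K} G` for all `K > 0`,
which determines it almost everywhere. -/
def IsEntropySolution {d : ℕ} (T : ℝ) (Ω : Set (E d)) (k : ℝ → ℝ)
    (A : ℝ → E d → Matrix (Fin d) (Fin d) ℝ) {φ : ℝ → ℝ} (hφ : HypPhi φ) (u₀ : E d → ℝ)
    (f : ℝ → E d → ℝ) (v : ℝ → E d → ℝ) : Prop :=
  AEStronglyMeasurable (Function.uncurry v) (volume.restrict (cyl T Ω)) ∧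
  IntegrableOn (fun z : ℝ × E d => bInv φ (v z.1 z.2)) (cyl T Ω) ∧
  ∃ G : ℝ → E d → E d,
    (∀ K : ℝ, 0 < K → MemL2H10 T Ω (fun t x => trunc K (v t x))
      (fun t => {x | |v t x| < K}.indicator (G t))) ∧
    ∀ (ϕ : E d → ℝ) (Dϕ : E d → E d) (ζ S k₁ k₂ : ℝ → ℝ),
      MemH10 Ω ϕ Dϕ → MemLp ϕ ∞ (volume.restrict Ω) → IsTimeTest T ζ → ClassP S →
      IsSplitting T k k₁ k₂ →
      EntropyIneq T Ω A hφ (fun x => φ (u₀ x)) f v G S ϕ ζ k₁ k₂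

end

end FracPME

/-!
A weak solution `u` with `∂ₜ[k ∗ (u - u₀)] = g ∈ L¹` satisfies, for almost every time `t`,
`g(t) - div (A(t) ∇φ(u(t))) = f(t)` in the dual of `H¹₀(Ω) ∩ L^∞(Ω)`
(`ae_slice_identity_of_weak`). To see this, test with products `θ(t) ψ(x)`, integrate by parts in
time, apply the fundamental lemma of the calculus of variations in `t` for `ψ` in a countable dense
set of test functions, and extend to `H¹₀(Ω) ∩ L^∞(Ω)` by density and smooth truncation. No duality
between `H¹₀` and `H⁻¹` is involved, since all the terms are integrals of functions.

Let `v = φ(u)`. By the chain rule in `H¹₀(Ω)` (`ClassP.chainRule`, `chainRule_trunc`), the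
functions `S(v(t) - ϕ)` are bounded elements of `H¹₀(Ω)` with gradient
`S'(v - ϕ) (∇v - ∇ϕ)`. Testing with them and integrating over `t` with the weight `ζ` gives an
*equality* in which the term with the memory is `∫ ζ g S(v - ϕ)`.

Let `k = k₁ + k₂`. The bounded kernel `k₂` is the tail `κ(t) = ν((t, ∞))` of a finite measure `ν`,
so that `∂ₜ(k₂ ∗ w) = ν(ℝ) w - ν ∗ w` is integrable when `w = u - u₀` is
(`exists_deriv_conv_of_bounded`); call it `g₂`. Then `∂ₜ(k₁ ∗ w) = g - g₂` is integrable as well,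
and the entropy inequality reduces to the convexity inequality
`∂ₜ(k₁ ∗ Ψ(w)) ≤ Ψ'(w) ∂ₜ(k₁ ∗ w)` in the sense of distributions on `[0, T)`
(`convexity_inequality`). Here `Ψ(r) = ∫_{u₀}^{u₀ + r} S(φ(τ) - ϕ) dτ`, which is convex because
`S` and `φ` are non-decreasing, and `Ψ(w) = ∫_{v₀}^{v} S(σ - ϕ) db(σ)` because `db` is the image of
Lebesgue measure under `φ` (`intervalIntegral_dB`).

For smooth `z` with `z(0) = 0`, the convexity inequality says that
`∫₀ᵗ k₁(t - s) (Ψ'(z(t)) - Ψ'(z(s))) z'(s) ds ≥ 0`. It follows from the positivity of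
non-increasing kernels (`integral_conv_nonneg`), since `∫ᵣᵗ (Ψ'(z(t)) - Ψ'(z(s))) z'(s) ds ≥ 0` for
all `r ≤ t` by convexity of `Ψ`. For integrable `w`, mollify in time with densities supported in
`(0, ∞)`: this keeps causality and commutes with the convolution by `k₁`, so that the mollified
functions satisfy `k₁ ∗ zₙ' = (∂ₜ(k₁ ∗ w))ₙ` (`conv_deriv_mollified`), and every term converges.
-/

namespace FracPME

/-! ### Sobolev functions vanishing on the boundary and the chain rule -/

section Sobolev

theorem tendsto_eLpNorm_two_zero_of_dominated {α F : Type*} [MeasurableSpace α] {μ : Measure α}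
    [NormedAddCommGroup F] {f : ℕ → α → F} {b : α → ℝ} (hb : MemLp b 2 μ)
    (hf : ∀ n, AEStronglyMeasurable (f n) μ) (hbd : ∀ n, ∀ᵐ x ∂μ, ‖f n x‖ ≤ b x)
    (hlim : ∀ᵐ x ∂μ, Tendsto (fun n => f n x) atTop (𝓝 0)) :
    Tendsto (fun n => eLpNorm (f n) 2 μ) atTop (𝓝 0) := by
  have h1 : Tendsto (fun n => ∫⁻ x, ‖f n x‖ₑ ^ (2 : ℝ) ∂μ) atTop (𝓝 (∫⁻ _, 0 ∂μ)) := by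
    refine tendsto_lintegral_of_dominated_convergence' (fun x => ‖b x‖ₑ ^ (2 : ℝ))
      (fun n => (hf n).enorm.pow_const _) (fun n => ?_) ?_ ?_
    · filter_upwards [hbd n] with x hx
      gcongr
      exact enorm_le_iff_norm_le.2 (hx.trans (le_abs_self _))
    · have := lintegral_rpow_enorm_lt_top_of_eLpNorm_lt_top (by norm_num) (by norm_num) hb.2
      simpa using this.ne
    · filter_upwards [hlim] with x hx
      have h2 := (ENNReal.continuous_rpow_const (y := (2 : ℝ))).tendsto 0
      rw [ENNReal.zero_rpow_of_pos (by norm_num)] at h2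
      refine h2.comp ?_
      simpa using hx.enorm
  have h2 := ((ENNReal.continuous_rpow_const (y := 1 / (2 : ℝ))).tendsto 0).comp
    (by simpa using h1)
  rw [ENNReal.zero_rpow_of_pos (by norm_num)] at h2
  refine h2.congr fun n => ?_
  rw [eLpNorm_eq_lintegral_rpow_enorm_toReal (by norm_num) (by norm_num)]
  simp

variable {d : ℕ} {Ω : Set (E d)}

theorem continuous_gradient {ψ : E d → ℝ} (h : ContDiff ℝ ∞ ψ) : Continuous (gradient ψ) :=
  (LinearIsometryEquiv.continuous _).comp (h.continuous_fderiv (by norm_num))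

theorem hasCompactSupport_gradient {ψ : E d → ℝ} (h : HasCompactSupport ψ) :
    HasCompactSupport (gradient ψ) :=
  (h.fderiv (𝕜 := ℝ)).comp_left (g := (InnerProductSpace.toDual ℝ (E d)).symm) (map_zero _)

theorem gradient_comp_real {θ : ℝ → ℝ} {ψ : E d → ℝ} (hθ : Differentiable ℝ θ)
    (hψ : Differentiable ℝ ψ) (x : E d) :
    gradient (fun y => θ (ψ y)) x = deriv θ (ψ x) • gradient ψ x := by
  have := ((hθ (ψ x)).hasDerivAt.comp_hasFDerivAt x (hψ x).hasFDerivAt)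
  have h2 : fderiv ℝ (fun y => θ (ψ y)) x = deriv θ (ψ x) • fderiv ℝ ψ x := this.fderiv
  rw [gradient, gradient, h2, map_smul]

namespace IsTest

theorem memLp {ψ : E d → ℝ} (h : IsTest Ω ψ) (p : ℝ≥0∞) :
    MemLp ψ p (volume.restrict Ω) :=
  (h.smooth.continuous.memLp_of_hasCompactSupport h.compact).restrict _

theorem memLp_gradient {ψ : E d → ℝ} (h : IsTest Ω ψ) (p : ℝ≥0∞) :
    MemLp (gradient ψ) p (volume.restrict Ω) :=
  ((continuous_gradient h.smooth).memLp_of_hasCompactSupport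
    (hasCompactSupport_gradient h.compact)).restrict _

theorem add {ψ χ : E d → ℝ} (h : IsTest Ω ψ) (h' : IsTest Ω χ) : IsTest Ω (ψ + χ) :=
  ⟨h.smooth.add h'.smooth, h.compact.add h'.compact,
    (tsupport_add ψ χ).trans (union_subset h.support h'.support)⟩

theorem smul {ψ : E d → ℝ} (h : IsTest Ω ψ) (c : ℝ) : IsTest Ω (c • ψ) :=
  ⟨h.smooth.const_smul c, h.compact.smul_left,
    (tsupport_smul_subset_right (fun _ => c) ψ).trans h.support⟩

theorem zero : IsTest Ω (0 : E d → ℝ) :=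
  ⟨contDiff_const, HasCompactSupport.zero, by simp [tsupport]⟩

theorem comp {ψ : E d → ℝ} (h : IsTest Ω ψ) {θ : ℝ → ℝ} (hθ : ContDiff ℝ ∞ θ) (h0 : θ 0 = 0) :
    IsTest Ω (fun x => θ (ψ x)) :=
  ⟨hθ.comp h.smooth, h.compact.comp_left h0,
    (closure_mono (Function.support_comp_subset h0 ψ)).trans h.support⟩

theorem differentiable {ψ : E d → ℝ} (h : IsTest Ω ψ) : Differentiable ℝ ψ :=
  h.smooth.differentiable (by norm_num)

theorem memH10 {ψ : E d → ℝ} (h : IsTest Ω ψ) : MemH10 Ω ψ (gradient ψ) :=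
  ⟨h.memLp 2, h.memLp_gradient 2, Submodule.le_topologicalClosure _
    (Submodule.subset_span ⟨ψ, h, (h.memLp 2).coeFn_toLp, (h.memLp_gradient 2).coeFn_toLp⟩)⟩

end IsTest

/-- The span in the definition of `H10` may be dropped: the pairs `(ψ, ∇ψ)` already form a
subspace. -/
theorem exists_test_of_mem_span
    {p : Lp ℝ 2 (volume.restrict Ω) × Lp (E d) 2 (volume.restrict Ω)}
    (hp : p ∈ Submodule.span ℝ {p : Lp ℝ 2 (volume.restrict Ω) × Lp (E d) 2 (volume.restrict Ω) |
      ∃ ψ : E d → ℝ, IsTest Ω ψ ∧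
        p.1 =ᵐ[volume.restrict Ω] ψ ∧ p.2 =ᵐ[volume.restrict Ω] gradient ψ}) :
    ∃ ψ : E d → ℝ, IsTest Ω ψ ∧
      p.1 =ᵐ[volume.restrict Ω] ψ ∧ p.2 =ᵐ[volume.restrict Ω] gradient ψ := by
  induction hp using Submodule.span_induction with
  | mem x h => exact h
  | zero =>
    refine ⟨0, .zero, Lp.coeFn_zero _ _ _, (Lp.coeFn_zero _ _ _).trans ?_⟩
    refine Eventually.of_forall fun x => ?_
    simp [gradient]
  | add x y _ _ hx hy =>
    obtain ⟨ψ, h, h1, h2⟩ := hx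
    obtain ⟨χ, h', h1', h2'⟩ := hy
    refine ⟨ψ + χ, h.add h', (Lp.coeFn_add _ _).trans (h1.add h1'),
      (Lp.coeFn_add _ _).trans ((h2.add h2').trans (Eventually.of_forall fun z => ?_))⟩
    simp [gradient, fderiv_add (h.differentiable z) (h'.differentiable z)]
  | smul c x _ hx =>
    obtain ⟨ψ, h, h1, h2⟩ := hx
    refine ⟨c • ψ, h.smul c, (Lp.coeFn_smul _ _).trans (h1.const_smul c),
      (Lp.coeFn_smul _ _).trans ((h2.const_smul c).trans (Eventually.of_forall fun z => ?_))⟩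
    simp [gradient, fderiv_const_smul (h.differentiable z)]

/-- An element of `H¹₀(Ω)` is the limit, in `H¹` and almost everywhere, of test functions. -/
theorem MemH10.exists_seq {w : E d → ℝ} {G : E d → E d} (h : MemH10 Ω w G) :
    ∃ ψ : ℕ → E d → ℝ, (∀ n, IsTest Ω (ψ n)) ∧
      Tendsto (fun n => eLpNorm (ψ n - w) 2 (volume.restrict Ω)) atTop (𝓝 0) ∧
      Tendsto (fun n => eLpNorm (gradient (ψ n) - G) 2 (volume.restrict Ω)) atTop (𝓝 0) ∧
      ∀ᵐ x ∂(volume.restrict Ω), Tendsto (fun n => ψ n x) atTop (𝓝 (w x)) := by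
  obtain ⟨hw, hG, hm⟩ := h
  obtain ⟨p, hp, hlim⟩ := mem_closure_iff_seq_limit.1 hm
  choose ψ hψ h1 h2 using fun n => exists_test_of_mem_span (hp n)
  have e1 : Tendsto (fun n => eLpNorm (ψ n - w) 2 (volume.restrict Ω)) atTop (𝓝 0) := by
    have := (Lp.tendsto_Lp_iff_tendsto_eLpNorm' _ _).1 ((continuous_fst.tendsto _).comp hlim)
    refine this.congr fun n => eLpNorm_congr_ae ?_
    exact (h1 n).sub hw.coeFn_toLp
  have e2 : Tendsto (fun n => eLpNorm (gradient (ψ n) - G) 2 (volume.restrict Ω)) atTop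
      (𝓝 0) := by
    have := (Lp.tendsto_Lp_iff_tendsto_eLpNorm' _ _).1 ((continuous_snd.tendsto _).comp hlim)
    refine this.congr fun n => eLpNorm_congr_ae ?_
    exact (h2 n).sub hG.coeFn_toLp
  obtain ⟨ns, hns, hae⟩ := (tendstoInMeasure_of_tendsto_eLpNorm (p := 2) (by norm_num)
    (fun n => ((hψ n).memLp 2).1) hw.1 e1).exists_seq_tendsto_ae
  exact ⟨fun n => ψ (ns n), fun n => hψ _, e1.comp hns.tendsto_atTop,
    e2.comp hns.tendsto_atTop, hae⟩

/-- `H¹₀(Ω)` is closed. -/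
theorem MemH10.of_tendsto {w : E d → ℝ} {G : E d → E d} {wn : ℕ → E d → ℝ}
    {Gn : ℕ → E d → E d} (hw : MemLp w 2 (volume.restrict Ω))
    (hG : MemLp G 2 (volume.restrict Ω)) (hn : ∀ n, MemH10 Ω (wn n) (Gn n))
    (h1 : Tendsto (fun n => eLpNorm (wn n - w) 2 (volume.restrict Ω)) atTop (𝓝 0))
    (h2 : Tendsto (fun n => eLpNorm (Gn n - G) 2 (volume.restrict Ω)) atTop (𝓝 0)) :
    MemH10 Ω w G := by
  refine ⟨hw, hG, ?_⟩
  choose a b c using hn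
  refine IsClosed.mem_of_tendsto (Submodule.isClosed_topologicalClosure _)
    (f := fun n => ((a n).toLp, (b n).toLp)) (b := atTop) ?_ (Eventually.of_forall c)
  exact ((Lp.tendsto_Lp_iff_tendsto_eLpNorm'' _ _ _ _).2 h1).prodMk_nhds
    ((Lp.tendsto_Lp_iff_tendsto_eLpNorm'' _ _ _ _).2 h2)

theorem MemH10.sub {w w' : E d → ℝ} {G G' : E d → E d} (h : MemH10 Ω w G)
    (h' : MemH10 Ω w' G') : MemH10 Ω (fun x => w x - w' x) (fun x => G x - G' x) := by
  obtain ⟨a, b, c⟩ := h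
  obtain ⟨a', b', c'⟩ := h'
  exact ⟨a.sub a', b.sub b', (H10 Ω).sub_mem c c'⟩

theorem MemH10.smul {w : E d → ℝ} {G : E d → E d} (h : MemH10 Ω w G) (r : ℝ) :
    MemH10 Ω (fun x => r * w x) (fun x => r • G x) := by
  obtain ⟨a, b, c⟩ := h
  exact ⟨a.const_smul r, b.const_smul r, (H10 Ω).smul_mem r c⟩

theorem abs_le_of_abs_deriv_le {θ : ℝ → ℝ} (hd : Differentiable ℝ θ) {L : ℝ}
    (hL : ∀ s, |deriv θ s| ≤ L) (a b : ℝ) : |θ a - θ b| ≤ L * |a - b| :=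
  convex_univ.norm_image_sub_le_of_norm_deriv_le (fun x _ => hd x) (fun x _ => hL x)
    (mem_univ b) (mem_univ a)

/-- Composition with a smooth Lipschitz function acts continuously on approximating sequences of
test functions. -/
theorem MemH10.exists_seq_comp {w : E d → ℝ} {G : E d → E d} (h : MemH10 Ω w G) {θ : ℝ → ℝ}
    (hθ : ContDiff ℝ ∞ θ) (h0 : θ 0 = 0) {L : ℝ} (hL : ∀ s, |deriv θ s| ≤ L) :
    ∃ ψ : ℕ → E d → ℝ, (∀ n, IsTest Ω (ψ n)) ∧ (∀ n, IsTest Ω (fun x => θ (ψ n x))) ∧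
      Tendsto (fun n => eLpNorm ((fun x => θ (ψ n x)) - fun x => θ (w x)) 2
        (volume.restrict Ω)) atTop (𝓝 0) ∧
      Tendsto (fun n => eLpNorm (gradient (fun x => θ (ψ n x)) - fun x => deriv θ (w x) • G x) 2
        (volume.restrict Ω)) atTop (𝓝 0) ∧
      ∀ᵐ x ∂(volume.restrict Ω), Tendsto (fun n => θ (ψ n x)) atTop (𝓝 (θ (w x))) := by
  obtain ⟨ψ, hψ, e1, e2, hae⟩ := h.exists_seq
  obtain ⟨hw, hG, -⟩ := h
  have hd : Differentiable ℝ θ := hθ.differentiable (by norm_num)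
  have hL0 : 0 ≤ L := (abs_nonneg _).trans (hL 0)
  have hdc : Continuous (deriv θ) := hθ.continuous_deriv (by norm_num)
  refine ⟨ψ, hψ, fun n => (hψ n).comp hθ h0, ?_, ?_, ?_⟩
  · have : Tendsto (fun n => ENNReal.ofReal L * eLpNorm (ψ n - w) 2 (volume.restrict Ω)) atTop
        (𝓝 0) := by
      simpa using ENNReal.Tendsto.const_mul e1 (Or.inr (ENNReal.ofReal_ne_top (r := L)))
    refine tendsto_of_tendsto_of_tendsto_of_le_of_le tendsto_const_nhds this
      (fun _ => zero_le) fun n => ?_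
    refine eLpNorm_le_mul_eLpNorm_of_ae_le_mul (Eventually.of_forall fun x => ?_) 2
    exact abs_le_of_abs_deriv_le hd hL _ _
  · have key : ∀ n, eLpNorm (gradient (fun x => θ (ψ n x)) - fun x => deriv θ (w x) • G x) 2
        (volume.restrict Ω) ≤ ENNReal.ofReal L * eLpNorm (gradient (ψ n) - G) 2
          (volume.restrict Ω) +
        eLpNorm (fun x => (deriv θ (ψ n x) - deriv θ (w x)) • G x) 2 (volume.restrict Ω) := by
      intro n
      have e : (gradient (fun x => θ (ψ n x)) - fun x => deriv θ (w x) • G x) =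
          (fun x => deriv θ (ψ n x) • (gradient (ψ n) x - G x)) +
            fun x => (deriv θ (ψ n x) - deriv θ (w x)) • G x := by
        ext1 x
        simp only [Pi.sub_apply, Pi.add_apply, gradient_comp_real hd (hψ n).differentiable]
        rw [smul_sub, sub_smul]; abel
      rw [e]
      refine (eLpNorm_add_le ?_ ?_ (by norm_num)).trans ?_
      · exact (hdc.comp (hψ n).smooth.continuous).aestronglyMeasurable.smul
          (((hψ n).memLp_gradient 2).1.sub hG.1)
      · exact ((hdc.comp (hψ n).smooth.continuous).aestronglyMeasurable.sub
          (hdc.comp_aestronglyMeasurable hw.1)).smul hG.1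
      · gcongr
        refine eLpNorm_le_mul_eLpNorm_of_ae_le_mul (Eventually.of_forall fun x => ?_) 2
        rw [norm_smul]
        exact mul_le_mul_of_nonneg_right (hL _) (norm_nonneg _)
    have h2 : Tendsto (fun n => eLpNorm (fun x => (deriv θ (ψ n x) - deriv θ (w x)) • G x) 2
        (volume.restrict Ω)) atTop (𝓝 0) := by
      refine tendsto_eLpNorm_two_zero_of_dominated (b := fun x => (2 * L) * ‖G x‖)
        (hG.norm.const_mul _) (fun n => ?_) (fun n => Eventually.of_forall fun x => ?_) ?_
      · exact ((hdc.comp (hψ n).smooth.continuous).aestronglyMeasurable.sub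
          (hdc.comp_aestronglyMeasurable hw.1)).smul hG.1
      · rw [norm_smul]
        gcongr
        calc ‖deriv θ (ψ n x) - deriv θ (w x)‖ ≤ _ := norm_sub_le _ _
          _ ≤ L + L := add_le_add (hL _) (hL _)
          _ = 2 * L := by ring
      · filter_upwards [hae] with x hx
        have : Tendsto (fun n => (deriv θ (ψ n x) - deriv θ (w x)) • G x) atTop
          (𝓝 ((deriv θ (w x) - deriv θ (w x)) • G x)) :=
          (((hdc.tendsto _).comp hx).sub_const _).smul_const _
        simpa using this
    have h1 := ENNReal.Tendsto.const_mul e2 (Or.inr (ENNReal.ofReal_ne_top (r := L)))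
    refine tendsto_of_tendsto_of_tendsto_of_le_of_le tendsto_const_nhds
      (by simpa using h1.add h2) (fun _ => zero_le) key
  · filter_upwards [hae] with x hx
    exact (hd.continuous.tendsto _).comp hx

/-- `F` operates on `H¹₀(Ω)` with the chain rule `∇F(w) = h(w) ∇w`. -/
def ChainRule (Ω : Set (E d)) (F h : ℝ → ℝ) : Prop :=
  ∀ (w : E d → ℝ) (G : E d → E d), MemH10 Ω w G →
    MemH10 Ω (fun x => F (w x)) (fun x => h (w x) • G x)

theorem MemH10.memLp_comp {w : E d → ℝ} {G : E d → E d} (H : MemH10 Ω w G) {F h : ℝ → ℝ} {L : ℝ}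
    (hF : Measurable F) (hm : Measurable h) (hF' : ∀ s, |F s| ≤ L * |s|) (hL : ∀ s, |h s| ≤ L) :
    MemLp (fun x => F (w x)) 2 (volume.restrict Ω) ∧
      MemLp (fun x => h (w x) • G x) 2 (volume.restrict Ω) := by
  obtain ⟨hw, hG, -⟩ := H
  constructor
  · exact MemLp.of_le_mul hw (hF.comp_aemeasurable hw.1.aemeasurable).aestronglyMeasurable
      (Eventually.of_forall fun x => hF' _)
  · refine MemLp.of_le_mul (c := L) hG
      ((hm.comp_aemeasurable hw.1.aemeasurable).aestronglyMeasurable.smul hG.1)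
      (Eventually.of_forall fun x => ?_)
    rw [norm_smul]
    exact mul_le_mul_of_nonneg_right (hL _) (norm_nonneg _)

/-- The chain rule passes to pointwise limits that are uniformly Lipschitz. -/
theorem ChainRule.of_tendsto {F h : ℝ → ℝ} {Fn hn : ℕ → ℝ → ℝ} {L : ℝ}
    (H : ∀ n, ChainRule Ω (Fn n) (hn n)) (hFm : ∀ n, Measurable (Fn n))
    (hhm : ∀ n, Measurable (hn n)) (hFL : ∀ n s, |Fn n s| ≤ L * |s|) (hhL : ∀ n s, |hn n s| ≤ L)
    (hF : ∀ s, Tendsto (fun n => Fn n s) atTop (𝓝 (F s)))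
    (hh : ∀ s, Tendsto (fun n => hn n s) atTop (𝓝 (h s))) : ChainRule Ω F h := by
  intro w G hwG
  have mF : Measurable F := measurable_of_tendsto_metrizable hFm (tendsto_pi_nhds.2 hF)
  have mh : Measurable h := measurable_of_tendsto_metrizable hhm (tendsto_pi_nhds.2 hh)
  have bF : ∀ s, |F s| ≤ L * |s| := fun s =>
    le_of_tendsto (hF s).abs (Eventually.of_forall fun n => hFL n s)
  have bh : ∀ s, |h s| ≤ L := fun s =>
    le_of_tendsto (hh s).abs (Eventually.of_forall fun n => hhL n s)
  obtain ⟨m1, m2⟩ := hwG.memLp_comp mF mh bF bh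
  have mn := fun n => hwG.memLp_comp (hFm n) (hhm n) (hFL n) (hhL n)
  obtain ⟨hw, hG, -⟩ := id hwG
  refine MemH10.of_tendsto m1 m2 (fun n => H n w G hwG) ?_ ?_
  · refine tendsto_eLpNorm_two_zero_of_dominated (b := fun x => (2 * L) * ‖w x‖)
      (hw.norm.const_mul _) (fun n => (mn n).1.1.sub m1.1)
      (fun n => Eventually.of_forall fun x => ?_) (Eventually.of_forall fun x => ?_)
    · calc ‖Fn n (w x) - F (w x)‖ ≤ |Fn n (w x)| + |F (w x)| := norm_sub_le _ _
        _ ≤ L * |w x| + L * |w x| := add_le_add (hFL _ _) (bF _)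
        _ = 2 * L * |w x| := by ring
    · simpa using (hF (w x)).sub_const (F (w x))
  · refine tendsto_eLpNorm_two_zero_of_dominated (b := fun x => (2 * L) * ‖G x‖)
      (hG.norm.const_mul _) (fun n => (mn n).2.1.sub m2.1)
      (fun n => Eventually.of_forall fun x => ?_) (Eventually.of_forall fun x => ?_)
    · simp only [Pi.sub_apply]
      rw [← sub_smul, norm_smul]
      gcongr
      calc ‖hn n (w x) - h (w x)‖ ≤ _ := norm_sub_le _ _
        _ ≤ L + L := add_le_add (hhL _ _) (bh _)
        _ = 2 * L := by ring
    · simpa using ((hh (w x)).smul_const (G x)).sub_const (h (w x) • G x)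

theorem contDiff_primitive {h : ℝ → ℝ} (hh : ContDiff ℝ ∞ h) :
    ContDiff ℝ ∞ (fun s => ∫ r in (0 : ℝ)..s, h r) := by
  have hd : ∀ s, HasDerivAt (fun s => ∫ r in (0 : ℝ)..s, h r) (h s) s := fun s =>
    intervalIntegral.integral_hasDerivAt_right (hh.continuous.intervalIntegrable _ _)
      hh.continuous.stronglyMeasurable.stronglyMeasurableAtFilter hh.continuous.continuousAt
  rw [contDiff_infty_iff_deriv]
  refine ⟨fun s => (hd s).differentiableAt, ?_⟩
  rwa [show deriv (fun s => ∫ r in (0 : ℝ)..s, h r) = h from funext fun s => (hd s).deriv]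

theorem chainRule_primitive_of_smooth {h : ℝ → ℝ} (hh : ContDiff ℝ ∞ h) {L : ℝ}
    (hL : ∀ s, |h s| ≤ L) : ChainRule Ω (fun s => ∫ r in (0 : ℝ)..s, h r) h := by
  have hd : deriv (fun s => ∫ r in (0 : ℝ)..s, h r) = h :=
    funext fun s => hh.continuous.deriv_integral h 0 s
  intro w G hwG
  obtain ⟨ψ, hψ, hψ', e1, e2, -⟩ := hwG.exists_seq_comp (contDiff_primitive hh) (by simp)
    (L := L) (by rwa [hd])
  rw [hd] at e2
  have bF : ∀ s, |∫ r in (0 : ℝ)..s, h r| ≤ L * |s| := fun s => by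
    simpa using intervalIntegral.norm_integral_le_of_norm_le_const (f := h) (a := 0) (b := s)
      (fun x _ => hL x)
  obtain ⟨m1, m2⟩ := hwG.memLp_comp (contDiff_primitive hh).continuous.measurable
    hh.continuous.measurable bF hL
  exact MemH10.of_tendsto m1 m2 (fun n => (hψ' n).memH10) e1 e2

/-- The chain rule for the primitive of a pointwise limit of uniformly bounded smooth
functions. -/
theorem chainRule_primitive_of_tendsto {h : ℝ → ℝ} {hn : ℕ → ℝ → ℝ} {L : ℝ}
    (hs : ∀ n, ContDiff ℝ ∞ (hn n)) (hL : ∀ n s, |hn n s| ≤ L)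
    (hh : ∀ s, Tendsto (fun n => hn n s) atTop (𝓝 (h s))) :
    ChainRule Ω (fun s => ∫ r in (0 : ℝ)..s, h r) h := by
  refine ChainRule.of_tendsto (L := L) (fun n => chainRule_primitive_of_smooth (hs n) (hL n))
    (fun n => (contDiff_primitive (hs n)).continuous.measurable)
    (fun n => (hs n).continuous.measurable) (fun n s => ?_) hL (fun s => ?_) hh
  · simpa using intervalIntegral.norm_integral_le_of_norm_le_const (f := hn n) (a := 0) (b := s)
      (fun x _ => hL n x)
  · refine intervalIntegral.tendsto_integral_filter_of_dominated_convergence (fun _ => L)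
      (Eventually.of_forall fun n => (hs n).continuous.aestronglyMeasurable)
      (Eventually.of_forall fun n => Eventually.of_forall fun x _ => hL n x)
      intervalIntegrable_const (Eventually.of_forall fun x _ => hh x)

theorem ClassP.eq_integral {S : ℝ → ℝ} (hS : ClassP S) (s : ℝ) :
    ∫ r in (0 : ℝ)..s, deriv S r = S s := by
  rw [intervalIntegral.integral_deriv_eq_sub
    (fun x _ => hS.contDiff.differentiable (by norm_num) x)
    ((hS.contDiff.continuous_deriv (by norm_num)).intervalIntegrable _ _), hS.map_zero, sub_zero]

/-- The derivative of a function in `𝒫` is uniformly continuous, hence a uniform limit of smooth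
functions. -/
theorem ClassP.chainRule {S : ℝ → ℝ} (hS : ClassP S) : ChainRule Ω S (deriv S) := by
  have hc : Continuous (deriv S) := hS.contDiff.continuous_deriv (by norm_num)
  have huc : UniformContinuous (deriv S) := hS.compact.uniformContinuous_of_continuous hc
  choose hn hs hd using fun n : ℕ =>
    huc.exists_contDiff_dist_le (ε := 1 / ((n : ℝ) + 1)) (by positivity)
  have e : S = fun s => ∫ r in (0 : ℝ)..s, deriv S r := funext fun s => (hS.eq_integral s).symm
  rw [show ChainRule Ω S (deriv S) = ChainRule Ω (fun s => ∫ r in (0 : ℝ)..s, deriv S r) (deriv S)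
    by rw [← e]]
  refine chainRule_primitive_of_tendsto (L := 2) hs (fun n s => ?_) (fun s => ?_)
  · have h1 := hd n s
    have h2 : (1 : ℝ) / (n + 1) ≤ 1 := by
      rw [div_le_one (by positivity)]; linarith [(Nat.cast_nonneg n : (0 : ℝ) ≤ n)]
    rw [Real.dist_eq] at h1
    have h3 := abs_lt.1 h1
    rw [abs_le]
    constructor <;> linarith [hS.deriv_nonneg s, hS.deriv_le_one s]
  · rw [tendsto_iff_dist_tendsto_zero]
    exact squeeze_zero (fun _ => dist_nonneg) (fun n => (hd n s).le)
      tendsto_one_div_add_atTop_nhds_zero_nat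

theorem abs_trunc_le {K : ℝ} (hK : 0 < K) (s : ℝ) : |trunc K s| ≤ |s| := by
  unfold trunc
  rcases le_total 0 s with h | h
  · rw [abs_of_nonneg h, abs_le]
    exact ⟨by linarith [le_max_right (-K) (min K s), le_min hK.le h], max_le (by linarith)
      (min_le_right _ _)⟩
  · rw [abs_of_nonpos h, abs_le]
    have : min K s = s := min_eq_right (h.trans hK.le)
    rw [this]
    exact ⟨by linarith [le_max_right (-K) s], max_le (by linarith) (by linarith)⟩

/-- `T_K` is the primitive of the indicator of `(-K, K)`; it fails to be differentiable at `±K`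
only. -/
theorem integral_indicator_ball {K : ℝ} (hK : 0 < K) (s : ℝ) :
    ∫ r in (0 : ℝ)..s, {r : ℝ | |r| < K}.indicator (fun _ => (1 : ℝ)) r = trunc K s := by
  have hc : Continuous (trunc K) := by unfold trunc; fun_prop
  have hd : ∀ x, |x| ≠ K → HasDerivAt (trunc K)
      ({r : ℝ | |r| < K}.indicator (fun _ => (1 : ℝ)) x) x := by
    intro x hx
    rcases lt_or_gt_of_ne hx with h | h
    · rw [indicator_of_mem (by exact h)]
      refine (hasDerivAt_id x).congr_of_eventuallyEq ?_
      filter_upwards [(isOpen_lt continuous_abs continuous_const).mem_nhds h] with y hy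
      have := abs_lt.1 hy
      simp [trunc, this.1.le, this.2.le]
    · rw [indicator_of_notMem (by simpa using h.le)]
      rcases lt_abs.1 h with h | h
      · refine (hasDerivAt_const x K).congr_of_eventuallyEq ?_
        filter_upwards [lt_mem_nhds h] with y hy
        simp [trunc, hy.le]; linarith
      · refine (hasDerivAt_const x (-K)).congr_of_eventuallyEq ?_
        filter_upwards [gt_mem_nhds (show x < -K by linarith)] with y hy
        simp [trunc, hy.le]
  have hi : IntervalIntegrable ({r : ℝ | |r| < K}.indicator (fun _ => (1 : ℝ))) volume 0 s := by
    refine (intervalIntegrable_const (c := (1 : ℝ))).mono_fun' ?_ ?_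
    · exact (measurable_const.indicator
        (isOpen_lt continuous_abs continuous_const).measurableSet).aestronglyMeasurable
    · refine Eventually.of_forall fun x => ?_
      by_cases h : |x| < K <;> simp [indicator, h]
  rw [MeasureTheory.integral_eq_of_hasDerivAt_off_countable (s := {K, -K}) (trunc K) _
    (by simp : ({K, -K} : Set ℝ).Countable) hc.continuousOn (fun x hx => hd x ?_) hi]
  · simp [trunc, hK.le]
  · intro h
    rcases (abs_eq hK.le).1 h with h | h <;> simp [h] at hx

/-- Stampacchia's chain rule for truncations: the indicator of `(-K, K)` is a pointwise limit of
smooth bump functions supported in `(-K, K)`. -/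
theorem chainRule_trunc {K : ℝ} (hK : 0 < K) :
    ChainRule Ω (trunc K) ({r : ℝ | |r| < K}.indicator fun _ => 1) := by
  have e : trunc K = fun s => ∫ r in (0 : ℝ)..s, {r : ℝ | |r| < K}.indicator (fun _ => (1 : ℝ)) r :=
    funext fun s => (integral_indicator_ball hK s).symm
  rw [e]
  have hlt : ∀ n : ℕ, K * (1 - 1 / ((n : ℝ) + 2)) < K := fun n => by
    have : 0 < 1 / ((n : ℝ) + 2) := by positivity
    nlinarith
  have hpos : ∀ n : ℕ, 0 < K * (1 - 1 / ((n : ℝ) + 2)) := fun n => by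
    have : 1 / ((n : ℝ) + 2) < 1 := by
      rw [div_lt_one (by positivity)]; linarith [(Nat.cast_nonneg n : (0 : ℝ) ≤ n)]
    exact mul_pos hK (by linarith)
  let B : ℕ → ContDiffBump (0 : ℝ) := fun n => ⟨_, K, hpos n, hlt n⟩
  refine chainRule_primitive_of_tendsto (L := 1) (hn := fun n => B n)
    (fun n => (B n).contDiff) (fun n s => ?_) (fun s => ?_)
  · rw [abs_of_nonneg (B n).nonneg]; exact (B n).le_one
  · by_cases h : |s| < K
    · rw [indicator_of_mem (by exact h)]
      refine tendsto_const_nhds.congr' ?_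
      have : Tendsto (fun n : ℕ => K * (1 - 1 / ((n : ℝ) + 2))) atTop (𝓝 (K * (1 - 0))) := by
        refine (tendsto_const_nhds.sub ?_).const_mul K
        have := (tendsto_one_div_add_atTop_nhds_zero_nat (𝕜 := ℝ)).comp (tendsto_add_atTop_nat 1)
        refine this.congr fun n => ?_
        simp only [Function.comp_apply]; push_cast; ring
      rw [sub_zero, mul_one] at this
      filter_upwards [this.eventually_const_lt h] with n hn
      exact ((B n).one_of_mem_closedBall (by
        rw [mem_closedBall_zero_iff]; exact hn.le)).symm
    · rw [indicator_of_notMem (by exact h)]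
      refine tendsto_const_nhds.congr fun n => ?_
      exact ((B n).zero_of_le_dist (by simpa using h)).symm

/-- A smooth bounded function with bounded derivative which is the identity on `[-M, M]`. -/
theorem exists_smooth_truncation {M : ℝ} (hM : 0 ≤ M) : ∃ (θ : ℝ → ℝ) (C : ℝ), ContDiff ℝ ∞ θ ∧
    θ 0 = 0 ∧ (∀ s, |deriv θ s| ≤ 1) ∧ (∀ s, |θ s| ≤ C) ∧
    ∀ s, |s| ≤ M → θ s = s ∧ deriv θ s = 1 := by
  let B : ContDiffBump (0 : ℝ) := ⟨M + 1, M + 2, by linarith, by linarith⟩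
  have hB : ContDiff ℝ ∞ B := B.contDiff
  have hd : deriv (fun s => ∫ r in (0 : ℝ)..s, B r) = B :=
    funext fun s => hB.continuous.deriv_integral B 0 s
  have hi : Integrable B := hB.continuous.integrable_of_hasCompactSupport B.hasCompactSupport
  refine ⟨fun s => ∫ r in (0 : ℝ)..s, B r, ∫ r, ‖B r‖, contDiff_primitive hB, by simp, ?_, ?_, ?_⟩
  · intro s
    rw [hd, abs_of_nonneg B.nonneg]; exact B.le_one
  · intro s
    refine (intervalIntegral.norm_integral_le_integral_norm_uIoc (f := B) (a := 0)
      (b := s)).trans ?_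
    exact setIntegral_le_integral hi.norm (Eventually.of_forall fun _ => norm_nonneg _)
  · intro s hs
    have h1 : ∀ r, |r| ≤ M → B r = 1 := fun r hr =>
      B.one_of_mem_closedBall (by simp [B]; linarith)
    rw [hd]
    refine ⟨?_, h1 s hs⟩
    have : ∫ r in (0 : ℝ)..s, B r = ∫ r in (0 : ℝ)..s, (1 : ℝ) := by
      refine intervalIntegral.integral_congr fun r hr => h1 r ?_
      have := abs_sub_left_of_mem_uIcc hr
      simp only [sub_zero] at this
      linarith
    simp [this]

end Sobolev

/-! ### Convolution in time on the cylinder -/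

section TimeConvolution

theorem ae_fst_mem_Ioo {X : Type*} [MeasurableSpace X] {μ : Measure X} {T : ℝ} :
    ∀ᵐ z ∂((volume.restrict (Ioo 0 T)).prod μ), z.1 ∈ Ioo 0 T :=
  Measure.quasiMeasurePreserving_fst.ae (ae_restrict_mem measurableSet_Ioo)

section Kernel

variable {X : Type*} [MeasurableSpace X] {μ : Measure X} [SFinite μ] {T : ℝ}

theorem integrable_indicator_uncurry {w : ℝ → X → ℝ}
    (hw : Integrable (Function.uncurry w) ((volume.restrict (Ioo 0 T)).prod μ)) :
    Integrable (fun p : ℝ × X => (Ioo 0 T).indicator (fun s => w s p.2) p.1)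
      (volume.prod μ) := by
  have e : (fun p : ℝ × X => (Ioo 0 T).indicator (fun s => w s p.2) p.1) =
      (Ioo 0 T ×ˢ univ).indicator (Function.uncurry w) := by
    ext1 ⟨t, x⟩
    by_cases ht : t ∈ Ioo 0 T
    · rw [indicator_of_mem ht, indicator_of_mem (by exact ⟨ht, mem_univ _⟩)]; rfl
    · rw [indicator_of_notMem ht, indicator_of_notMem (fun h => ht h.1)]
  rw [e, integrable_indicator_iff (measurableSet_Ioo.prod MeasurableSet.univ), IntegrableOn,
    ← Measure.prod_restrict, Measure.restrict_univ]
  exact hw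

theorem integrable_conv_integrand {κ : ℝ → ℝ} {w : ℝ → X → ℝ}
    (hκ : Integrable κ) (hw : Integrable (Function.uncurry w) (volume.prod μ)) :
    Integrable (fun p : (ℝ × X) × ℝ => κ (p.1.1 - p.2) * w p.2 p.1.2)
      ((volume.prod μ).prod volume) := by
  have h1 : Integrable (fun p : (ℝ × X) × ℝ => w p.1.1 p.1.2 * κ p.2)
      ((volume.prod μ).prod volume) := Integrable.mul_prod hw hκ
  -- the change of variables `(t, x, s) ↦ (s, x, t - s)` preserves the measure
  have mp1 : MeasurePreserving (fun p : (ℝ × X) × ℝ => (p.1, p.2 - p.1.1))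
      ((volume.prod μ).prod volume) ((volume.prod μ).prod volume) := by
    refine (MeasurePreserving.id _).skew_product (g := fun (a : ℝ × X) (b : ℝ) => b - a.1)
      (by fun_prop) (Eventually.of_forall fun a => ?_)
    exact (measurePreserving_sub_right volume a.1).map_eq
  have mp2 : MeasurePreserving (fun p : (ℝ × X) × ℝ => ((p.2, p.1.2), p.1.1))
      ((volume.prod μ).prod volume) ((volume.prod μ).prod volume) := by
    have a1 := measurePreserving_prodAssoc (volume : Measure ℝ) μ (volume : Measure ℝ)
    have a2 : MeasurePreserving (Prod.map id Prod.swap : ℝ × X × ℝ → ℝ × ℝ × X)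
      (volume.prod (μ.prod volume)) (volume.prod (volume.prod μ)) :=
      (MeasurePreserving.id _).prod Measure.measurePreserving_swap
    have a3 : MeasurePreserving (Prod.swap : ℝ × ℝ × X → (ℝ × X) × ℝ)
      (volume.prod (volume.prod μ)) ((volume.prod μ).prod volume) :=
      Measure.measurePreserving_swap
    exact a3.comp (a2.comp a1)
  have := (mp1.comp mp2).integrable_comp_of_integrable h1
  refine this.congr (Eventually.of_forall fun p => ?_)
  simp [Function.comp, mul_comm]

/-- Extending both factors by zero, the causal convolution is a convolution on `ℝ`. -/
theorem integral_indicator_conv {κ : ℝ → ℝ} {w : ℝ → ℝ} {t : ℝ} (ht : t ∈ Ioo 0 T) :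
    ∫ s, (Ioo 0 T).indicator κ (t - s) * (Ioo 0 T).indicator w s =
      ∫ s in (0 : ℝ)..t, κ (t - s) * w s := by
  rw [intervalIntegral.integral_of_le ht.1.le, integral_Ioc_eq_integral_Ioo,
    ← integral_indicator measurableSet_Ioo]
  congr 1 with s
  by_cases hs : s ∈ Ioo 0 t
  · rw [indicator_of_mem hs,
      indicator_of_mem (by exact ⟨by linarith [hs.2], by linarith [hs.1, ht.2]⟩),
      indicator_of_mem (by exact ⟨hs.1, hs.2.trans ht.2⟩)]
  · rw [indicator_of_notMem hs]
    rcases not_and_or.1 hs with h | h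
    · rw [indicator_of_notMem (fun h' : s ∈ Ioo 0 T => h h'.1), mul_zero]
    · rw [indicator_of_notMem (fun h' : t - s ∈ Ioo 0 T => h (by linarith [h'.1])), zero_mul]

theorem integrable_conv {κ : ℝ → ℝ} {w : ℝ → X → ℝ} (hκ : IntegrableOn κ (Ioo 0 T))
    (hw : Integrable (Function.uncurry w) ((volume.restrict (Ioo 0 T)).prod μ)) :
    Integrable (fun z : ℝ × X => ∫ τ in (0 : ℝ)..z.1, κ (z.1 - τ) * w τ z.2)
      ((volume.restrict (Ioo 0 T)).prod μ) := by
  have h := (integrable_conv_integrand ((integrable_indicator_iff measurableSet_Ioo).2 hκ)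
    (w := fun s x => (Ioo 0 T).indicator (fun s => w s x) s)
    (integrable_indicator_uncurry hw)).integral_prod_left
  have h2 := h.restrict (s := Ioo 0 T ×ˢ univ)
  rw [← Measure.prod_restrict, Measure.restrict_univ] at h2
  refine h2.congr ?_
  filter_upwards [ae_fst_mem_Ioo] with z hz
  exact integral_indicator_conv hz

theorem ae_intervalIntegrable_conv {κ : ℝ → ℝ} {w : ℝ → X → ℝ} (hκ : IntegrableOn κ (Ioo 0 T))
    (hw : Integrable (Function.uncurry w) ((volume.restrict (Ioo 0 T)).prod μ)) :
    ∀ᵐ z ∂((volume.restrict (Ioo 0 T)).prod μ),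
      IntervalIntegrable (fun τ => κ (z.1 - τ) * w τ z.2) volume 0 z.1 := by
  have h := (integrable_conv_integrand ((integrable_indicator_iff measurableSet_Ioo).2 hκ)
    (w := fun s x => (Ioo 0 T).indicator (fun s => w s x) s)
    (integrable_indicator_uncurry hw)).prod_right_ae
  have h2 := ae_restrict_of_ae (s := Ioo 0 T ×ˢ univ) h
  rw [← Measure.prod_restrict, Measure.restrict_univ] at h2
  filter_upwards [ae_fst_mem_Ioo, h2] with z hz hi
  rw [intervalIntegrable_iff_integrableOn_Ioo_of_le hz.1.le]
  refine hi.integrableOn.congr_fun (fun s hs => ?_) measurableSet_Ioo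
  simp only
  rw [indicator_of_mem (by exact ⟨by linarith [hs.2], by linarith [hs.1, hz.2]⟩),
      indicator_of_mem (by exact ⟨hs.1, hs.2.trans hz.2⟩)]

theorem integrable_primitive {g : ℝ → X → ℝ}
    (hg : Integrable (Function.uncurry g) ((volume.restrict (Ioo 0 T)).prod μ)) :
    Integrable (fun z : ℝ × X => ∫ τ in (0 : ℝ)..z.1, g τ z.2)
      ((volume.restrict (Ioo 0 T)).prod μ) := by
  simpa using integrable_conv (κ := fun _ => 1) (by simp) hg

theorem lintegral_eLpNorm_one {g : ℝ → X → ℝ} {ν : Measure ℝ} [SFinite ν]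
    (hg : AEStronglyMeasurable (Function.uncurry g) (ν.prod μ)) :
    ∫⁻ t, eLpNorm (g t) 1 μ ∂ν = ∫⁻ z, ‖Function.uncurry g z‖ₑ ∂(ν.prod μ) := by
  rw [lintegral_prod _ hg.enorm]
  simp [eLpNorm_one_eq_lintegral_enorm]

end Kernel

variable {d : ℕ} {Ω : Set (E d)} {T : ℝ}

theorem restrict_cyl : (volume : Measure (ℝ × E d)).restrict (cyl T Ω) =
    (volume.restrict (Ioo 0 T)).prod (volume.restrict Ω) := by
  rw [cyl, Measure.prod_restrict]; rfl

theorem memL1Lq_one_iff {g : ℝ → E d → ℝ} :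
    MemL1Lq 1 T Ω g ↔ IntegrableOn (Function.uncurry g) (cyl T Ω) := by
  rw [IntegrableOn]
  constructor
  · rintro ⟨h1, h2⟩
    refine ⟨h1, ?_⟩
    rw [restrict_cyl] at h1 ⊢
    rwa [lintegral_eLpNorm_one h1] at h2
  · rintro h
    refine ⟨h.1, ?_⟩
    rw [restrict_cyl] at h
    rw [lintegral_eLpNorm_one h.1]
    exact h.2

/-- Integration by parts against the primitive of an integrable function. -/
theorem integral_deriv_mul_primitive {θ g : ℝ → ℝ} (hT : 0 < T) (hθ : ContDiff ℝ 1 θ)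
    (h0 : θ T = 0) (hg : IntegrableOn g (Ioo 0 T)) :
    ∫ t in Ioo 0 T, deriv θ t * ∫ s in (0 : ℝ)..t, g s = -∫ t in Ioo 0 T, θ t * g t := by
  have hgi : IntervalIntegrable g volume 0 T :=
    (intervalIntegrable_iff_integrableOn_Ioo_of_le hT.le).2 hg
  have hθd : Differentiable ℝ θ := hθ.differentiable (by norm_num)
  have hθi : IntervalIntegrable (deriv θ) volume 0 T :=
    (hθ.continuous_deriv (by norm_num)).intervalIntegrable _ _
  have ac1 : AbsolutelyContinuousOnInterval θ 0 T := by
    have h1 := hθi.absolutelyContinuousOnInterval_intervalIntegral (c := 0) (by simp)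
    obtain ⟨K, hK⟩ := (hθ.locallyLipschitz).locallyLipschitzOn.exists_lipschitzOnWith_of_compact
      (s := uIcc 0 T) isCompact_uIcc
    exact hK.absolutelyContinuousOnInterval
  have ac2 := hgi.absolutelyContinuousOnInterval_intervalIntegral (c := 0) (by simp)
  -- both factors are absolutely continuous
  have key := ac1.integral_deriv_mul_eq_sub ac2
  have e : ∫ t in (0 : ℝ)..T, deriv θ t * (∫ s in (0 : ℝ)..t, g s) +
      θ t * deriv (fun t => ∫ s in (0 : ℝ)..t, g s) t =
      ∫ t in (0 : ℝ)..T, deriv θ t * (∫ s in (0 : ℝ)..t, g s) + θ t * g t := by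
    refine intervalIntegral.integral_congr_ae ?_
    filter_upwards [hgi.ae_hasDerivAt_integral] with t ht hm
    rw [(ht (uIoc_subset_uIcc hm) 0 (by simp)).deriv]
  rw [e, intervalIntegral.integral_add] at key
  · simp only [h0, zero_mul, intervalIntegral.integral_same, mul_zero, sub_zero] at key
    rw [intervalIntegral.integral_of_le hT.le, integral_Ioc_eq_integral_Ioo,
      intervalIntegral.integral_of_le hT.le, integral_Ioc_eq_integral_Ioo] at key
    linarith
  · exact hθi.mul_continuousOn ac2.continuousOn
  · exact hgi.continuousOn_mul hθ.continuous.continuousOn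

end TimeConvolution

/-! ### Non-increasing kernels -/

section Kernels

/-- A bounded non-increasing kernel is almost everywhere the tail of a finite measure on
`[0, ∞)`, namely of its Stieltjes measure. -/
theorem exists_tail_measure {κ : ℝ → ℝ} {T C : ℝ} (hT : 0 < T) (hκ : AntitoneOn κ (Ioo 0 T))
    (h0 : ∀ t ∈ Ioo 0 T, 0 ≤ κ t) (hC : ∀ t ∈ Ioo 0 T, κ t ≤ C) :
    ∃ ν : Measure ℝ, IsFiniteMeasure ν ∧ ν (Iio 0) = 0 ∧ ν.real univ = C ∧
      ∀ᵐ t ∂(volume.restrict (Ioo 0 T)), ν.real (Ioi t) = κ t := by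
  have hC0 : 0 ≤ C := by
    have h : T / 2 ∈ Ioo 0 T := ⟨by linarith, by linarith⟩
    exact (h0 _ h).trans (hC _ h)
  -- the distribution function of `ν`: it jumps from `-C` to `-κ(0⁺)` at `0`, and from `-κ(T⁻)` to `0` at `T`
  let F : ℝ → ℝ := fun t => if t ≤ 0 then -C else if t < T then -κ t else 0
  have F1 : ∀ t, t ≤ 0 → F t = -C := fun t ht => if_pos ht
  have F2 : ∀ t ∈ Ioo 0 T, F t = -κ t := fun t ht => by
    simp only [F]; rw [if_neg (not_le.2 ht.1), if_pos ht.2]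
  have F3 : ∀ t, T ≤ t → F t = 0 := fun t ht => by
    simp only [F]; rw [if_neg (by linarith), if_neg (by linarith)]
  have hF : Monotone F := by
    intro s t hst
    rcases le_or_gt s 0 with hs | hs
    · rw [F1 s hs]
      rcases le_or_gt t 0 with ht | ht
      · rw [F1 t ht]
      · rcases lt_or_ge t T with ht' | ht'
        · rw [F2 t ⟨ht, ht'⟩]; linarith [hC t ⟨ht, ht'⟩]
        · rw [F3 t ht']; linarith
    · rcases lt_or_ge t T with ht' | ht'
      · have a1 : s ∈ Ioo 0 T := ⟨hs, hst.trans_lt ht'⟩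
        have a2 : t ∈ Ioo 0 T := ⟨hs.trans_le hst, ht'⟩
        rw [F2 _ a1, F2 _ a2]
        linarith [hκ a1 a2 hst]
      · rw [F3 t ht']
        rcases lt_or_ge s T with hs' | hs'
        · rw [F2 s ⟨hs, hs'⟩]; linarith [h0 s ⟨hs, hs'⟩]
        · rw [F3 s hs']
  have hcont : ∀ t, ContinuousAt F t → hF.stieltjesFunction t = F t := fun t ht => by
    rw [hF.stieltjesFunction_eq]
    exact ht.continuousWithinAt.rightLim_eq
  have hS1 : ∀ t, t < 0 → hF.stieltjesFunction t = -C := fun t ht => by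
    rw [hcont t, F1 t ht.le]
    refine (continuousAt_const (y := -C)).congr ?_
    filter_upwards [gt_mem_nhds ht] with s hs using (F1 s hs.le).symm
  have hS3 : ∀ t, T < t → hF.stieltjesFunction t = 0 := fun t ht => by
    rw [hcont t, F3 t ht.le]
    refine (continuousAt_const (y := (0 : ℝ))).congr ?_
    filter_upwards [lt_mem_nhds ht] with s hs using (F3 s hs.le).symm
  have lbot : Tendsto hF.stieltjesFunction atBot (𝓝 (-C)) :=
    tendsto_const_nhds.congr' (by
      filter_upwards [eventually_lt_atBot 0] with t ht using (hS1 t ht).symm)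
  have ltop : Tendsto hF.stieltjesFunction atTop (𝓝 0) :=
    tendsto_const_nhds.congr' (by
      filter_upwards [eventually_gt_atTop T] with t ht using (hS3 t ht).symm)
  have hll : Function.leftLim hF.stieltjesFunction 0 = -C := by
    refine leftLim_eq_of_tendsto (tendsto_const_nhds.congr' ?_)
    filter_upwards [self_mem_nhdsWithin] with t ht using (hS1 t ht).symm
  refine ⟨hF.stieltjesFunction.measure, hF.stieltjesFunction.isFiniteMeasure lbot ltop, ?_, ?_, ?_⟩
  · rw [StieltjesFunction.measure_Iio _ lbot, hll]; simp
  · rw [Measure.real, StieltjesFunction.measure_univ _ lbot ltop]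
    simp [hC0]
  · have hco : ∀ᵐ t : ℝ, ContinuousAt F t := by
      have := hF.countable_not_continuousAt.measure_zero (volume : Measure ℝ)
      exact measure_eq_zero_iff_ae_notMem.1 this |>.mono fun t ht => by simpa using ht
    filter_upwards [ae_restrict_of_ae hco, ae_restrict_mem measurableSet_Ioo] with t ht htm
    rw [Measure.real, StieltjesFunction.measure_Ioi _ ltop, hcont t ht, F2 t htm]
    simp [h0 t htm]

theorem integrable_shift {Y : Type*} [MeasurableSpace Y] {m : Measure Y} [SFinite m]
    {ν : Measure ℝ} [IsFiniteMeasure ν] {w : Y → ℝ} (hw : Integrable w m) {σ : ℝ → Y → Y}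
    (hσ : Measurable (Function.uncurry σ)) (hp : ∀ r, MeasurePreserving (σ r) m m) :
    Integrable (fun p : Y × ℝ => w (σ p.2 p.1)) (m.prod ν) := by
  have mp : MeasurePreserving (fun p : ℝ × Y => (p.1, σ p.1 p.2)) (ν.prod m) (ν.prod m) :=
    (MeasurePreserving.id ν).skew_product hσ (Eventually.of_forall fun r => (hp r).map_eq)
  have := (hw.comp_snd ν)
  exact ((mp.integrable_comp_of_integrable this)).swap

/-- By Fubini's theorem, the integral of `e` with the weight `s ↦ ν(A_s)`, where `A_s` is a section
of `A`, is the `ν`-average of the integrals of `e` over the sections of `A` in the other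
direction. -/
theorem integral_measureReal_mul {m ν : Measure ℝ} [SFinite m] [IsFiniteMeasure ν] {e : ℝ → ℝ}
    (he : Integrable e m) {A : Set (ℝ × ℝ)} (hA : MeasurableSet A) :
    ∫ s, ν.real (Prod.mk s ⁻¹' A) * e s ∂m =
      ∫ r, ∫ s, A.indicator (fun p => e p.1) (s, r) ∂m ∂ν := by
  rw [← integral_integral_swap (f := fun s r => A.indicator (fun p => e p.1) (s, r))]
  · congr 1 with s
    have : (fun r => A.indicator (fun p => e p.1) (s, r)) =
        (Prod.mk s ⁻¹' A).indicator (fun _ => e s) := by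
      ext r; rfl
    rw [this, integral_indicator (measurable_prodMk_left hA)]
    simp
  · exact (he.comp_fst ν).indicator hA

variable {κ : ℝ → ℝ} {T C : ℝ}

/-- A bounded non-increasing kernel is positive against functions all of whose integrals up to
the final time are non-negative. -/
theorem integral_conv_nonneg_of_bounded {e : ℝ → ℝ} {t : ℝ} (ht : t ∈ Ioo 0 T)
    (hκ : AntitoneOn κ (Ioo 0 T)) (h0 : ∀ t ∈ Ioo 0 T, 0 ≤ κ t) (hC : ∀ t ∈ Ioo 0 T, κ t ≤ C)
    (he : Continuous e) (hpos : ∀ r ∈ Icc 0 t, 0 ≤ ∫ s in r..t, e s) :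
    0 ≤ ∫ s in (0 : ℝ)..t, κ (t - s) * e s := by
  obtain ⟨ν, hν, -, -, hνt⟩ := exists_tail_measure (ht.1.trans ht.2) hκ h0 hC
  have hae : ∀ᵐ s ∂(volume.restrict (Ioo 0 t)), ν.real (Ioi (t - s)) = κ (t - s) := by
    rw [ae_restrict_iff' measurableSet_Ioo] at hνt ⊢
    have := (Measure.measurePreserving_sub_left volume t).quasiMeasurePreserving.ae hνt
    filter_upwards [this] with s hs hst
    exact hs ⟨by linarith [hst.2], by linarith [hst.1, ht.2]⟩
  rw [intervalIntegral.integral_of_le ht.1.le, integral_Ioc_eq_integral_Ioo]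
  have e1 : ∫ s in Ioo 0 t, κ (t - s) * e s = ∫ s in Ioo 0 t,
      ν.real (Prod.mk s ⁻¹' {p : ℝ × ℝ | t - p.1 < p.2}) * e s := by
    refine integral_congr_ae ?_
    filter_upwards [hae] with s hs
    rw [← hs]; rfl
  have hei : Integrable e (volume.restrict (Ioo 0 t)) :=
    (intervalIntegrable_iff_integrableOn_Ioo_of_le ht.1.le).1 (he.intervalIntegrable _ _)
  rw [e1, integral_measureReal_mul hei (measurableSet_lt (by fun_prop) (by fun_prop))]
  refine integral_nonneg fun r => ?_
  have e2 : (fun s => {p : ℝ × ℝ | t - p.1 < p.2}.indicator (fun p => e p.1) (s, r)) =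
      (Ioi (t - r)).indicator e := by
    ext s
    simp only [indicator, mem_ofPred_eq, mem_Ioi, sub_lt_comm]
  simp only [Pi.zero_apply]
  rw [e2, integral_indicator measurableSet_Ioi, Measure.restrict_restrict measurableSet_Ioi]
  rcases le_or_gt (max 0 (t - r)) t with hr | hr
  · have : Ioi (t - r) ∩ Ioo 0 t = Ioo (max 0 (t - r)) t := by
      ext s; simp only [mem_inter_iff, mem_Ioi, mem_Ioo, max_lt_iff]; tauto
    rw [this, ← integral_Ioc_eq_integral_Ioo, ← intervalIntegral.integral_of_le hr]
    exact hpos _ ⟨le_max_left _ _, hr⟩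
  · have : Ioi (t - r) ∩ Ioo 0 t = ∅ := by
      ext s
      simp only [mem_inter_iff, mem_Ioi, mem_Ioo, mem_empty_iff_false, iff_false]
      rintro ⟨h1, h2, h3⟩
      rcases lt_max_iff.1 hr with h | h <;> linarith
    simp [this]

/-- For an unbounded kernel the positivity follows by truncation from above. -/
theorem integral_conv_nonneg {e : ℝ → ℝ} {t : ℝ} (ht : t ∈ Ioo 0 T)
    (hκ : AntitoneOn κ (Ioo 0 T)) (h0 : ∀ t ∈ Ioo 0 T, 0 ≤ κ t) (hi : IntegrableOn κ (Ioo 0 T))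
    (he : Continuous e) (hpos : ∀ r ∈ Icc 0 t, 0 ≤ ∫ s in r..t, e s) :
    0 ≤ ∫ s in (0 : ℝ)..t, κ (t - s) * e s := by
  have hit : IntervalIntegrable (fun s => κ (t - s)) volume 0 t := by
    have : IntervalIntegrable κ volume 0 t :=
      (intervalIntegrable_iff_integrableOn_Ioo_of_le ht.1.le).2
        (hi.mono_set (Ioo_subset_Ioo_right ht.2.le))
    simpa using (this.comp_sub_left t).symm
  have hie : IntervalIntegrable (fun s => κ (t - s) * e s) volume 0 t :=
    hit.mul_continuousOn he.continuousOn
  have hlim : Tendsto (fun n : ℕ => ∫ s in (0 : ℝ)..t, min (κ (t - s)) n * e s) atTop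
      (𝓝 (∫ s in (0 : ℝ)..t, κ (t - s) * e s)) := by
    refine intervalIntegral.tendsto_integral_filter_of_dominated_convergence
      (fun s => ‖κ (t - s) * e s‖) (Eventually.of_forall fun n => ?_)
      (Eventually.of_forall fun n => ?_) hie.norm (Eventually.of_forall fun s _ => ?_)
    · have h1 : AEStronglyMeasurable (fun s => κ (t - s)) (volume.restrict (uIoc 0 t)) :=
        (intervalIntegrable_iff.1 hit).1
      exact (h1.inf aestronglyMeasurable_const).mul he.aestronglyMeasurable
    · -- at `s = t` the kernel is evaluated at `0`, where nothing is known about it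
      have hne : ∀ᵐ s : ℝ, s ≠ t := by simp [ae_iff, measure_singleton]
      filter_upwards [hne] with s hs hst
      rw [uIoc_of_le ht.1.le] at hst
      have h2 := h0 (t - s) ⟨sub_pos.2 (lt_of_le_of_ne hst.2 hs), by linarith [hst.1, ht.2]⟩
      rw [norm_mul, norm_mul]
      gcongr
      rw [Real.norm_of_nonneg h2, Real.norm_of_nonneg (le_min h2 (Nat.cast_nonneg n))]
      exact min_le_left _ _
    · refine tendsto_const_nhds.congr' ?_
      filter_upwards [eventually_ge_atTop ⌈κ (t - s)⌉₊] with n hn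
      rw [min_eq_left ((Nat.le_ceil _).trans (by exact_mod_cast hn))]
  refine ge_of_tendsto' hlim fun n => ?_
  exact integral_conv_nonneg_of_bounded (κ := fun s => min (κ s) n) (C := n) ht
    (fun a ha b hb hab => min_le_min_right _ (hκ ha hb hab))
    (fun a ha => le_min (h0 a ha) (Nat.cast_nonneg n)) (fun a _ => min_le_right _ _) he hpos

/-- If `κ` is the tail of `ν`, then `∂ₜ(κ ∗ w) = ν(ℝ) w - ν ∗ w`. -/
theorem integral_sub_shift_eq_conv {ν : Measure ℝ} [IsFiniteMeasure ν] (hν : ν (Iio 0) = 0)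
    (hνt : ∀ᵐ t ∂(volume.restrict (Ioo 0 T)), ν.real (Ioi t) = κ t) {w : ℝ → ℝ}
    (hw : Integrable w) (hw0 : ∀ t, t ≤ 0 → w t = 0) {t : ℝ} (ht : t ∈ Ioo 0 T) :
    ∫ s in (0 : ℝ)..t, (ν.real univ * w s - ∫ r, w (s - r) ∂ν) =
      ∫ s in (0 : ℝ)..t, κ (t - s) * w s := by
  have hae : ∀ᵐ s ∂(volume.restrict (Ioo 0 t)), ν.real (Ioi (t - s)) = κ (t - s) := by
    rw [ae_restrict_iff' measurableSet_Ioo] at hνt ⊢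
    have := (Measure.measurePreserving_sub_left volume t).quasiMeasurePreserving.ae hνt
    filter_upwards [this] with s hs hst
    exact hs ⟨by linarith [hst.2], by linarith [hst.1, ht.2]⟩
  have hsh : Integrable (fun p : ℝ × ℝ => w (p.1 - p.2)) (volume.prod ν) :=
    integrable_shift (σ := fun r s => s - r) hw (by fun_prop)
      (fun r => measurePreserving_sub_right volume r)
  have hsh' : Integrable (fun p : ℝ × ℝ => w (p.1 - p.2))
      ((volume.restrict (Ioo 0 t)).prod ν) := by
    have := hsh.restrict (s := Ioo 0 t ×ˢ univ)
    rwa [← Measure.prod_restrict, Measure.restrict_univ] at this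
  have key : ∫ s in Ioo 0 t, ∫ r, w (s - r) ∂ν =
      ∫ s in Ioo 0 t, ν.real (Prod.mk s ⁻¹' {p : ℝ × ℝ | p.2 ≤ t - p.1}) * w s := by
    rw [integral_measureReal_mul hw.integrableOn (measurableSet_le (by fun_prop) (by fun_prop)),
      integral_integral_swap hsh']
    refine integral_congr_ae ?_
    have hν' : ∀ᵐ r ∂ν, 0 ≤ r := by
      rw [ae_iff]; simpa [Iio] using hν
    filter_upwards [hν'] with r hr
    have e2 : (fun s => {p : ℝ × ℝ | p.2 ≤ t - p.1}.indicator (fun p => w p.1) (s, r)) =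
        (Iic (t - r)).indicator w := by
      ext s
      simp only [indicator, mem_ofPred_eq, mem_Iic, le_sub_comm]
    rw [e2, integral_indicator measurableSet_Iic, Measure.restrict_restrict measurableSet_Iic]
    have e3 : ∫ s in Ioo 0 t, w (s - r) = ∫ s in Iic (t - r), w s := by
      rw [← integral_Ioc_eq_integral_Ioo, ← intervalIntegral.integral_of_le ht.1.le,
        intervalIntegral.integral_comp_sub_right w r, zero_sub,
        intervalIntegral.integral_of_le (by linarith [ht.1])]
      symm
      refine setIntegral_eq_of_subset_of_forall_sdiff_eq_zero measurableSet_Iic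
        Ioc_subset_Iic_self fun s hs => hw0 s ?_
      have h1 := hs.1
      have h2 := hs.2
      simp only [mem_Iic, mem_Ioc, not_and_or, not_lt] at h1 h2
      rcases h2 with h2 | h2
      · linarith
      · exact absurd h1 h2
    rw [e3]
    -- the two domains differ by the null set `{t}` and by negative times, where `w` vanishes
    have e4 : ∫ s in Iic (t - r), w s = ∫ s in Iio (t - r), w s := integral_Iic_eq_integral_Iio
    have e5 : ∫ s in Iic (t - r) ∩ Ioo 0 t, w s = ∫ s in Iio (t - r) ∩ Ioo 0 t, w s := by
      refine setIntegral_congr_set ?_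
      exact (Iio_ae_eq_Iic (a := t - r)).symm.inter (ae_eq_refl _)
    rw [e4, e5]
    refine setIntegral_eq_of_subset_of_forall_sdiff_eq_zero measurableSet_Iio
        inter_subset_left fun s hs => hw0 s ?_
    by_contra hs0
    exact hs.2 ⟨hs.1, not_le.1 hs0, by linarith [show s < t - r from hs.1]⟩
  rw [intervalIntegral.integral_of_le ht.1.le, integral_Ioc_eq_integral_Ioo,
    intervalIntegral.integral_of_le ht.1.le, integral_Ioc_eq_integral_Ioo,
    integral_sub (hw.integrableOn.const_mul _) hsh'.integral_prod_left, key, ← integral_sub]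
  · refine integral_congr_ae ?_
    filter_upwards [hae] with s hs
    have : (Prod.mk s ⁻¹' {p : ℝ × ℝ | p.2 ≤ t - p.1}) = (Ioi (t - s))ᶜ := by
      ext r; simp
    rw [this, measureReal_compl measurableSet_Ioi, hs]
    ring
  · exact hw.integrableOn.const_mul _
  · have hm : Measurable fun s => ν.real (Prod.mk s ⁻¹' {p : ℝ × ℝ | p.2 ≤ t - p.1}) :=
      (measurable_measure_prodMk_left
        (measurableSet_le (by fun_prop) (by fun_prop))).ennreal_toReal
    refine hw.integrableOn.bdd_mul hm.aestronglyMeasurable (c := ν.real univ)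
      (Eventually.of_forall fun s => ?_)
    rw [Real.norm_of_nonneg measureReal_nonneg]
    exact measureReal_mono (subset_univ _)

/-- Convolution in time with a bounded non-increasing kernel gains one derivative in `L¹`. -/
theorem exists_deriv_conv_of_bounded {X : Type*} [MeasurableSpace X] {μ : Measure X} [SFinite μ]
    (hT : 0 < T) (hκ : AntitoneOn κ (Ioo 0 T)) (h0 : ∀ t ∈ Ioo 0 T, 0 ≤ κ t)
    (hC : ∀ t ∈ Ioo 0 T, κ t ≤ C) {w : ℝ → X → ℝ}
    (hw : Integrable (Function.uncurry w) ((volume.restrict (Ioo 0 T)).prod μ)) :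
    ∃ g : ℝ → X → ℝ, Integrable (Function.uncurry g) ((volume.restrict (Ioo 0 T)).prod μ) ∧
      ∀ᵐ x ∂μ, ∀ t ∈ Ioo 0 T,
        ∫ τ in (0 : ℝ)..t, κ (t - τ) * w τ x = ∫ s in (0 : ℝ)..t, g s x := by
  obtain ⟨ν, hν, hν0, -, hνt⟩ := exists_tail_measure hT hκ h0 hC
  let W : ℝ × X → ℝ := fun p => (Ioo 0 T).indicator (fun s => w s p.2) p.1
  have hW : Integrable W (volume.prod μ) := integrable_indicator_uncurry hw
  refine ⟨fun t x => ν.real univ * W (t, x) - ∫ r, W (t - r, x) ∂ν, ?_, ?_⟩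
  · have hsh : Integrable (fun p : (ℝ × X) × ℝ => W (p.1.1 - p.2, p.1.2))
        ((volume.prod μ).prod ν) := by
      refine integrable_shift (σ := fun r z => (z.1 - r, z.2)) hW (by fun_prop) fun r => ?_
      exact (measurePreserving_sub_right volume r).prod (MeasurePreserving.id μ)
    have h := ((hW.const_mul (ν.real univ)).sub hsh.integral_prod_left).restrict
      (s := Ioo 0 T ×ˢ univ)
    rwa [← Measure.prod_restrict, Measure.restrict_univ] at h
  · filter_upwards [hW.prod_left_ae] with x hx t ht
    have := integral_sub_shift_eq_conv hν0 hνt hx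
      (fun s hs => indicator_of_notMem (fun h => not_lt.2 hs h.1) _) ht
    rw [this]
    refine intervalIntegral.integral_congr_ae ?_
    have hne : ∀ᵐ s : ℝ, s ≠ t := by simp [ae_iff, measure_singleton]
    filter_upwards [hne] with s _ hs
    rw [uIoc_of_le ht.1.le] at hs
    simp only [W]
    rw [indicator_of_mem (show s ∈ Ioo 0 T from ⟨hs.1, hs.2.trans_lt ht.2⟩)]

end Kernels

/-! ### Mollification in time, and the convexity inequality for smooth functions -/

section SmoothConvexity

open scoped Convolution

/-- Translations act continuously on `L¹(ℝ)`. -/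
theorem tendsto_lintegral_translate {f : ℝ → ℝ} (hf : Integrable f) :
    Tendsto (fun s => ∫⁻ t, ‖f (t - s) - f t‖ₑ) (𝓝 0) (𝓝 0) := by
  have hf1 : MemLp f 1 volume := memLp_one_iff_integrable.2 hf
  let σ : C(ℝ, C(ℝ, ℝ)) := (ContinuousMap.mk (fun p : ℝ × ℝ => p.2 - p.1) (by fun_prop)).curry
  have hσ : ∀ s, MeasurePreserving (σ s) := fun s => measurePreserving_sub_right volume s
  have key := (continuous_const (y := hf1.toLp f)).compMeasurePreservingLp σ.continuous hσ
    (by norm_num) |>.tendsto 0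
  have h2 := (Lp.tendsto_Lp_iff_tendsto_eLpNorm' _ _).1 key
  refine h2.congr fun s => ?_
  rw [← eLpNorm_one_eq_lintegral_enorm]
  refine eLpNorm_congr_ae (p := 1) (μ := volume) ?_
  have c : ∀ s, Lp.compMeasurePreserving (σ s) (hσ s) (hf1.toLp f) =ᵐ[volume]
      fun t => f (t - s) := fun s =>
    (Lp.coeFn_compMeasurePreserving _ (hσ s)).trans
      ((hσ s).quasiMeasurePreserving.ae_eq_comp hf1.coeFn_toLp)
  filter_upwards [c s, c 0] with t h1 h2
  simp only [Pi.sub_apply]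
  rw [h1, h2, sub_zero]

/-- A sequence of smooth probability densities on `(0, ∞)` concentrating at `0`. -/
noncomputable def causalMollifier (n : ℕ) : ℝ → ℝ :=
  (⟨1 / (4 * ((n : ℝ) + 1)), 1 / (2 * ((n : ℝ) + 1)), by positivity, by
    apply one_div_lt_one_div_of_lt <;> nlinarith [(Nat.cast_nonneg n : (0 : ℝ) ≤ n)]⟩ :
    ContDiffBump (1 / ((n : ℝ) + 1))).normed volume

namespace causalMollifier

variable (n : ℕ)

theorem contDiff : ContDiff ℝ ∞ (causalMollifier n) := ContDiffBump.contDiff_normed _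

theorem hasCompactSupport : HasCompactSupport (causalMollifier n) :=
  ContDiffBump.hasCompactSupport_normed _

theorem nonneg (s : ℝ) : 0 ≤ causalMollifier n s := ContDiffBump.nonneg_normed _ _

theorem integral_eq_one : ∫ s, causalMollifier n s = 1 := ContDiffBump.integral_normed _

theorem integrable : Integrable (causalMollifier n) := ContDiffBump.integrable_normed _

theorem eq_zero {s : ℝ} (hs : s ≤ 0 ∨ 2 / ((n : ℝ) + 1) ≤ s) : causalMollifier n s = 0 := by
  rw [← Function.notMem_support, causalMollifier, ContDiffBump.support_normed_eq,
    Metric.mem_ball, Real.dist_eq, not_lt]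
  have h1 : 1 / (2 * ((n : ℝ) + 1)) = (1 / ((n : ℝ) + 1)) / 2 := by field_simp
  have h2 : 2 / ((n : ℝ) + 1) = 2 * (1 / ((n : ℝ) + 1)) := by ring
  have h3 : 0 < 1 / ((n : ℝ) + 1) := by positivity
  rw [h2] at hs
  simp only [h1]
  rcases hs with hs | hs
  · rw [abs_of_neg (by linarith)]; linarith
  · rw [abs_of_pos (by linarith)]; linarith

/-- Mollification converges in `L¹`. -/
theorem tendsto_convolution {f : ℝ → ℝ} (hf : Integrable f) :
    Tendsto (fun n => ∫⁻ t,
      ‖(causalMollifier n ⋆[ContinuousLinearMap.mul ℝ ℝ, volume] f) t - f t‖ₑ) atTop (𝓝 0) := by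
  rw [ENNReal.tendsto_nhds_zero]
  intro ε hε
  have h1 := (ENNReal.tendsto_nhds_zero.1 (tendsto_lintegral_translate hf)) ε hε
  obtain ⟨δ, hδ, hb⟩ := Metric.eventually_nhds_iff.1 h1
  have h2 : ∀ᶠ n : ℕ in atTop, 2 / ((n : ℝ) + 1) < δ := by
    have := (tendsto_one_div_add_atTop_nhds_zero_nat (𝕜 := ℝ)).const_mul 2
    rw [mul_zero] at this
    filter_upwards [this.eventually_lt_const hδ] with n hn
    rwa [mul_one_div] at hn
  filter_upwards [h2] with n hn
  have hmeas : AEStronglyMeasurable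
      (fun p : ℝ × ℝ => causalMollifier n p.2 * (f (p.1 - p.2) - f p.1))
      (volume.prod volume) := by
    refine ((contDiff n).continuous.aestronglyMeasurable.comp_snd).mul
      (AEStronglyMeasurable.sub ?_ hf.1.comp_fst)
    exact hf.1.comp_quasiMeasurePreserving (quasiMeasurePreserving_sub_of_right_invariant _ _)
  calc ∫⁻ t, ‖(causalMollifier n ⋆[ContinuousLinearMap.mul ℝ ℝ, volume] f) t - f t‖ₑ
      ≤ ∫⁻ t, ∫⁻ s, ‖causalMollifier n s * (f (t - s) - f t)‖ₑ := by
        refine lintegral_mono_ae ?_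
        filter_upwards [(integrable n).ae_convolution_exists (ContinuousLinearMap.mul ℝ ℝ) hf]
          with t ht
        have e : (causalMollifier n ⋆[ContinuousLinearMap.mul ℝ ℝ, volume] f) t - f t =
            ∫ s, causalMollifier n s * (f (t - s) - f t) := by
          simp_rw [mul_sub]
          have ht' : Integrable (fun s => causalMollifier n s * f (t - s)) := ht
          rw [integral_sub ht' ((integrable n).mul_const _), integral_mul_const,
            integral_eq_one, one_mul]
          rfl
        rw [e]
        exact enorm_integral_le_lintegral_enorm _
    _ = ∫⁻ s, ∫⁻ t, ‖causalMollifier n s * (f (t - s) - f t)‖ₑ :=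
        lintegral_lintegral_swap hmeas.enorm
    _ ≤ ∫⁻ s, ‖causalMollifier n s‖ₑ * ε := by
        refine lintegral_mono fun s => ?_
        simp_rw [enorm_mul]
        rw [lintegral_const_mul' _ _ enorm_ne_top]
        by_cases hs : s ≤ 0 ∨ 2 / ((n : ℝ) + 1) ≤ s
        · simp [eq_zero n hs]
        · push Not at hs
          gcongr
          refine hb ?_
          rw [Real.dist_eq, sub_zero, abs_of_pos hs.1]
          exact hs.2.trans hn
    _ = ε := by
        rw [lintegral_mul_const'' _ (integrable n).1.enorm,
          ← ofReal_integral_norm_eq_lintegral_enorm (integrable n)]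
        simp_rw [Real.norm_of_nonneg (nonneg n _)]
        rw [integral_eq_one, ENNReal.ofReal_one, one_mul]

end causalMollifier

/-- Young's inequality in `L¹`. -/
theorem lintegral_convolution_le {h K : ℝ → ℝ} (hh : Integrable h) (hK : Integrable K) :
    ∫⁻ t, ‖∫ s, h s * K (t - s)‖ₑ ≤ (∫⁻ s, ‖h s‖ₑ) * ∫⁻ s, ‖K s‖ₑ := by
  have hmeas : AEStronglyMeasurable (fun p : ℝ × ℝ => h p.2 * K (p.1 - p.2))
      (volume.prod volume) :=
    hh.1.convolution_integrand (ContinuousLinearMap.mul ℝ ℝ) hK.1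
  calc ∫⁻ t, ‖∫ s, h s * K (t - s)‖ₑ ≤ ∫⁻ t, ∫⁻ s, ‖h s * K (t - s)‖ₑ :=
        lintegral_mono fun t => enorm_integral_le_lintegral_enorm _
    _ = ∫⁻ s, ∫⁻ t, ‖h s * K (t - s)‖ₑ := lintegral_lintegral_swap hmeas.enorm
    _ = ∫⁻ s, ‖h s‖ₑ * ∫⁻ t, ‖K t‖ₑ := by
        refine lintegral_congr fun s => ?_
        simp_rw [enorm_mul]
        rw [lintegral_const_mul' _ _ enorm_ne_top,
          lintegral_sub_right_eq_self (fun t => ‖K t‖ₑ) s]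
    _ = _ := lintegral_mul_const'' _ hh.1.enorm

theorem integral_causal_conv {κ w : ℝ → ℝ} {T t : ℝ} (hw : ∀ s, s ≤ 0 → w s = 0)
    (ht : t ∈ Ioo 0 T) :
    ∫ s, w s * (Ioo 0 T).indicator κ (t - s) = ∫ s in (0 : ℝ)..t, κ (t - s) * w s := by
  rw [← integral_indicator_conv ht]
  congr 1 with s
  by_cases hs : s ∈ Ioo 0 T
  · rw [indicator_of_mem hs, mul_comm]
  · rw [indicator_of_notMem hs, mul_zero]
    rcases not_and_or.1 hs with h | h
    · rw [hw s (not_lt.1 h), zero_mul]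
    · rw [indicator_of_notMem (fun h' : t - s ∈ Ioo 0 T => h (by linarith [h'.1, ht.2])), mul_zero]

/-- The subgradient inequality for the convex function `Ψ`. -/
theorem sub_le_mul_sub_of_monotone_deriv {Ψ ψ : ℝ → ℝ} (hΨ : ∀ r, HasDerivAt Ψ (ψ r) r)
    (hψm : Monotone ψ) (a b : ℝ) : Ψ b - Ψ a ≤ ψ b * (b - a) := by
  have hconv : ConvexOn ℝ univ Ψ := by
    refine MonotoneOn.convexOn_of_deriv convex_univ
      (fun x _ => (hΨ x).continuousAt.continuousWithinAt)
      (fun x _ => (hΨ x).differentiableAt.differentiableWithinAt) ?_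
    rw [show deriv Ψ = ψ from funext fun r => (hΨ r).deriv]
    exact hψm.monotoneOn _
  rcases lt_trichotomy a b with h | h | h
  · have := hconv.slope_le_of_hasDerivAt (mem_univ a) (mem_univ b) h (hΨ b)
    rw [slope_def_field, div_le_iff₀ (by linarith)] at this
    exact this
  · simp [h]
  · have := hconv.le_slope_of_hasDerivAt (mem_univ b) (mem_univ a) h (hΨ b)
    rw [slope_def_field, le_div_iff₀ (by linarith)] at this
    linarith

variable {κ : ℝ → ℝ} {T : ℝ} {Ψ ψ : ℝ → ℝ}

/-- The convexity inequality `∂ₜ(κ ∗ Ψ(z)) ≤ ψ(z) (κ ∗ z')` for smooth `z`, tested with `ζ`. -/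
theorem convexity_inequality_of_smooth (hT : 0 < T)
    (hκ : AntitoneOn κ (Ioo 0 T)) (h0 : ∀ t ∈ Ioo 0 T, 0 ≤ κ t) (hi : IntegrableOn κ (Ioo 0 T))
    (hΨ : ∀ r, HasDerivAt Ψ (ψ r) r) (hψc : Continuous ψ) (hψm : Monotone ψ) (hΨ0 : Ψ 0 = 0)
    {ζ : ℝ → ℝ} (hζ : ContDiff ℝ 1 ζ) (hζT : ζ T = 0) (hζ0 : ∀ t ∈ Ioo 0 T, 0 ≤ ζ t)
    {z : ℝ → ℝ} (hz : ContDiff ℝ 1 z) (hzc : HasCompactSupport z) (hz0 : ∀ t, t ≤ 0 → z t = 0) :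
    -(∫ t in Ioo 0 T, deriv ζ t * ∫ s in (0 : ℝ)..t, κ (t - s) * Ψ (z s)) ≤
      ∫ t in Ioo 0 T, ζ t * (∫ s in (0 : ℝ)..t, κ (t - s) * deriv z s) * ψ (z t) := by
  set K : ℝ → ℝ := (Ioo 0 T).indicator κ
  have hK : Integrable K := (integrable_indicator_iff measurableSet_Ioo).2 hi
  have hzd : ∀ t, HasDerivAt z (deriv z t) t := fun t =>
    (hz.differentiable (by norm_num) t).hasDerivAt
  have hz'c : Continuous (deriv z) := hz.continuous_deriv (by norm_num)
  have hz'0 : ∀ t, t ≤ 0 → deriv z t = 0 := by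
    intro t ht
    have h1 : HasDerivWithinAt z 0 (Iic t) t :=
      (hasDerivWithinAt_const t _ (0 : ℝ)).congr (fun s hs => hz0 s (le_trans hs ht)) (hz0 t ht)
    exact (uniqueDiffWithinAt_Iic t).eq_deriv _ (hzd t).hasDerivWithinAt h1
  have hΨz : ∀ t, HasDerivAt (fun t => Ψ (z t)) (ψ (z t) * deriv z t) t := fun t =>
    (hΨ (z t)).comp t (hzd t)
  have hΨd : deriv (fun t => Ψ (z t)) = fun t => ψ (z t) * deriv z t :=
    funext fun t => (hΨz t).deriv
  have hqc : Continuous fun t => ψ (z t) * deriv z t := (hψc.comp hz.continuous).mul hz'c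
  have hΨ1 : ContDiff ℝ 1 (fun t => Ψ (z t)) := by
    rw [contDiff_one_iff_deriv, hΨd]
    exact ⟨fun t => (hΨz t).differentiableAt, hqc⟩
  have hΨs : HasCompactSupport (fun t => Ψ (z t)) := hzc.comp_left hΨ0
  have hqs : HasCompactSupport (fun t => ψ (z t) * deriv z t) := hzc.deriv.mul_left
  set F : ℝ → ℝ := (fun t => Ψ (z t)) ⋆[ContinuousLinearMap.mul ℝ ℝ, volume] K
  set F' : ℝ → ℝ := (fun t => ψ (z t) * deriv z t) ⋆[ContinuousLinearMap.mul ℝ ℝ, volume] K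
  have hF : ∀ t, HasDerivAt F (F' t) t := by
    intro t
    have := hΨs.hasDerivAt_convolution_left (ContinuousLinearMap.mul ℝ ℝ) hΨ1
      (hK.locallyIntegrable) t
    rwa [hΨd] at this
  have hF'c : Continuous F' :=
    hqs.continuous_convolution_left _ hqc hK.locallyIntegrable
  have hFc : Continuous F := continuous_iff_continuousAt.2 fun t => (hF t).continuousAt
  have hF1 : ∀ t ∈ Ioo 0 T, F t = ∫ s in (0 : ℝ)..t, κ (t - s) * Ψ (z s) := fun t ht =>
    integral_causal_conv (fun s hs => by rw [hz0 s hs, hΨ0]) ht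
  have hF2 : ∀ t ∈ Ioo 0 T, F' t = ∫ s in (0 : ℝ)..t, κ (t - s) * (ψ (z s) * deriv z s) :=
    fun t ht => integral_causal_conv (fun s hs => by rw [hz'0 s hs, mul_zero]) ht
  have hF0 : F 0 = 0 := by
    refine integral_eq_zero_of_ae (Eventually.of_forall fun s => ?_)
    rcases le_or_gt s 0 with hs | hs
    · simp [hz0 s hs, hΨ0]
    · have : K (0 - s) = 0 := indicator_of_notMem (fun h => by linarith [h.1]) _
      rw [zero_sub] at this
      simp [this]
  have ibp : ∫ t in (0 : ℝ)..T, deriv ζ t * F t + ζ t * F' t = 0 := by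
    have hζd : ∀ t, HasDerivAt ζ (deriv ζ t) t := fun t =>
      (hζ.differentiable (by norm_num) t).hasDerivAt
    rw [intervalIntegral.integral_deriv_mul_eq_sub (fun t _ => hζd t) (fun t _ => hF t)
      ((hζ.continuous_deriv (by norm_num)).intervalIntegrable _ _)
      (hF'c.intervalIntegrable _ _), hζT, hF0]
    simp
  have i1 : IntervalIntegrable (fun t => deriv ζ t * F t) volume 0 T :=
    ((hζ.continuous_deriv (by norm_num)).mul hFc).intervalIntegrable _ _
  have i2 : IntervalIntegrable (fun t => ζ t * F' t) volume 0 T :=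
    (hζ.continuous.mul hF'c).intervalIntegrable _ _
  rw [intervalIntegral.integral_add i1 i2, intervalIntegral.integral_of_le hT.le,
    intervalIntegral.integral_of_le hT.le, integral_Ioc_eq_integral_Ioo,
    integral_Ioc_eq_integral_Ioo] at ibp
  have e1 : ∫ t in Ioo 0 T, deriv ζ t * ∫ s in (0 : ℝ)..t, κ (t - s) * Ψ (z s) =
      ∫ t in Ioo 0 T, deriv ζ t * F t :=
    setIntegral_congr_fun measurableSet_Ioo fun t ht => by simp only [hF1 t ht]
  set P : ℝ → ℝ := deriv z ⋆[ContinuousLinearMap.mul ℝ ℝ, volume] K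
  have hPc : Continuous P :=
    hzc.deriv.continuous_convolution_left _ hz'c hK.locallyIntegrable
  have hP : ∀ t ∈ Ioo 0 T, P t = ∫ s in (0 : ℝ)..t, κ (t - s) * deriv z s := fun t ht =>
    integral_causal_conv hz'0 ht
  have e2 : ∫ t in Ioo 0 T, ζ t * (∫ s in (0 : ℝ)..t, κ (t - s) * deriv z s) * ψ (z t) =
      ∫ t in Ioo 0 T, ζ t * P t * ψ (z t) :=
    setIntegral_congr_fun measurableSet_Ioo fun t ht => by simp only [hP t ht]
  rw [e1, e2, show -∫ t in Ioo 0 T, deriv ζ t * F t = ∫ t in Ioo 0 T, ζ t * F' t by linarith]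
  refine setIntegral_mono_on ((intervalIntegrable_iff_integrableOn_Ioo_of_le hT.le).1 i2)
    ((intervalIntegrable_iff_integrableOn_Ioo_of_le hT.le).1
      (((hζ.continuous.mul hPc).mul (hψc.comp hz.continuous)).intervalIntegrable _ _))
    measurableSet_Ioo fun t ht => ?_
  rw [mul_assoc]
  refine mul_le_mul_of_nonneg_left ?_ (hζ0 t ht)
  rw [hP t ht, hF2 t ht]
  have hit : IntervalIntegrable (fun s => κ (t - s)) volume 0 t := by
    have : IntervalIntegrable κ volume 0 t :=
      (intervalIntegrable_iff_integrableOn_Ioo_of_le ht.1.le).2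
        (hi.mono_set (Ioo_subset_Ioo_right ht.2.le))
    simpa using (this.comp_sub_left t).symm
  rw [← sub_nonneg, ← intervalIntegral.integral_mul_const, ← intervalIntegral.integral_sub]
  · -- for every `r` the integral of `(ψ(z(t)) - ψ(z(s))) z'(s)` over `(r, t)` equals
    -- `ψ(z(t)) (z(t) - z(r)) - (Ψ(z(t)) - Ψ(z(r)))`, which is non-negative by convexity
    have hec : Continuous fun s => ψ (z t) * deriv z s - ψ (z s) * deriv z s := by fun_prop
    have := integral_conv_nonneg ht hκ h0 hi hec (fun r hr => ?_)
    · refine this.trans_eq (intervalIntegral.integral_congr fun s _ => ?_)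
      ring
    · rw [intervalIntegral.integral_sub ((hz'c.const_mul _).intervalIntegrable _ _)
        (hqc.intervalIntegrable _ _), intervalIntegral.integral_const_mul,
        intervalIntegral.integral_eq_sub_of_hasDerivAt (fun s _ => hzd s)
          (hz'c.intervalIntegrable _ _),
        intervalIntegral.integral_eq_sub_of_hasDerivAt (fun s _ => hΨz s)
          (hqc.intervalIntegrable _ _)]
      exact sub_nonneg.2 (sub_le_mul_sub_of_monotone_deriv hΨ hψm _ _)
  · exact (hit.mul_continuousOn hz'c.continuousOn).mul_const _
  · exact hit.mul_continuousOn hqc.continuousOn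

end SmoothConvexity

/-! ### The convexity inequality for integrable functions -/

section Convexity

open scoped Convolution

/-- Mollification in time commutes with the convolution by `κ`: if `κ ∗ z = 1 ∗ g`, then the
mollified functions satisfy `κ ∗ zₙ' = gₙ`. -/
theorem conv_deriv_mollified {κ z g : ℝ → ℝ} {T : ℝ} (hi : IntegrableOn κ (Ioo 0 T))
    (hz : IntegrableOn z (Ioo 0 T)) (hg : IntegrableOn g (Ioo 0 T))
    (hzg : ∀ᵐ t ∂(volume.restrict (Ioo 0 T)),
      ∫ s in (0 : ℝ)..t, κ (t - s) * z s = ∫ s in (0 : ℝ)..t, g s)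
    {ρ : ℝ → ℝ} (hρ : ContDiff ℝ ∞ ρ) (hρc : HasCompactSupport ρ) (hρ0 : ∀ t, t ≤ 0 → ρ t = 0)
    {t : ℝ} (ht : t ∈ Ioo 0 T) :
    ∫ s in (0 : ℝ)..t, κ (t - s) *
        deriv (ρ ⋆[ContinuousLinearMap.mul ℝ ℝ, volume] (Ioo 0 T).indicator z) s =
      (ρ ⋆[ContinuousLinearMap.mul ℝ ℝ, volume] (Ioo 0 T).indicator g) t := by
  set K : ℝ → ℝ := (Ioo 0 T).indicator κ
  set Z : ℝ → ℝ := (Ioo 0 T).indicator z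
  have hK : Integrable K := (integrable_indicator_iff measurableSet_Ioo).2 hi
  have hZ : Integrable Z := (integrable_indicator_iff measurableSet_Ioo).2 hz
  have hρ1 : ContDiff ℝ 1 ρ := hρ.of_le (by norm_num)
  have hρd : ∀ s, HasDerivAt ρ (deriv ρ s) s := fun s =>
    (hρ1.differentiable (by norm_num) s).hasDerivAt
  have hρ'c : Continuous (deriv ρ) := hρ1.continuous_deriv (by norm_num)
  have hρ'0 : ∀ t, t ≤ 0 → deriv ρ t = 0 := by
    intro t ht
    have h1 : HasDerivWithinAt ρ 0 (Iic t) t :=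
      (hasDerivWithinAt_const t _ (0 : ℝ)).congr (fun s hs => hρ0 s (le_trans hs ht)) (hρ0 t ht)
    exact (uniqueDiffWithinAt_Iic t).eq_deriv _ (hρd t).hasDerivWithinAt h1
  have hd : deriv (ρ ⋆[ContinuousLinearMap.mul ℝ ℝ, volume] Z) =
      deriv ρ ⋆[ContinuousLinearMap.mul ℝ ℝ, volume] Z := funext fun s =>
    (hρc.hasDerivAt_convolution_left _ hρ1 hZ.locallyIntegrable s).deriv
  have hc0 : ∀ s, s ≤ 0 → (deriv ρ ⋆[ContinuousLinearMap.mul ℝ ℝ, volume] Z) s = 0 := by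
    intro s hs
    refine integral_eq_zero_of_ae (Eventually.of_forall fun r => ?_)
    rcases le_or_gt r 0 with hr | hr
    · simp [hρ'0 r hr]
    · have : Z (s - r) = 0 := indicator_of_notMem (fun h => by linarith [h.1]) _
      simp [this]
  have hassoc : ((deriv ρ ⋆[ContinuousLinearMap.mul ℝ ℝ, volume] Z)
        ⋆[ContinuousLinearMap.mul ℝ ℝ, volume] K) t =
      (deriv ρ ⋆[ContinuousLinearMap.mul ℝ ℝ, volume]
        (Z ⋆[ContinuousLinearMap.mul ℝ ℝ, volume] K)) t := by
    refine convolution_assoc _ _ _ _ (fun x y w => mul_assoc x y w)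
      hρ'c.aestronglyMeasurable hZ.1 hK.1 ?_ ?_ ?_
    · exact Eventually.of_forall
        (hρc.deriv.convolutionExists_left _ hρ'c hZ.locallyIntegrable)
    · exact hZ.norm.ae_convolution_exists _ hK.norm
    · exact hρc.deriv.norm.convolutionExists_left _ hρ'c.norm
        (hZ.norm.integrable_convolution _ hK.norm).locallyIntegrable t
  -- move the derivative onto `ρ`, then use associativity and integrate by parts
  rw [hd, ← integral_causal_conv hc0 ht]
  refine hassoc.trans ?_
  rw [convolution_eq_swap, convolution_eq_swap]
  have hin : ∀ s, s ∈ Ioo 0 t → s ∈ Ioo 0 T := fun s hs => ⟨hs.1, hs.2.trans ht.2⟩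
  have e1 : ∫ s, (ContinuousLinearMap.mul ℝ ℝ) (deriv ρ (t - s))
      ((Z ⋆[ContinuousLinearMap.mul ℝ ℝ, volume] K) s) =
      ∫ s in Ioo 0 t, deriv ρ (t - s) * ∫ r in (0 : ℝ)..s, g r := by
    rw [← integral_indicator measurableSet_Ioo]
    refine integral_congr_ae ?_
    rw [EventuallyEq]
    rw [ae_restrict_iff' measurableSet_Ioo] at hzg
    filter_upwards [hzg] with s hs
    by_cases hst : s ∈ Ioo 0 t
    · rw [indicator_of_mem hst, ← hs (hin s hst)]
      have e : (Z ⋆[ContinuousLinearMap.mul ℝ ℝ, volume] K) s =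
          ∫ r in (0 : ℝ)..s, κ (s - r) * z r := by
        rw [← integral_indicator_conv (hin s hst)]
        exact integral_congr_ae (Eventually.of_forall fun r => mul_comm _ _)
      rw [e]; rfl
    · rw [indicator_of_notMem hst]
      rcases not_and_or.1 hst with h | h
      · have : (Z ⋆[ContinuousLinearMap.mul ℝ ℝ, volume] K) s = 0 := by
          refine integral_eq_zero_of_ae (Eventually.of_forall fun r => ?_)
          rcases le_or_gt r 0 with hr | hr
          · have : Z r = 0 := indicator_of_notMem (fun h => by linarith [h.1]) _
            simp [this]
          · have : K (s - r) = 0 := indicator_of_notMem (fun h' => by linarith [h'.1]) _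
            simp [this]
        rw [this]; simp
      · rw [hρ'0 _ (by linarith)]; simp
  have e2 : ∫ s, (ContinuousLinearMap.mul ℝ ℝ) (ρ (t - s)) ((Ioo 0 T).indicator g s) =
      ∫ s in Ioo 0 t, ρ (t - s) * g s := by
    rw [← integral_indicator measurableSet_Ioo]
    refine integral_congr_ae (Eventually.of_forall fun s => ?_)
    by_cases hst : s ∈ Ioo 0 t
    · simp only [indicator_of_mem hst, indicator_of_mem (hin s hst)]; rfl
    · simp only [indicator_of_notMem hst]
      rcases not_and_or.1 hst with h | h
      · rw [indicator_of_notMem (fun h' => h h'.1)]; simp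
      · rw [hρ0 _ (by linarith)]; simp
  rw [e1, e2]
  have hθd : deriv (fun s => ρ (t - s)) = fun s => -deriv ρ (t - s) := by
    ext s; rw [deriv_comp_const_sub]
  have := integral_deriv_mul_primitive (θ := fun s => ρ (t - s)) ht.1
    (hρ1.comp (contDiff_const.sub contDiff_id)) (by simp [hρ0])
    (hg.mono_set fun s hs => hin s hs)
  rw [hθd] at this
  simp only [neg_mul, integral_neg, neg_inj] at this
  exact this

/-- The convexity inequality `∂ₜ(κ ∗ Ψ(z)) ≤ ψ(z) ∂ₜ(κ ∗ z)`, tested with `ζ`, for a possibly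
unbounded non-increasing kernel and a merely integrable function `z` for which `∂ₜ(κ ∗ z)` is
integrable. Mollification in time reduces it to smooth `z`. -/
theorem convexity_inequality {κ z g Ψ ψ ζ : ℝ → ℝ} {T M : ℝ} (hT : 0 < T)
    (hκ : AntitoneOn κ (Ioo 0 T)) (h0 : ∀ t ∈ Ioo 0 T, 0 ≤ κ t) (hi : IntegrableOn κ (Ioo 0 T))
    (hz : IntegrableOn z (Ioo 0 T)) (hg : IntegrableOn g (Ioo 0 T))
    (hzg : ∀ᵐ t ∂(volume.restrict (Ioo 0 T)),
      ∫ s in (0 : ℝ)..t, κ (t - s) * z s = ∫ s in (0 : ℝ)..t, g s)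
    (hΨ : ∀ r, HasDerivAt Ψ (ψ r) r) (hψc : Continuous ψ) (hψm : Monotone ψ)
    (hψM : ∀ r, |ψ r| ≤ M) (hΨ0 : Ψ 0 = 0)
    (hζ : ContDiff ℝ 1 ζ) (hζT : ζ T = 0) (hζ0 : ∀ t ∈ Ioo 0 T, 0 ≤ ζ t) :
    -(∫ t in Ioo 0 T, deriv ζ t * ∫ s in (0 : ℝ)..t, κ (t - s) * Ψ (z s)) ≤
      ∫ t in Ioo 0 T, ζ t * g t * ψ (z t) := by
  set K : ℝ → ℝ := (Ioo 0 T).indicator κ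
  set Z : ℝ → ℝ := (Ioo 0 T).indicator z
  set G : ℝ → ℝ := (Ioo 0 T).indicator g
  have hK : Integrable K := (integrable_indicator_iff measurableSet_Ioo).2 hi
  have hZ : Integrable Z := (integrable_indicator_iff measurableSet_Ioo).2 hz
  have hG : Integrable G := (integrable_indicator_iff measurableSet_Ioo).2 hg
  have hZc : HasCompactSupport Z :=
    HasCompactSupport.of_support_subset_isCompact isCompact_Icc
      (support_indicator_subset.trans Ioo_subset_Icc_self)
  have hZ0 : ∀ t, t ≤ 0 → Z t = 0 := fun t ht =>
    indicator_of_notMem (fun h => by linarith [h.1]) _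
  have hΨd : Differentiable ℝ Ψ := fun r => (hΨ r).differentiableAt
  have hΨL : ∀ a b, |Ψ a - Ψ b| ≤ M * |a - b| :=
    abs_le_of_abs_deriv_le hΨd (fun s => by rw [(hΨ s).deriv]; exact hψM s)
  -- a subsequence of the mollified functions converges almost everywhere
  have L1 := causalMollifier.tendsto_convolution hZ
  have hzn0 : ∀ n : ℕ, ContDiff ℝ ∞
      (causalMollifier n ⋆[ContinuousLinearMap.mul ℝ ℝ, volume] Z) := fun n =>
    (causalMollifier.hasCompactSupport n).contDiff_convolution_left _
      (causalMollifier.contDiff n) hZ.locallyIntegrable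
  obtain ⟨ns, hns, hae⟩ := (tendstoInMeasure_of_tendsto_eLpNorm (p := 1) (μ := volume)
    (f := fun n => causalMollifier n ⋆[ContinuousLinearMap.mul ℝ ℝ, volume] Z) (g := Z)
    (by norm_num) (fun n => (hzn0 n).continuous.aestronglyMeasurable) hZ.1
    (by simp only [eLpNorm_one_eq_lintegral_enorm]; exact L1)).exists_seq_tendsto_ae
  have L1z := L1.comp hns.tendsto_atTop
  have L1g := (causalMollifier.tendsto_convolution hG).comp hns.tendsto_atTop
  set zn : ℕ → ℝ → ℝ := fun n =>
    causalMollifier (ns n) ⋆[ContinuousLinearMap.mul ℝ ℝ, volume] Z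
  set gn : ℕ → ℝ → ℝ := fun n =>
    causalMollifier (ns n) ⋆[ContinuousLinearMap.mul ℝ ℝ, volume] G
  have hzn : ∀ n, ContDiff ℝ ∞ (zn n) := fun n => hzn0 (ns n)
  have hznc : ∀ n, HasCompactSupport (zn n) := fun n =>
    (causalMollifier.hasCompactSupport _).convolution _ hZc
  have hzni : ∀ n, Integrable (zn n) := fun n =>
    (hzn n).continuous.integrable_of_hasCompactSupport (hznc n)
  have hgni : ∀ n, Integrable (gn n) := fun n =>
    (causalMollifier.integrable _).integrable_convolution _ hG
  have hznz : ∀ n t, t ≤ 0 → zn n t = 0 := by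
    intro n t ht
    refine integral_eq_zero_of_ae (Eventually.of_forall fun r => ?_)
    rcases le_or_gt r 0 with hr | hr
    · simp [causalMollifier.eq_zero (ns n) (Or.inl hr)]
    · simp [hZ0 (t - r) (by linarith)]
  have key : ∀ n,
      -(∫ t in Ioo 0 T, deriv ζ t * ∫ s in (0 : ℝ)..t, κ (t - s) * Ψ (zn n s)) ≤
      ∫ t in Ioo 0 T, ζ t * gn n t * ψ (zn n t) := by
    intro n
    refine (convexity_inequality_of_smooth hT hκ h0 hi hΨ hψc hψm hΨ0 hζ hζT hζ0
      ((hzn n).of_le (by norm_num)) (hznc n) (hznz n)).trans_eq ?_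
    refine setIntegral_congr_fun measurableSet_Ioo fun t ht => ?_
    rw [conv_deriv_mollified hi hz hg hzg (causalMollifier.contDiff _)
      (causalMollifier.hasCompactSupport _)
      (fun t ht => causalMollifier.eq_zero _ (Or.inl ht)) ht]
  obtain ⟨Cζ, hCζ⟩ := isCompact_Icc.exists_bound_of_continuousOn (s := Icc 0 T)
    hζ.continuous.continuousOn
  obtain ⟨Cζ', hCζ'⟩ := isCompact_Icc.exists_bound_of_continuousOn (s := Icc 0 T)
    (hζ.continuous_deriv (by norm_num)).continuousOn
  have hζ'm : AEStronglyMeasurable (deriv ζ) (volume.restrict (Ioo 0 T)) :=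
    (hζ.continuous_deriv (by norm_num)).aestronglyMeasurable
  have hΨi : ∀ {y : ℝ → ℝ}, Integrable y → Integrable fun s => Ψ (y s) := fun {y} hy => by
    refine Integrable.mono' (hy.abs.const_mul M)
      (hΨd.continuous.comp_aestronglyMeasurable hy.1) (Eventually.of_forall fun s => ?_)
    simpa [hΨ0] using hΨL (y s) 0
  -- convergence of the left-hand sides
  have hconv : ∀ {y : ℝ → ℝ}, (∀ s, s ≤ 0 → y s = 0) → ∀ t ∈ Ioo 0 T,
      ∫ s in (0 : ℝ)..t, κ (t - s) * Ψ (y s) = ∫ s, Ψ (y s) * K (t - s) := fun {y} hy t ht =>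
    (integral_causal_conv (fun s hs => by rw [hy s hs, hΨ0]) ht).symm
  have hconvi : ∀ {y : ℝ → ℝ}, Integrable y →
      Integrable fun t => ∫ s, Ψ (y s) * K (t - s) := fun {y} hy =>
    (hΨi hy).integrable_convolution (ContinuousLinearMap.mul ℝ ℝ) hK
  have lim1 : Tendsto (fun n => ∫ t in Ioo 0 T, deriv ζ t * ∫ s, Ψ (zn n s) * K (t - s)) atTop
      (𝓝 (∫ t in Ioo 0 T, deriv ζ t * ∫ s, Ψ (Z s) * K (t - s))) := by
    have hib : ∀ {y : ℝ → ℝ}, Integrable y → Integrable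
        (fun t => deriv ζ t * ∫ s, Ψ (y s) * K (t - s)) (volume.restrict (Ioo 0 T)) :=
      fun {y} hy => (hconvi hy).restrict.bdd_mul hζ'm (c := Cζ') (by
        filter_upwards [ae_restrict_mem measurableSet_Ioo] with t ht using
          hCζ' t (Ioo_subset_Icc_self ht))
    refine tendsto_integral_of_L1 _ (hib hZ).1 (Eventually.of_forall fun n => hib (hzni n)) ?_
    have hb : ∀ n, ∫⁻ t in Ioo 0 T, ‖deriv ζ t * (∫ s, Ψ (zn n s) * K (t - s)) -
        deriv ζ t * ∫ s, Ψ (Z s) * K (t - s)‖ₑ ≤ ENNReal.ofReal Cζ' *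
        ((ENNReal.ofReal M * ∫⁻ s, ‖zn n s - Z s‖ₑ) * ∫⁻ s, ‖K s‖ₑ) := by
      intro n
      have hh : Integrable fun s => Ψ (zn n s) - Ψ (Z s) := (hΨi (hzni n)).sub (hΨi hZ)
      calc _ ≤ ∫⁻ t in Ioo 0 T, ENNReal.ofReal Cζ' *
            ‖∫ s, (Ψ (zn n s) - Ψ (Z s)) * K (t - s)‖ₑ := by
            refine lintegral_mono_ae ?_
            filter_upwards [ae_restrict_mem measurableSet_Ioo, ae_restrict_of_ae
              ((hΨi (hzni n)).ae_convolution_exists (ContinuousLinearMap.mul ℝ ℝ) hK),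
              ae_restrict_of_ae
              ((hΨi hZ).ae_convolution_exists (ContinuousLinearMap.mul ℝ ℝ) hK)]
              with t ht i1 i2
            have i1' : Integrable fun s => Ψ (zn n s) * K (t - s) := i1
            have i2' : Integrable fun s => Ψ (Z s) * K (t - s) := i2
            simp_rw [sub_mul]
            rw [← mul_sub, integral_sub i1' i2', enorm_mul]
            gcongr
            rw [Real.enorm_eq_ofReal_abs]
            exact ENNReal.ofReal_le_ofReal (hCζ' t (Ioo_subset_Icc_self ht))
        _ ≤ ∫⁻ t, ENNReal.ofReal Cζ' * ‖∫ s, (Ψ (zn n s) - Ψ (Z s)) * K (t - s)‖ₑ :=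
            setLIntegral_le_lintegral _ _
        _ = ENNReal.ofReal Cζ' * ∫⁻ t, ‖∫ s, (Ψ (zn n s) - Ψ (Z s)) * K (t - s)‖ₑ :=
            lintegral_const_mul' _ _ ENNReal.ofReal_ne_top
        _ ≤ _ := by
            gcongr
            refine (lintegral_convolution_le hh hK).trans ?_
            gcongr
            rw [← lintegral_const_mul' _ _ ENNReal.ofReal_ne_top]
            refine lintegral_mono fun s => ?_
            rw [Real.enorm_eq_ofReal_abs, Real.enorm_eq_ofReal_abs,
              ← ENNReal.ofReal_mul ((abs_nonneg _).trans (hψM 0))]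
            exact ENNReal.ofReal_le_ofReal (hΨL _ _)
    have hlim : Tendsto (fun n => ENNReal.ofReal Cζ' *
        ((ENNReal.ofReal M * ∫⁻ s, ‖zn n s - Z s‖ₑ) * ∫⁻ s, ‖K s‖ₑ)) atTop (𝓝 0) := by
      have a1 := ENNReal.Tendsto.const_mul L1z (Or.inr (ENNReal.ofReal_ne_top (r := M)))
      have a2 := ENNReal.Tendsto.mul_const a1 (Or.inr (hK.2.ne))
      have a3 := ENNReal.Tendsto.const_mul a2 (Or.inr (ENNReal.ofReal_ne_top (r := Cζ')))
      simpa using a3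
    exact tendsto_of_tendsto_of_tendsto_of_le_of_le tendsto_const_nhds hlim
      (fun _ => zero_le) hb
  have eL : ∀ n, ∫ t in Ioo 0 T, deriv ζ t * ∫ s in (0 : ℝ)..t, κ (t - s) * Ψ (zn n s) =
      ∫ t in Ioo 0 T, deriv ζ t * ∫ s, Ψ (zn n s) * K (t - s) := fun n =>
    setIntegral_congr_fun measurableSet_Ioo fun t ht => by simp only [hconv (hznz n) t ht]
  have eL' : ∫ t in Ioo 0 T, deriv ζ t * ∫ s in (0 : ℝ)..t, κ (t - s) * Ψ (z s) =
      ∫ t in Ioo 0 T, deriv ζ t * ∫ s, Ψ (Z s) * K (t - s) := by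
    refine setIntegral_congr_fun measurableSet_Ioo fun t ht => ?_
    simp only [← hconv hZ0 t ht]
    congr 1
    refine intervalIntegral.integral_congr_ae ?_
    have hne : ∀ᵐ s : ℝ, s ≠ t := by simp [ae_iff, measure_singleton]
    filter_upwards [hne] with s _ hs
    rw [uIoc_of_le ht.1.le] at hs
    simp only [Z]
    rw [indicator_of_mem (show s ∈ Ioo 0 T from ⟨hs.1, hs.2.trans_lt ht.2⟩)]
  -- convergence of the right-hand sides
  have hψn : ∀ n, AEStronglyMeasurable (fun t => ψ (zn n t)) (volume.restrict (Ioo 0 T)) :=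
    fun n => (hψc.comp (hzn n).continuous).aestronglyMeasurable
  have hζb : ∀ᵐ t ∂(volume.restrict (Ioo 0 T)), ‖ζ t‖ ≤ Cζ := by
    filter_upwards [ae_restrict_mem measurableSet_Ioo] with t ht using
      hCζ t (Ioo_subset_Icc_self ht)
  have hζg : ∀ {y : ℝ → ℝ}, Integrable y → Integrable (fun t => ζ t * y t)
      (volume.restrict (Ioo 0 T)) := fun {y} hy =>
    hy.restrict.bdd_mul hζ.continuous.aestronglyMeasurable (c := Cζ) hζb
  have hib2 : ∀ n {y : ℝ → ℝ}, Integrable y → Integrable (fun t => ζ t * y t * ψ (zn n t))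
      (volume.restrict (Ioo 0 T)) := fun n {y} hy =>
    (hζg hy).mul_bdd (c := M) (hψn n) (Eventually.of_forall fun t => hψM _)
  have lim2 : Tendsto (fun n => ∫ t in Ioo 0 T, ζ t * (gn n t - G t) * ψ (zn n t)) atTop
      (𝓝 (∫ _ in Ioo 0 T, 0)) := by
    refine tendsto_integral_of_L1 _ aestronglyMeasurable_const
      (Eventually.of_forall fun n => hib2 n ((hgni n).sub hG)) ?_
    have hb : ∀ n, ∫⁻ t in Ioo 0 T, ‖ζ t * (gn n t - G t) * ψ (zn n t) - 0‖ₑ ≤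
        ENNReal.ofReal (Cζ * M) * ∫⁻ t, ‖gn n t - G t‖ₑ := by
      intro n
      calc _ ≤ ∫⁻ t in Ioo 0 T, ENNReal.ofReal (Cζ * M) * ‖gn n t - G t‖ₑ := by
            refine lintegral_mono_ae ?_
            filter_upwards [hζb] with t ht
            rw [sub_zero, Real.enorm_eq_ofReal_abs, Real.enorm_eq_ofReal_abs,
              ← ENNReal.ofReal_mul (mul_nonneg ((norm_nonneg _).trans ht)
                ((abs_nonneg _).trans (hψM 0))), abs_mul, abs_mul]
            refine ENNReal.ofReal_le_ofReal ?_
            rw [Real.norm_eq_abs] at ht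
            calc |ζ t| * |gn n t - G t| * |ψ (zn n t)| ≤ Cζ * |gn n t - G t| * M := by
                  gcongr
                  · exact mul_nonneg ((abs_nonneg _).trans ht) (abs_nonneg _)
                  · exact hψM _
              _ = _ := by ring
        _ ≤ ∫⁻ t, ENNReal.ofReal (Cζ * M) * ‖gn n t - G t‖ₑ := setLIntegral_le_lintegral _ _
        _ = _ := lintegral_const_mul' _ _ ENNReal.ofReal_ne_top
    refine tendsto_of_tendsto_of_tendsto_of_le_of_le tendsto_const_nhds ?_
      (fun _ => zero_le) hb
    simpa using ENNReal.Tendsto.const_mul L1g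
      (Or.inr (ENNReal.ofReal_ne_top (r := Cζ * M)))
  have lim3 : Tendsto (fun n => ∫ t in Ioo 0 T, ζ t * G t * ψ (zn n t)) atTop
      (𝓝 (∫ t in Ioo 0 T, ζ t * G t * ψ (Z t))) := by
    refine tendsto_integral_of_dominated_convergence (fun t => ‖ζ t * G t‖ * M)
      (fun n => (hib2 n hG).1) ((hζg hG).norm.mul_const M)
      (fun n => Eventually.of_forall fun t => ?_) ?_
    · rw [norm_mul]
      exact mul_le_mul_of_nonneg_left (hψM _) (norm_nonneg _)
    · filter_upwards [ae_restrict_of_ae hae] with t ht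
      exact ((hψc.tendsto _).comp ht).const_mul _
  have lim4 : Tendsto (fun n => ∫ t in Ioo 0 T, ζ t * gn n t * ψ (zn n t)) atTop
      (𝓝 (∫ t in Ioo 0 T, ζ t * G t * ψ (Z t))) := by
    have := lim2.add lim3
    rw [integral_zero, zero_add] at this
    refine this.congr fun n => ?_
    refine (integral_add (hib2 n ((hgni n).sub hG)) (hib2 n hG)).symm.trans ?_
    congr 1 with t
    simp only [Pi.sub_apply]; ring
  have eR : ∫ t in Ioo 0 T, ζ t * g t * ψ (z t) = ∫ t in Ioo 0 T, ζ t * G t * ψ (Z t) :=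
    setIntegral_congr_fun measurableSet_Ioo fun t ht => by
      simp only [G, Z, indicator_of_mem ht]
  rw [eL', eR]
  refine le_of_tendsto_of_tendsto' lim1.neg lim4 fun n => ?_
  rw [← eL n]
  exact key n

end Convexity

/-! ### The measure `db`, and localization in time of the weak formulation -/

section Slices

section Stieltjes

variable {φ : ℝ → ℝ}

theorem HypPhi.bInv_apply (hφ : HypPhi φ) (r : ℝ) : bInv φ (φ r) = r :=
  Function.leftInverse_invFun hφ.strictMono.injective r

theorem HypPhi.continuous_bInv (hφ : HypPhi φ) : Continuous (bInv φ) :=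
  hφ.monotone_bInv.continuous_of_surjective fun r => ⟨φ r, hφ.bInv_apply r⟩

theorem HypPhi.preimage_Ioc (hφ : HypPhi φ) (a b : ℝ) :
    φ ⁻¹' Ioc a b = Ioc (bInv φ a) (bInv φ b) := by
  ext r
  simp only [mem_preimage, mem_Ioc]
  rw [← hφ.strictMono.lt_iff_lt (a := bInv φ a), ← hφ.strictMono.le_iff_le (b := bInv φ b),
    hφ.apply_bInv, hφ.apply_bInv]

/-- The measure `db` is the image of Lebesgue measure under `φ = b⁻¹`. -/
theorem dB_eq_map (hφ : HypPhi φ) : dB hφ = Measure.map φ volume := by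
  rw [dB]
  refine Measure.ext_of_Ioc _ _ fun a b _ => ?_
  have hs : ∀ s, hφ.monotone_bInv.stieltjesFunction s = bInv φ s := fun s => by
    rw [hφ.monotone_bInv.stieltjesFunction_eq]
    exact hφ.continuous_bInv.continuousAt.continuousWithinAt.rightLim_eq
  rw [StieltjesFunction.measure_Ioc, hs, hs,
    Measure.map_apply hφ.contDiff.continuous.measurable measurableSet_Ioc, hφ.preimage_Ioc,
    Real.volume_Ioc]

/-- The change of variables `σ = φ(r)` in an integral against `db`. -/
theorem intervalIntegral_dB (hφ : HypPhi φ) {F : ℝ → ℝ} (hF : Continuous F) (a b : ℝ) :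
    ∫ σ in (φ a)..(φ b), F σ ∂(dB hφ) = ∫ r in a..b, F (φ r) := by
  have key : ∀ a b, ∫ σ in Ioc (φ a) (φ b), F σ ∂(dB hφ) = ∫ r in Ioc a b, F (φ r) := by
    intro a b
    rw [dB_eq_map, setIntegral_map measurableSet_Ioc hF.aestronglyMeasurable
      hφ.contDiff.continuous.aemeasurable, hφ.preimage_Ioc, hφ.bInv_apply, hφ.bInv_apply]
  rw [intervalIntegral, intervalIntegral, key, key]

end Stieltjes

theorem integrable_inner_of_memLp {α F : Type*} [MeasurableSpace α] {μ : Measure α}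
    [NormedAddCommGroup F] [InnerProductSpace ℝ F] {J D : α → F} (hJ : MemLp J 2 μ)
    (hD : MemLp D 2 μ) : Integrable (fun x => inner ℝ (J x) (D x)) μ := by
  rw [← memLp_one_iff_integrable]
  refine MemLp.of_bilin (p := 2) (q := 2) (fun a b => inner ℝ a b) 1 hJ hD
    (hJ.1.inner hD.1) (Eventually.of_forall fun x => ?_)
  rw [one_mul]
  exact nnnorm_inner_le_nnnorm _ _

theorem tendsto_integral_inner {α F : Type*} [MeasurableSpace α] {μ : Measure α}
    [NormedAddCommGroup F] [InnerProductSpace ℝ F] {J D : α → F} {Dn : ℕ → α → F}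
    (hJ : MemLp J 2 μ) (hD : MemLp D 2 μ) (hDn : ∀ n, MemLp (Dn n) 2 μ)
    (hlim : Tendsto (fun n => eLpNorm (Dn n - D) 2 μ) atTop (𝓝 0)) :
    Tendsto (fun n => ∫ x, inner ℝ (J x) (Dn n x) ∂μ) atTop
      (𝓝 (∫ x, inner ℝ (J x) (D x) ∂μ)) := by
  refine tendsto_integral_of_L1 _ (integrable_inner_of_memLp hJ hD).1
    (Eventually.of_forall fun n => integrable_inner_of_memLp hJ (hDn n)) ?_
  have hb : ∀ n, ∫⁻ x, ‖inner ℝ (J x) (Dn n x) - inner ℝ (J x) (D x)‖ₑ ∂μ ≤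
      eLpNorm J 2 μ * eLpNorm (Dn n - D) 2 μ := by
    intro n
    have := eLpNorm_le_eLpNorm_mul_eLpNorm'_of_norm (p := 2) (q := 2) (r := 1) hJ.1
      ((hDn n).sub hD).1 (fun a b => inner ℝ a b) 1 (Eventually.of_forall fun x => by
        rw [NNReal.coe_one, one_mul]; exact norm_inner_le_norm _ _)
    rw [eLpNorm_one_eq_lintegral_enorm, ENNReal.coe_one, one_mul] at this
    simpa only [Pi.sub_apply, inner_sub_right] using this
  refine tendsto_of_tendsto_of_tendsto_of_le_of_le tendsto_const_nhds ?_ (fun _ => zero_le) hb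
  simpa using ENNReal.Tendsto.const_mul hlim (Or.inr hJ.2.ne)

variable {d : ℕ} {Ω : Set (E d)}

/-- There is a countable set of test functions which is dense for the uniform convergence, on
bounded sets, of the functions and of their gradients. -/
theorem exists_countable_dense_test (Ω : Set (E d)) (hΩb : Bornology.IsBounded Ω) :
    ∃ D : Set (E d → ℝ), D.Countable ∧ (∀ ψ ∈ D, IsTest Ω ψ) ∧
      ∀ ψ, IsTest Ω ψ → ∃ ψn : ℕ → E d → ℝ, (∀ n, ψn n ∈ D) ∧
        TendstoUniformlyOn ψn ψ atTop Ω ∧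
        TendstoUniformlyOn (fun n => gradient (ψn n)) (gradient ψ) atTop Ω := by
  let ι : {ψ : E d → ℝ // IsTest Ω ψ} → C(E d, ℝ × E d) := fun ψ =>
    ⟨fun x => (ψ.1 x, gradient ψ.1 x), ψ.2.smooth.continuous.prodMk
      (continuous_gradient ψ.2.smooth)⟩
  obtain ⟨s, hs, hd⟩ := TopologicalSpace.exists_countable_dense (range ι)
  choose pre hpre using fun y : range ι => y.2
  refine ⟨(fun y => (pre y).1) '' s, hs.image _, ?_, fun ψ hψ => ?_⟩
  · rintro _ ⟨y, -, rfl⟩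
    exact (pre y).2
  · obtain ⟨y, hy, hlim⟩ := mem_closure_iff_seq_limit.1 (hd ⟨ι ⟨ψ, hψ⟩, mem_range_self _⟩)
    have h2 : Tendsto (fun n => (y n : C(E d, ℝ × E d))) atTop (𝓝 (ι ⟨ψ, hψ⟩)) :=
      (continuous_subtype_val.tendsto _).comp hlim
    have h3 := ContinuousMap.tendsto_iff_forall_isCompact_tendstoUniformlyOn.1 h2
      (closure Ω) hΩb.isCompact_closure
    have h4 : TendstoUniformlyOn
        (fun n x => ((pre (y n)).1 x, gradient (pre (y n)).1 x))
        (fun x => (ψ x, gradient ψ x)) atTop Ω := by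
      refine (h3.mono subset_closure).congr (Eventually.of_forall fun n x _ => ?_)
      simp only [← hpre (y n)]
      rfl
    refine ⟨fun n => (pre (y n)).1, fun n => mem_image_of_mem _ (hy n), ?_, ?_⟩
    · exact uniformContinuous_fst.comp_tendstoUniformlyOn h4
    · exact uniformContinuous_snd.comp_tendstoUniformlyOn h4

/-- An identity valid for a countable dense set of test functions extends to all of
`H¹₀(Ω) ∩ L^∞(Ω)`. -/
theorem weak_identity_extend (hΩm : MeasurableSet Ω)
    {D : Set (E d → ℝ)} (hD : ∀ ψ ∈ D, IsTest Ω ψ)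
    (hdense : ∀ ψ, IsTest Ω ψ → ∃ ψn : ℕ → E d → ℝ, (∀ n, ψn n ∈ D) ∧
        TendstoUniformlyOn ψn ψ atTop Ω ∧
        TendstoUniformlyOn (fun n => gradient (ψn n)) (gradient ψ) atTop Ω)
    [IsFiniteMeasure ((volume : Measure (E d)).restrict Ω)]
    {h : E d → ℝ} {J : E d → E d} (hh : IntegrableOn h Ω) (hJ : MemLp J 2 (volume.restrict Ω))
    (hid : ∀ ψ ∈ D, ∫ x in Ω, (h x * ψ x + inner ℝ (J x) (gradient ψ x)) = 0)
    {w : E d → ℝ} {G : E d → E d} (hw : MemH10 Ω w G) (hwb : MemLp w ∞ (volume.restrict Ω)) :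
    ∫ x in Ω, (h x * w x + inner ℝ (J x) (G x)) = 0 := by
  have hJ1 : Integrable J (volume.restrict Ω) := hJ.integrable (by norm_num)
  have htest : ∀ ψ, IsTest Ω ψ →
      ∫ x in Ω, (h x * ψ x + inner ℝ (J x) (gradient ψ x)) = 0 := by
    intro ψ hψ
    obtain ⟨ψn, hψn, u1, u2⟩ := hdense ψ hψ
    obtain ⟨C1, hC1⟩ := hψ.smooth.continuous.bounded_above_of_compact_support hψ.compact
    obtain ⟨C2, hC2⟩ := (continuous_gradient hψ.smooth).bounded_above_of_compact_support
      (hasCompactSupport_gradient hψ.compact)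
    have hlim : Tendsto (fun n => ∫ x in Ω, (h x * ψn n x + inner ℝ (J x) (gradient (ψn n) x)))
        atTop (𝓝 (∫ x in Ω, (h x * ψ x + inner ℝ (J x) (gradient ψ x)))) := by
      refine tendsto_integral_filter_of_dominated_convergence
        (fun x => ‖h x‖ * (C1 + 1) + ‖J x‖ * (C2 + 1)) ?_ ?_
        ((hh.norm.mul_const _).add (hJ1.norm.mul_const _)) ?_
      · exact Eventually.of_forall fun n => (hh.1.mul ((hD _ (hψn n)).memLp 2).1).add
          (hJ.1.inner ((hD _ (hψn n)).memLp_gradient 2).1)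
      · filter_upwards [Metric.tendstoUniformlyOn_iff.1 u1 1 one_pos,
          Metric.tendstoUniformlyOn_iff.1 u2 1 one_pos] with n h1 h2
        filter_upwards [ae_restrict_mem hΩm] with x hx
        have b1 : ‖ψn n x‖ ≤ C1 + 1 := by
          have := h1 x hx
          rw [dist_comm, dist_eq_norm] at this
          linarith [norm_le_norm_add_norm_sub' (ψn n x) (ψ x), hC1 x]
        have b2 : ‖gradient (ψn n) x‖ ≤ C2 + 1 := by
          have := h2 x hx
          rw [dist_comm, dist_eq_norm] at this
          linarith [norm_le_norm_add_norm_sub' (gradient (ψn n) x) (gradient ψ x), hC2 x]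
        refine (norm_add_le _ _).trans (add_le_add ?_ ?_)
        · rw [norm_mul]; gcongr
        · exact (norm_inner_le_norm _ _).trans (by gcongr)
      · filter_upwards [ae_restrict_mem hΩm] with x hx
        exact ((u1.tendsto_at hx).const_mul _).add
          (((continuous_const (y := J x)).inner continuous_id).continuousAt.tendsto.comp
            (u2.tendsto_at hx))
    have : (fun n => ∫ x in Ω, (h x * ψn n x + inner ℝ (J x) (gradient (ψn n) x))) =
        fun _ => 0 := funext fun n => hid _ (hψn n)
    rw [this] at hlim
    exact (tendsto_nhds_unique hlim tendsto_const_nhds)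
  -- approximate `w` by test functions truncated above the bound of `w`
  obtain ⟨M, hM0, hM⟩ : ∃ M : ℝ, 0 ≤ M ∧ ∀ᵐ x ∂(volume.restrict Ω), |w x| ≤ M := by
    refine ⟨(eLpNorm w ∞ (volume.restrict Ω)).toReal, ENNReal.toReal_nonneg, ?_⟩
    rw [eLpNorm_exponent_top]
    filter_upwards [enorm_ae_le_eLpNormEssSup w (volume.restrict Ω)] with x hx
    rw [← Real.norm_eq_abs, ← toReal_enorm]
    refine ENNReal.toReal_mono ?_ hx
    have := hwb.2
    rw [eLpNorm_exponent_top] at this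
    exact this.ne
  obtain ⟨θ, C, hθ, hθ0, hθL, hθC, hθM⟩ := exists_smooth_truncation hM0
  obtain ⟨ψ, hψ, hθψ, -, e2, hae⟩ := hw.exists_seq_comp hθ hθ0 hθL
  obtain ⟨hw2, hG2, -⟩ := id hw
  have e2' : Tendsto (fun n => eLpNorm (gradient (fun x => θ (ψ n x)) - G) 2
      (volume.restrict Ω)) atTop (𝓝 0) := by
    refine e2.congr fun n => eLpNorm_congr_ae ?_
    filter_upwards [hM] with x hx
    simp [(hθM _ hx).2]
  have l1 := tendsto_integral_inner hJ hG2 (fun n => (hθψ n).memLp_gradient 2) e2'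
  have l2 : Tendsto (fun n => ∫ x in Ω, h x * θ (ψ n x)) atTop (𝓝 (∫ x in Ω, h x * w x)) := by
    refine tendsto_integral_of_dominated_convergence (fun x => ‖h x‖ * C)
      (fun n => hh.1.mul ((hθψ n).memLp 2).1) (hh.norm.mul_const _)
      (fun n => Eventually.of_forall fun x => ?_) ?_
    · rw [norm_mul]; gcongr; exact hθC _
    · filter_upwards [hae, hM] with x hx hb
      rw [(hθM _ hb).1] at hx
      exact hx.const_mul _
  have hbd : ∀ n, Integrable (fun x => h x * θ (ψ n x)) (volume.restrict Ω) := fun n =>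
    hh.mul_bdd (c := C) ((hθψ n).memLp 2).1 (Eventually.of_forall fun x => hθC _)
  rw [integral_add (hh.mul_bdd (c := M) hw2.1 hM) (integrable_inner_of_memLp hJ hG2)]
  refine tendsto_nhds_unique (l2.add l1) (tendsto_const_nhds.congr fun n => ?_)
  rw [← integral_add (hbd n) (integrable_inner_of_memLp hJ ((hθψ n).memLp_gradient 2))]
  exact (htest _ (hθψ n)).symm

/-- Localization in time of the weak formulation: tested with products `θ(t) ψ(x)`, it holds on
almost every time slice, simultaneously for all test functions in `H¹₀(Ω) ∩ L^∞(Ω)`. -/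
theorem ae_slice_identity {T : ℝ} (hΩo : IsOpen Ω) (hΩb : Bornology.IsBounded Ω)
    {h : ℝ → E d → ℝ} {J : ℝ → E d → E d} (hh : IntegrableOn (Function.uncurry h) (cyl T Ω))
    (hJ : MemLp (Function.uncurry J) 2 (volume.restrict (cyl T Ω)))
    (hid : ∀ (θ : ℝ → ℝ) (ψ : E d → ℝ), ContDiff ℝ ∞ θ → HasCompactSupport θ →
      tsupport θ ⊆ Ioo 0 T → IsTest Ω ψ →
      ∫ z in cyl T Ω, θ z.1 * (h z.1 z.2 * ψ z.2 + inner ℝ (J z.1 z.2) (gradient ψ z.2)) = 0) :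
    ∀ᵐ t ∂(volume.restrict (Ioo 0 T)), ∀ (w : E d → ℝ) (G : E d → E d), MemH10 Ω w G →
      MemLp w ∞ (volume.restrict Ω) →
      ∫ x in Ω, (h t x * w x + inner ℝ (J t x) (G x)) = 0 := by
  have hfin : IsFiniteMeasure ((volume : Measure (E d)).restrict Ω) :=
    ⟨by rw [Measure.restrict_apply_univ]; exact hΩb.measure_lt_top⟩
  have hfin2 : IsFiniteMeasure ((volume : Measure (ℝ × E d)).restrict (cyl T Ω)) := by
    rw [restrict_cyl]; infer_instance
  obtain ⟨D, hDc, hD, hdense⟩ := exists_countable_dense_test Ω hΩb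
  have hslice : ∀ ψ ∈ D, ∀ᵐ t ∂(volume.restrict (Ioo 0 T)),
      ∫ x in Ω, (h t x * ψ x + inner ℝ (J t x) (gradient ψ x)) = 0 := by
    intro ψ hψD
    have hψ := hD ψ hψD
    obtain ⟨C1, hC1⟩ := hψ.smooth.continuous.bounded_above_of_compact_support hψ.compact
    have hi : Integrable (fun z : ℝ × E d => h z.1 z.2 * ψ z.2 +
        inner ℝ (J z.1 z.2) (gradient ψ z.2)) (volume.restrict (cyl T Ω)) := by
      refine Integrable.add ?_ ?_
      · exact Integrable.mul_bdd hh (c := C1)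
          (hψ.smooth.continuous.comp continuous_snd).aestronglyMeasurable
          (Eventually.of_forall fun z => hC1 _)
      · refine integrable_inner_of_memLp hJ ?_
        rw [restrict_cyl]
        exact (hψ.memLp_gradient 2).comp_snd _
    rw [restrict_cyl] at hi
    have hF : IntegrableOn (fun t => ∫ x in Ω, (h t x * ψ x + inner ℝ (J t x) (gradient ψ x)))
        (Ioo 0 T) := hi.integral_prod_left
    -- the fundamental lemma of the calculus of variations, in time
    have := isOpen_Ioo.ae_eq_zero_of_integral_contDiff_smul_eq_zero
      (hF.locallyIntegrableOn) (fun θ h1 h2 h3 => ?_)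
    · rwa [ae_restrict_iff' measurableSet_Ioo]
    · have e := hid θ ψ h1 h2 h3 hψ
      obtain ⟨C, hC⟩ := h1.continuous.bounded_above_of_compact_support h2
      have hi' := hi.bdd_mul (c := C) (f := fun z => θ z.1)
        (h1.continuous.comp continuous_fst).aestronglyMeasurable
        (Eventually.of_forall fun z => hC _)
      rw [restrict_cyl, integral_prod _ hi'] at e
      refine Eq.trans ?_ e
      rw [← setIntegral_eq_integral_of_forall_compl_eq_zero (s := Ioo 0 T) fun t ht => ?_]
      · exact setIntegral_congr_fun measurableSet_Ioo fun t _ => (integral_const_mul _ _).symm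
      · rw [image_eq_zero_of_notMem_tsupport (fun h' => ht (h3 h')), zero_smul]
  rw [restrict_cyl] at hJ
  have hJs : ∀ᵐ t ∂(volume.restrict (Ioo 0 T)), MemLp (J t) 2 (volume.restrict Ω) := by
    have h1 := (memLp_two_iff_integrable_sq_norm hJ.1).1 hJ
    filter_upwards [h1.prod_right_ae, hJ.1.prodMk_left] with t ht hm
    exact (memLp_two_iff_integrable_sq_norm hm).2 ht
  have hhs : ∀ᵐ t ∂(volume.restrict (Ioo 0 T)), IntegrableOn (h t) Ω := by
    rw [IntegrableOn, restrict_cyl] at hh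
    exact hh.prod_right_ae
  filter_upwards [(ae_ball_iff hDc).2 hslice, hJs, hhs] with t h1 h2 h3 w G hwG hwb
  exact weak_identity_extend hΩo.measurableSet hD hdense h3 h2 h1 hwG hwb

end Slices

/-! ### Testing the weak formulation on the cylinder -/

section Testing

theorem memLp_toEuclideanLin {α : Type*} [MeasurableSpace α] {μ : Measure α} {d : ℕ}
    {A : α → Matrix (Fin d) (Fin d) ℝ} {G : α → E d} (hA : ∀ i j, MemLp (fun z => A z i j) ∞ μ)
    (hG : MemLp G 2 μ) : MemLp (fun z => Matrix.toEuclideanLin (A z) (G z)) 2 μ := by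
  refine MemLp.of_eval_piLp fun i => ?_
  have : (fun z => (Matrix.toEuclideanLin (A z) (G z)) i) = fun z => ∑ j, A z i j * G z j := by
    ext z
    simp [Matrix.toLpLin_apply, Matrix.mulVec, dotProduct]
  rw [this]
  exact memLp_finsetSum _ fun j _ => (hG.eval_piLp j).mul' (hA i j)

theorem ae_bound_Ioo {X : Type*} [MeasurableSpace X] {μ : Measure X} [SFinite μ] {T : ℝ}
    {θ : ℝ → ℝ} (hθ : Continuous θ) :
    ∃ C, ∀ᵐ z ∂((volume.restrict (Ioo 0 T)).prod μ), ‖θ z.1‖ ≤ C := by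
  obtain ⟨C, hC⟩ := isCompact_Icc.exists_bound_of_continuousOn (s := Icc 0 T) hθ.continuousOn
  exact ⟨C, ae_fst_mem_Ioo.mono fun z hz => hC _ (Ioo_subset_Icc_self hz)⟩

theorem integrable_time_mul {X : Type*} [MeasurableSpace X] {μ : Measure X} [SFinite μ] {T : ℝ}
    {θ : ℝ → ℝ} (hθ : Continuous θ) {w : ℝ × X → ℝ}
    (hw : Integrable w ((volume.restrict (Ioo 0 T)).prod μ)) :
    Integrable (fun z => θ z.1 * w z) ((volume.restrict (Ioo 0 T)).prod μ) := by
  obtain ⟨C, hC⟩ := ae_bound_Ioo (μ := μ) (T := T) hθ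
  exact hw.bdd_mul (c := C) (hθ.comp_aestronglyMeasurable
    measurable_fst.aestronglyMeasurable) hC

/-- Integration by parts in time on the cylinder. -/
theorem integral_prod_deriv_mul {X : Type*} [MeasurableSpace X] {μ : Measure X} [SFinite μ]
    {T C : ℝ} (hT : 0 < T) {W g : ℝ → X → ℝ} {θ : ℝ → ℝ} {ψ : X → ℝ}
    (hg : Integrable (Function.uncurry g) ((volume.restrict (Ioo 0 T)).prod μ))
    (hW : ∀ᵐ z ∂((volume.restrict (Ioo 0 T)).prod μ),
      W z.1 z.2 = ∫ s in (0 : ℝ)..z.1, g s z.2)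
    (hθ : ContDiff ℝ 1 θ) (hθT : θ T = 0) (hψ : AEStronglyMeasurable ψ μ) (hC : ∀ x, ‖ψ x‖ ≤ C) :
    ∫ z, deriv θ z.1 * ψ z.2 * W z.1 z.2 ∂((volume.restrict (Ioo 0 T)).prod μ) =
      -∫ z, θ z.1 * (g z.1 z.2 * ψ z.2) ∂((volume.restrict (Ioo 0 T)).prod μ) := by
  have hθ' : Continuous (deriv θ) := hθ.continuous_deriv (by norm_num)
  have e : ∫ z, deriv θ z.1 * ψ z.2 * W z.1 z.2 ∂((volume.restrict (Ioo 0 T)).prod μ) =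
      ∫ z, deriv θ z.1 * ((∫ s in (0 : ℝ)..z.1, g s z.2) * ψ z.2)
        ∂((volume.restrict (Ioo 0 T)).prod μ) := by
    refine integral_congr_ae ?_
    filter_upwards [hW] with z hz
    rw [hz]; ring
  have i1 := integrable_time_mul hθ' ((integrable_primitive hg).mul_bdd (c := C)
    hψ.comp_snd (Eventually.of_forall fun z => hC z.2))
  have i2 := integrable_time_mul hθ.continuous (hg.mul_bdd (c := C)
    hψ.comp_snd (Eventually.of_forall fun z => hC z.2))
  rw [e, integral_prod_symm _ i1]
  refine Eq.trans ?_ (congrArg Neg.neg (integral_prod_symm _ i2)).symm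
  rw [← integral_neg]
  refine integral_congr_ae ?_
  filter_upwards [hg.prod_left_ae] with x hx
  have := integral_deriv_mul_primitive hT hθ hθT hx
  calc ∫ t in Ioo 0 T, deriv θ t * ((∫ s in (0 : ℝ)..t, g s x) * ψ x)
      = (∫ t in Ioo 0 T, deriv θ t * ∫ s in (0 : ℝ)..t, g s x) * ψ x := by
        rw [← integral_mul_const]; congr 1 with t; ring
    _ = -∫ t in Ioo 0 T, θ t * (g t x * ψ x) := by
        rw [show (∫ t in Ioo 0 T, deriv θ t * ∫ s in (0 : ℝ)..t, g s x) =
          -∫ t in Ioo 0 T, θ t * g t x from this, neg_mul, ← integral_mul_const]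
        congr 2 with t; ring

/-- The convexity inequality, integrated over the space variable. -/
theorem integral_convexity_inequality {X : Type*} [MeasurableSpace X] {μ : Measure X} [SFinite μ]
    {κ ζ : ℝ → ℝ} {T M : ℝ} {w g : ℝ → X → ℝ} {Ψ ψ : X → ℝ → ℝ} (hT : 0 < T)
    (hκ : AntitoneOn κ (Ioo 0 T)) (h0 : ∀ t ∈ Ioo 0 T, 0 ≤ κ t) (hi : IntegrableOn κ (Ioo 0 T))
    (hw : Integrable (Function.uncurry w) ((volume.restrict (Ioo 0 T)).prod μ))
    (hg : Integrable (Function.uncurry g) ((volume.restrict (Ioo 0 T)).prod μ))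
    (hwg : ∀ᵐ z ∂((volume.restrict (Ioo 0 T)).prod μ),
      ∫ s in (0 : ℝ)..z.1, κ (z.1 - s) * w s z.2 = ∫ s in (0 : ℝ)..z.1, g s z.2)
    (hΨ : ∀ x r, HasDerivAt (Ψ x) (ψ x r) r) (hψc : ∀ x, Continuous (ψ x))
    (hψm : ∀ x, Monotone (ψ x)) (hψM : ∀ x r, |ψ x r| ≤ M) (hΨ0 : ∀ x, Ψ x 0 = 0)
    (hΨi : Integrable (fun z : ℝ × X => Ψ z.2 (w z.1 z.2)) ((volume.restrict (Ioo 0 T)).prod μ))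
    (hψi : AEStronglyMeasurable (fun z : ℝ × X => ψ z.2 (w z.1 z.2))
      ((volume.restrict (Ioo 0 T)).prod μ))
    (hζ : ContDiff ℝ 1 ζ) (hζT : ζ T = 0) (hζ0 : ∀ t ∈ Ioo 0 T, 0 ≤ ζ t) :
    -(∫ z, deriv ζ z.1 * (∫ s in (0 : ℝ)..z.1, κ (z.1 - s) * Ψ z.2 (w s z.2))
        ∂((volume.restrict (Ioo 0 T)).prod μ)) ≤
      ∫ z, ζ z.1 * g z.1 z.2 * ψ z.2 (w z.1 z.2) ∂((volume.restrict (Ioo 0 T)).prod μ) := by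
  have i1 := integrable_time_mul (hζ.continuous_deriv (by norm_num))
    (integrable_conv hi (w := fun t x => Ψ x (w t x)) hΨi)
  have i2 : Integrable (fun z : ℝ × X => ζ z.1 * g z.1 z.2 * ψ z.2 (w z.1 z.2))
      ((volume.restrict (Ioo 0 T)).prod μ) :=
    (integrable_time_mul hζ.continuous hg).mul_bdd (c := M) hψi
      (Eventually.of_forall fun z => hψM _ _)
  rw [integral_prod_symm _ i1, integral_prod_symm _ i2, ← integral_neg]
  refine integral_mono_ae i1.integral_prod_right.neg i2.integral_prod_right ?_
  have hwg' : ∀ᵐ x ∂μ, ∀ᵐ t ∂(volume.restrict (Ioo 0 T)),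
      ∫ s in (0 : ℝ)..t, κ (t - s) * w s x = ∫ s in (0 : ℝ)..t, g s x :=
    Measure.ae_ae_of_ae_prod (Measure.measurePreserving_swap.quasiMeasurePreserving.ae hwg)
  filter_upwards [hwg', hw.prod_left_ae, hg.prod_left_ae] with x h1 h2 h3
  exact convexity_inequality hT hκ h0 hi h2 h3 h1 (hΨ x) (hψc x) (hψm x) (hψM x) (hΨ0 x)
    hζ hζT hζ0

variable {d : ℕ} {Ω : Set (E d)} {T : ℝ}

/-- A product `θ(t) ψ(x)` of test functions is admissible in the weak formulation. -/
theorem memW11_product {θ : ℝ → ℝ} {ψ : E d → ℝ} (hθ : ContDiff ℝ ∞ θ) (hψ : IsTest Ω ψ) :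
    MemW11 2 T Ω (fun t x => θ t * ψ x) (fun x => θ 0 * ψ x) (fun t x => deriv θ t * ψ x) := by
  have hθ' : Continuous (deriv θ) := hθ.continuous_deriv (by norm_num)
  refine ⟨(hψ.memLp 2).const_mul _, ⟨?_, ?_⟩, Eventually.of_forall fun z => ?_⟩
  · exact ((hθ'.comp continuous_fst).mul
      (hψ.smooth.continuous.comp continuous_snd)).aestronglyMeasurable
  · have e : ∀ t, eLpNorm (fun x => deriv θ t * ψ x) 2 (volume.restrict Ω) =
        ‖deriv θ t‖ₑ * eLpNorm ψ 2 (volume.restrict Ω) := fun t =>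
      eLpNorm_const_smul (deriv θ t) ψ 2 _
    simp_rw [e]
    rw [lintegral_mul_const' _ _ (hψ.memLp 2).2.ne]
    exact ENNReal.mul_lt_top
      (hθ'.integrableOn_Icc.mono_set (Ioo_subset_Icc_self (a := 0) (b := T))).2 (hψ.memLp 2).2
  · rw [intervalIntegral.integral_mul_const, intervalIntegral.integral_deriv_eq_sub
      (fun s _ => hθ.differentiable (by norm_num) s) (hθ'.intervalIntegrable _ _)]
    ring

theorem memL2H10_product [IsFiniteMeasure ((volume : Measure (E d)).restrict Ω)]
    {θ : ℝ → ℝ} {ψ : E d → ℝ} (hθ : Continuous θ) (hψ : IsTest Ω ψ) :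
    MemL2H10 T Ω (fun t x => θ t * ψ x) (fun t x => θ t • gradient ψ x) := by
  have hfin2 : IsFiniteMeasure ((volume : Measure (ℝ × E d)).restrict (cyl T Ω)) := by
    rw [restrict_cyl]; infer_instance
  obtain ⟨C, hC⟩ := ae_bound_Ioo (μ := (volume : Measure (E d)).restrict Ω) (T := T) hθ
  rw [← restrict_cyl] at hC
  obtain ⟨C1, hC1⟩ := hψ.smooth.continuous.bounded_above_of_compact_support hψ.compact
  obtain ⟨C2, hC2⟩ := (continuous_gradient hψ.smooth).bounded_above_of_compact_support
    (hasCompactSupport_gradient hψ.compact)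
  refine ⟨MemLp.of_bound ?_ (C * C1) ?_, MemLp.of_bound ?_ (C * C2) ?_,
    Eventually.of_forall fun t => hψ.memH10.smul (θ t)⟩
  · exact ((hθ.comp continuous_fst).mul
      (hψ.smooth.continuous.comp continuous_snd)).aestronglyMeasurable
  · filter_upwards [hC] with z hz
    rw [Function.uncurry, norm_mul]
    exact mul_le_mul hz (hC1 _) (norm_nonneg _) ((norm_nonneg _).trans hz)
  · exact ((hθ.comp continuous_fst).smul
      ((continuous_gradient hψ.smooth).comp continuous_snd)).aestronglyMeasurable
  · filter_upwards [hC] with z hz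
    rw [Function.uncurry, norm_smul]
    exact mul_le_mul hz (hC2 _) (norm_nonneg _) ((norm_nonneg _).trans hz)

/-- If `∂ₜ[k ∗ (u - u₀)] = g` is integrable, a weak solution satisfies
`g(t) - div (A(t) ∇φ(u(t))) = f(t)` in the dual of `H¹₀(Ω) ∩ L^∞(Ω)`, for almost every `t`. -/
theorem ae_slice_identity_of_weak (hT : 0 < T) (hΩo : IsOpen Ω) (hΩb : Bornology.IsBounded Ω)
    {A : ℝ → E d → Matrix (Fin d) (Fin d) ℝ} (hA : HypCoeff T Ω A)
    {f W g : ℝ → E d → ℝ} {G : ℝ → E d → E d} (hf : IntegrableOn (Function.uncurry f) (cyl T Ω))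
    (hG : MemLp (Function.uncurry G) 2 (volume.restrict (cyl T Ω)))
    (hW : MemW11 1 T Ω W 0 g)
    (hweak : ∀ (η : ℝ → E d → ℝ) (η₀ : E d → ℝ) (η' : ℝ → E d → ℝ) (Dη : ℝ → E d → E d),
      MemW11 2 T Ω η η₀ η' → MemL2H10 T Ω η Dη →
      (∀ᵐ x ∂(volume.restrict Ω), η₀ x + ∫ s in (0 : ℝ)..T, η' s x = 0) →
      IntegrableOn (fun z : ℝ × E d => η' z.1 z.2 * W z.1 z.2) (cyl T Ω) →
      IntegrableOn (fun z : ℝ × E d => f z.1 z.2 * η z.1 z.2) (cyl T Ω) →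
      ∫ z in cyl T Ω, (-(η' z.1 z.2 * W z.1 z.2) +
          inner ℝ (Matrix.toEuclideanLin (A z.1 z.2) (G z.1 z.2)) (Dη z.1 z.2)) =
        ∫ z in cyl T Ω, f z.1 z.2 * η z.1 z.2) :
    ∀ᵐ t ∂(volume.restrict (Ioo 0 T)), ∀ (w : E d → ℝ) (D : E d → E d), MemH10 Ω w D →
      MemLp w ∞ (volume.restrict Ω) →
      ∫ x in Ω, ((g t x - f t x) * w x +
        inner ℝ (Matrix.toEuclideanLin (A t x) (G t x)) (D x)) = 0 := by
  have hfin : IsFiniteMeasure ((volume : Measure (E d)).restrict Ω) :=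
    ⟨by rw [Measure.restrict_apply_univ]; exact hΩb.measure_lt_top⟩
  have hg : IntegrableOn (Function.uncurry g) (cyl T Ω) := memL1Lq_one_iff.1 hW.deriv
  have hJ : MemLp (fun z : ℝ × E d => Matrix.toEuclideanLin (A z.1 z.2) (G z.1 z.2)) 2
      (volume.restrict (cyl T Ω)) := memLp_toEuclideanLin hA.bounded hG
  refine ae_slice_identity (h := fun t x => g t x - f t x)
    (J := fun t x => Matrix.toEuclideanLin (A t x) (G t x)) hΩo hΩb (hg.sub hf) hJ ?_
  intro θ ψ hθ hθc hθs hψ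
  have hθ' : Continuous (deriv θ) := hθ.continuous_deriv (by norm_num)
  have hθT : θ T = 0 := image_eq_zero_of_notMem_tsupport fun h => lt_irrefl _ (hθs h).2
  obtain ⟨C, hC⟩ := hψ.smooth.continuous.bounded_above_of_compact_support hψ.compact
  have hWe : ∀ᵐ z ∂(volume.restrict (cyl T Ω)),
      W z.1 z.2 = ∫ s in (0 : ℝ)..z.1, g s z.2 := by
    filter_upwards [hW.eq_integral] with z hz
    simpa using hz
  rw [IntegrableOn, restrict_cyl] at hg hf
  rw [restrict_cyl] at hWe hJ
  have hWi : Integrable (fun z : ℝ × E d => W z.1 z.2)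
      ((volume.restrict (Ioo 0 T)).prod (volume.restrict Ω)) :=
    (integrable_primitive hg).congr (hWe.mono fun z hz => hz.symm)
  have hψm : AEStronglyMeasurable (fun z : ℝ × E d => ψ z.2)
      ((volume.restrict (Ioo 0 T)).prod (volume.restrict Ω)) :=
    (hψ.smooth.continuous.comp continuous_snd).aestronglyMeasurable
  have hψb : ∀ᵐ z ∂((volume.restrict (Ioo 0 T)).prod (volume.restrict Ω)), ‖ψ z.2‖ ≤ C :=
    Eventually.of_forall fun z => hC z.2
  have i1 : Integrable (fun z : ℝ × E d => deriv θ z.1 * ψ z.2 * W z.1 z.2)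
      ((volume.restrict (Ioo 0 T)).prod (volume.restrict Ω)) := by
    refine (integrable_time_mul hθ' (hWi.bdd_mul (c := C) hψm hψb)).congr
      (Eventually.of_forall fun z => ?_)
    simp only; ring
  have i2 : Integrable (fun z : ℝ × E d => θ z.1 * (f z.1 z.2 * ψ z.2))
      ((volume.restrict (Ioo 0 T)).prod (volume.restrict Ω)) :=
    integrable_time_mul hθ.continuous (hf.mul_bdd (c := C) hψm hψb)
  have i3 : Integrable (fun z : ℝ × E d => θ z.1 * (g z.1 z.2 * ψ z.2))
      ((volume.restrict (Ioo 0 T)).prod (volume.restrict Ω)) :=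
    integrable_time_mul hθ.continuous (hg.mul_bdd (c := C) hψm hψb)
  have i4 : Integrable (fun z : ℝ × E d => θ z.1 *
      inner ℝ (Matrix.toEuclideanLin (A z.1 z.2) (G z.1 z.2)) (gradient ψ z.2))
      ((volume.restrict (Ioo 0 T)).prod (volume.restrict Ω)) :=
    integrable_time_mul hθ.continuous
      (integrable_inner_of_memLp hJ ((hψ.memLp_gradient 2).comp_snd _))
  have i2' : Integrable (fun z : ℝ × E d => f z.1 z.2 * (θ z.1 * ψ z.2))
      ((volume.restrict (Ioo 0 T)).prod (volume.restrict Ω)) :=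
    i2.congr (Eventually.of_forall fun z => by simp only; ring)
  have key := hweak _ _ _ _ (memW11_product (T := T) hθ hψ) (memL2H10_product hθ.continuous hψ)
    (Eventually.of_forall fun x => by
      rw [intervalIntegral.integral_mul_const, intervalIntegral.integral_deriv_eq_sub
        (fun s _ => hθ.differentiable (by norm_num) s) (hθ'.intervalIntegrable _ _), hθT]
      ring) (by rw [IntegrableOn, restrict_cyl]; exact i1)
    (by rw [IntegrableOn, restrict_cyl]; exact i2')
  rw [restrict_cyl] at key ⊢
  simp_rw [inner_smul_right] at key
  have i1n : Integrable (fun z : ℝ × E d => -(deriv θ z.1 * ψ z.2 * W z.1 z.2))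
      ((volume.restrict (Ioo 0 T)).prod (volume.restrict Ω)) := i1.neg
  rw [integral_add i1n i4, integral_neg,
    integral_prod_deriv_mul hT hg hWe (hθ.of_le (by norm_num)) hθT
      hψ.smooth.continuous.aestronglyMeasurable hC, neg_neg] at key
  calc _ = ∫ z, ((θ z.1 * (g z.1 z.2 * ψ z.2) + θ z.1 *
        inner ℝ (Matrix.toEuclideanLin (A z.1 z.2) (G z.1 z.2)) (gradient ψ z.2)) -
        f z.1 z.2 * (θ z.1 * ψ z.2))
        ∂((volume.restrict (Ioo 0 T)).prod (volume.restrict Ω)) := by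
        congr 1 with z; ring
    _ = 0 := by
        have i34 : Integrable (fun z : ℝ × E d => θ z.1 * (g z.1 z.2 * ψ z.2) + θ z.1 *
            inner ℝ (Matrix.toEuclideanLin (A z.1 z.2) (G z.1 z.2)) (gradient ψ z.2))
            ((volume.restrict (Ioo 0 T)).prod (volume.restrict Ω)) := i3.add i4
        rw [integral_sub i34 i2', integral_add i3 i4, key, sub_self]

end Testing

/-! ### Truncations, splittings of the kernel, and primitives -/

section Composition

namespace ClassP

variable {S : ℝ → ℝ}

theorem differentiable (hS : ClassP S) : Differentiable ℝ S :=
  hS.contDiff.differentiable (by norm_num)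

theorem continuous_deriv (hS : ClassP S) : Continuous (deriv S) :=
  hS.contDiff.continuous_deriv (by norm_num)

theorem monotone (hS : ClassP S) : Monotone S :=
  monotone_of_deriv_nonneg hS.differentiable hS.deriv_nonneg

theorem abs_deriv_le_one (hS : ClassP S) (r : ℝ) : |deriv S r| ≤ 1 := by
  rw [abs_of_nonneg (hS.deriv_nonneg r)]
  exact hS.deriv_le_one r

theorem abs_le_abs (hS : ClassP S) (r : ℝ) : |S r| ≤ |r| := by
  simpa [hS.map_zero] using abs_le_of_abs_deriv_le hS.differentiable hS.abs_deriv_le_one r 0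

/-- Functions in `𝒫` are bounded, because `S'` is integrable. -/
theorem exists_abs_le (hS : ClassP S) : ∃ M, ∀ r, |S r| ≤ M := by
  refine ⟨∫ r, ‖deriv S r‖, fun r => ?_⟩
  rw [← hS.eq_integral r, ← Real.norm_eq_abs]
  exact intervalIntegral.norm_integral_le_integral_norm_uIoc.trans
    (setIntegral_le_integral (hS.continuous_deriv.integrable_of_hasCompactSupport hS.compact).norm
      (Eventually.of_forall fun _ => norm_nonneg _))

end ClassP

section Composition

variable {d : ℕ} {Ω : Set (E d)} {T : ℝ}

theorem MemL2H10.comp {w : ℝ → E d → ℝ} {G : ℝ → E d → E d} (hw : MemL2H10 T Ω w G)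
    {F h : ℝ → ℝ} (hFh : ChainRule Ω F h) (hF : Measurable F) (hh : Measurable h)
    (hF1 : ∀ s, |F s| ≤ |s|) (hh1 : ∀ s, |h s| ≤ 1) :
    MemL2H10 T Ω (fun t x => F (w t x)) (fun t x => h (w t x) • G t x) := by
  have hm := hw.memLp.1.aemeasurable
  refine ⟨MemLp.of_le hw.memLp (hF.comp_aemeasurable hm).aestronglyMeasurable
    (Eventually.of_forall fun z => hF1 _), MemLp.of_le hw.memLp_grad
    ((hh.comp_aemeasurable hm).aestronglyMeasurable.smul hw.memLp_grad.1)
    (Eventually.of_forall fun z => ?_), hw.slice.mono fun t ht => hFh _ _ ht⟩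
  change ‖h (w z.1 z.2) • G z.1 z.2‖ ≤ ‖G z.1 z.2‖
  rw [norm_smul]
  exact mul_le_of_le_one_left (norm_nonneg _) (hh1 _)

theorem MemL2H10.sub_const {w : ℝ → E d → ℝ} {G : ℝ → E d → E d} (hw : MemL2H10 T Ω w G)
    {ϕ : E d → ℝ} {D : E d → E d} (hϕ : MemH10 Ω ϕ D) :
    MemL2H10 T Ω (fun t x => w t x - ϕ x) (fun t x => G t x - D x) := by
  obtain ⟨h1, h2, h3⟩ := hw
  have hs := h3.mono fun t ht => ht.sub hϕ
  obtain ⟨p1, p2, -⟩ := hϕ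
  refine ⟨?_, ?_, hs⟩
  · rw [restrict_cyl] at h1 ⊢
    exact h1.sub (p1.comp_snd _)
  · rw [restrict_cyl] at h2 ⊢
    exact h2.sub (p2.comp_snd _)

theorem memL2H10_trunc {v : ℝ → E d → ℝ} {G : ℝ → E d → E d} (hv : MemL2H10 T Ω v G) {K : ℝ}
    (hK : 0 < K) : MemL2H10 T Ω (fun t x => trunc K (v t x))
      (fun t => {x | |v t x| < K}.indicator (G t)) := by
  have hm : MeasurableSet {r : ℝ | |r| < K} :=
    (isOpen_lt continuous_abs continuous_const).measurableSet
  have hc : Continuous (trunc K) := by unfold trunc; fun_prop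
  have := hv.comp (chainRule_trunc hK) hc.measurable (measurable_const.indicator hm)
    (abs_trunc_le hK) fun s => by
      by_cases h : s ∈ {r : ℝ | |r| < K} <;> simp [h]
  convert this using 3 with t x
  by_cases h : |v t x| < K <;> simp [indicator, h]

end Composition

/-- The convolutions with the two parts of a splitting add up to the convolution with `k`. -/
theorem IsSplitting.ae_conv_eq_add {X : Type*} [MeasurableSpace X] {μ : Measure X} [SFinite μ]
    {T : ℝ} {k k₁ k₂ : ℝ → ℝ} (h : IsSplitting T k k₁ k₂) {w : ℝ → X → ℝ}
    (hw : Integrable (Function.uncurry w) ((volume.restrict (Ioo 0 T)).prod μ)) :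
    ∀ᵐ z ∂((volume.restrict (Ioo 0 T)).prod μ),
      ∫ s in (0 : ℝ)..z.1, k (z.1 - s) * w s z.2 =
        (∫ s in (0 : ℝ)..z.1, k₁ (z.1 - s) * w s z.2) +
          ∫ s in (0 : ℝ)..z.1, k₂ (z.1 - s) * w s z.2 := by
  filter_upwards [ae_fst_mem_Ioo, ae_intervalIntegrable_conv h.int₁ hw,
    ae_intervalIntegrable_conv h.int₂ hw] with z hz i1 i2
  rw [← intervalIntegral.integral_add i1 i2]
  have hadd := (ae_restrict_iff' measurableSet_Ioo).1 h.add_eq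
  have hadd' := (Measure.measurePreserving_sub_left volume z.1).quasiMeasurePreserving.ae hadd
  -- the splitting holds almost everywhere on `(0, T)` only; `s = z.1` corresponds to the time `0`
  refine intervalIntegral.integral_congr_ae ?_
  filter_upwards [hadd', compl_mem_ae_iff.2 (measure_singleton z.1)] with s hs hne hmem
  rw [uIoc_of_le hz.1.le] at hmem
  rw [hs ⟨sub_pos.2 (lt_of_le_of_ne hmem.2 hne), by linarith [hmem.1, hz.2]⟩, add_mul]

/-- A kernel with a finite right limit at `0` is bounded by this limit. -/
theorem le_of_antitoneOn_of_tendsto_nhdsGT {κ : ℝ → ℝ} {T c : ℝ} (hκ : AntitoneOn κ (Ioo 0 T))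
    (hc : Tendsto κ (𝓝[>] 0) (𝓝 c)) : ∀ t ∈ Ioo 0 T, κ t ≤ c := by
  intro t ht
  refine ge_of_tendsto hc ?_
  filter_upwards [Ioo_mem_nhdsGT ht.1] with s hs
  exact hκ ⟨hs.1, hs.2.trans ht.2⟩ ht hs.2.le

section Primitive

variable {F : ℝ → ℝ → ℝ}

theorem continuous_integral_of_continuous (hF : Continuous (Function.uncurry F)) :
    Continuous fun p : ℝ × ℝ × ℝ => ∫ τ in p.1..p.2.1, F p.2.2 τ := by
  have h0 : Continuous fun p : ℝ × ℝ => ∫ τ in (0 : ℝ)..p.2, F p.1 τ :=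
    intervalIntegral.continuous_parametric_intervalIntegral_of_continuous (by fun_prop)
      continuous_snd
  have hs : ∀ c, Continuous (F c) := fun c => hF.comp (Continuous.prodMk_right c)
  have e : (fun p : ℝ × ℝ × ℝ => ∫ τ in p.1..p.2.1, F p.2.2 τ) = fun p : ℝ × ℝ × ℝ =>
      (∫ τ in (0 : ℝ)..p.2.1, F p.2.2 τ) - ∫ τ in (0 : ℝ)..p.1, F p.2.2 τ := by
    ext p
    exact (intervalIntegral.integral_interval_sub_left ((hs _).intervalIntegrable _ _)
      ((hs _).intervalIntegrable _ _)).symm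
  rw [e]
  exact (h0.comp (continuous_snd.snd.prodMk continuous_snd.fst)).sub
    (h0.comp (continuous_snd.snd.prodMk continuous_fst))

theorem hasDerivAt_integral_add {F : ℝ → ℝ} (hF : Continuous F) (a r : ℝ) :
    HasDerivAt (fun r => ∫ τ in a..(a + r), F τ) (F (a + r)) r :=
  (intervalIntegral.integral_hasDerivAt_right (hF.intervalIntegrable _ _)
    hF.stronglyMeasurable.stronglyMeasurableAtFilter hF.continuousAt).comp_const_add a r

end Primitive

end Composition

/-! ### The entropy inequality -/

section EntropyInequality

variable {d : ℕ} {Ω : Set (E d)} {T : ℝ}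

/-- The convolution with a bounded non-increasing kernel is absolutely continuous in time. -/
theorem exists_memW11_conv (hT : 0 < T) {κ : ℝ → ℝ} (hκ : AntitoneOn κ (Ioo 0 T))
    (h0 : ∀ t ∈ Ioo 0 T, 0 ≤ κ t) {c : ℝ} (hC : ∀ t ∈ Ioo 0 T, κ t ≤ c) {w : ℝ → E d → ℝ}
    (hw : IntegrableOn (Function.uncurry w) (cyl T Ω)) :
    ∃ g : ℝ → E d → ℝ, MemW11 1 T Ω (conv κ w) 0 g := by
  rw [IntegrableOn, restrict_cyl] at hw
  obtain ⟨g, hg, hgc⟩ := exists_deriv_conv_of_bounded hT hκ h0 hC hw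
  refine ⟨g, MemLp.zero, memL1Lq_one_iff.2 (by rwa [IntegrableOn, restrict_cyl]), ?_⟩
  rw [restrict_cyl]
  filter_upwards [ae_fst_mem_Ioo, Measure.quasiMeasurePreserving_snd.ae hgc] with z hz h
  rw [Pi.zero_apply, zero_add]
  exact h z.1 hz

/-- The entropy inequality, written in terms of `u = b(v)`. It is the sum of the equation tested
with `ζ S(v - ϕ)` and of the convexity inequality for the kernel `k₁`, whose convolution with
`u - u₀` has the time derivative `g - g₂`. -/
theorem entropy_inequality_of_slice_identity (hT : 0 < T) {k k₁ k₂ φ S ζ : ℝ → ℝ}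
    {A : ℝ → E d → Matrix (Fin d) (Fin d) ℝ} (hA : HypCoeff T Ω A)
    (hφ : HypPhi φ) {u₀ ϕ : E d → ℝ} {f u g g₂ : ℝ → E d → ℝ} {G : ℝ → E d → E d}
    {Dϕ : E d → E d} (hu₀ : IntegrableOn u₀ Ω)
    (hf : IntegrableOn (Function.uncurry f) (cyl T Ω))
    (hu : IntegrableOn (Function.uncurry u) (cyl T Ω))
    (hG : MemL2H10 T Ω (fun t x => φ (u t x)) G)
    (hW : MemW11 1 T Ω (conv k (fun t x => u t x - u₀ x)) 0 g)
    (hslice : ∀ᵐ t ∂(volume.restrict (Ioo 0 T)), ∀ (w : E d → ℝ) (D : E d → E d), MemH10 Ω w D →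
      MemLp w ∞ (volume.restrict Ω) →
      ∫ x in Ω, ((g t x - f t x) * w x +
        inner ℝ (Matrix.toEuclideanLin (A t x) (G t x)) (D x)) = 0)
    (hϕ : MemH10 Ω ϕ Dϕ) (hζ : IsTimeTest T ζ) (hS : ClassP S) (hk : IsSplitting T k k₁ k₂)
    (hW₂ : MemW11 1 T Ω (conv k₂ (fun t x => u t x - u₀ x)) 0 g₂) :
    IntegrableOn (fun z : ℝ × E d => deriv ζ z.1 *
      conv k₁ (fun t x => ∫ τ in (u₀ x)..(u t x), S (φ τ - ϕ x)) z.1 z.2) (cyl T Ω) ∧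
    IntegrableOn (fun z : ℝ × E d => ζ z.1 * g₂ z.1 z.2 * S (φ (u z.1 z.2) - ϕ z.2))
      (cyl T Ω) ∧
    IntegrableOn (fun z : ℝ × E d => ζ z.1 *
      inner ℝ (Matrix.toEuclideanLin (A z.1 z.2) (G z.1 z.2))
        (deriv S (φ (u z.1 z.2) - ϕ z.2) • (G z.1 z.2 - Dϕ z.2))) (cyl T Ω) ∧
    IntegrableOn (fun z : ℝ × E d => ζ z.1 * f z.1 z.2 * S (φ (u z.1 z.2) - ϕ z.2))
      (cyl T Ω) ∧
    -(∫ z in cyl T Ω, deriv ζ z.1 *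
        conv k₁ (fun t x => ∫ τ in (u₀ x)..(u t x), S (φ τ - ϕ x)) z.1 z.2)
      + (∫ z in cyl T Ω, ζ z.1 * g₂ z.1 z.2 * S (φ (u z.1 z.2) - ϕ z.2))
      + (∫ z in cyl T Ω, ζ z.1 *
          inner ℝ (Matrix.toEuclideanLin (A z.1 z.2) (G z.1 z.2))
            (deriv S (φ (u z.1 z.2) - ϕ z.2) • (G z.1 z.2 - Dϕ z.2)))
      ≤ ∫ z in cyl T Ω, ζ z.1 * f z.1 z.2 * S (φ (u z.1 z.2) - ϕ z.2) := by
  have hSc : Continuous S := hS.contDiff.continuous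
  have hφc : Continuous φ := hφ.contDiff.continuous
  obtain ⟨M, hM⟩ := hS.exists_abs_le
  have hg : IntegrableOn (Function.uncurry g) (cyl T Ω) := memL1Lq_one_iff.1 hW.deriv
  have hg₂ : IntegrableOn (Function.uncurry g₂) (cyl T Ω) := memL1Lq_one_iff.1 hW₂.deriv
  have hJ : MemLp (fun z : ℝ × E d => Matrix.toEuclideanLin (A z.1 z.2) (G z.1 z.2)) 2
      (volume.restrict (cyl T Ω)) := memLp_toEuclideanLin hA.bounded hG.memLp_grad
  have hwS := (hG.sub_const hϕ).comp hS.chainRule hSc.measurable hS.continuous_deriv.measurable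
    hS.abs_le_abs hS.abs_deriv_le_one
  have hH := hwS.memLp_grad
  have hSm := hwS.memLp.1
  have hWe := hW.eq_integral
  have hWe₂ := hW₂.eq_integral
  simp only [IntegrableOn, restrict_cyl] at hf hu hg hg₂ hJ hH hSm hWe hWe₂ ⊢
  have hϕm : AEMeasurable ϕ (volume.restrict Ω) := hϕ.1.1.aemeasurable
  have hw : Integrable (Function.uncurry fun t x => u t x - u₀ x)
      ((volume.restrict (Ioo 0 T)).prod (volume.restrict Ω)) :=
    hu.sub (Integrable.comp_snd hu₀ _)
  have hSi : ∀ {h : ℝ → E d → ℝ}, Integrable (Function.uncurry h)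
      ((volume.restrict (Ioo 0 T)).prod (volume.restrict Ω)) →
      Integrable (fun z : ℝ × E d => ζ z.1 * h z.1 z.2 * S (φ (u z.1 z.2) - ϕ z.2))
        ((volume.restrict (Ioo 0 T)).prod (volume.restrict Ω)) := fun hh =>
    (integrable_time_mul hζ.smooth.continuous hh).mul_bdd (c := M) hSm
      (Eventually.of_forall fun z => hM _)
  have hJi : Integrable (fun z : ℝ × E d => ζ z.1 *
      inner ℝ (Matrix.toEuclideanLin (A z.1 z.2) (G z.1 z.2))
        (deriv S (φ (u z.1 z.2) - ϕ z.2) • (G z.1 z.2 - Dϕ z.2)))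
      ((volume.restrict (Ioo 0 T)).prod (volume.restrict Ω)) :=
    integrable_time_mul hζ.smooth.continuous (integrable_inner_of_memLp hJ hH)
  have hF : ∀ c, Continuous fun τ => S (φ τ - c) := fun c => hSc.comp (hφc.sub continuous_const)
  -- the convex function `Ψ(r) = ∫_{u₀}^{u₀ + r} S(φ(τ) - ϕ) dτ` of `r = u - u₀` is Lipschitz with
  -- constant `M`, so it preserves integrability
  have hΨi : Integrable (fun z : ℝ × E d =>
      ∫ τ in (u₀ z.2)..(u₀ z.2 + (u z.1 z.2 - u₀ z.2)), S (φ τ - ϕ z.2))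
      ((volume.restrict (Ioo 0 T)).prod (volume.restrict Ω)) := by
    refine Integrable.mono' (hw.norm.const_mul M) ?_ (Eventually.of_forall fun z => ?_)
    · have hcont := continuous_integral_of_continuous (F := fun c τ => S (φ τ - c))
        (hSc.comp ((hφc.comp continuous_snd).sub continuous_fst))
      have hm : AEMeasurable (fun z : ℝ × E d => (u₀ z.2, u₀ z.2 + (u z.1 z.2 - u₀ z.2), ϕ z.2))
          ((volume.restrict (Ioo 0 T)).prod (volume.restrict Ω)) :=
        hu₀.1.aemeasurable.comp_snd.prodMk
          ((hu₀.1.aemeasurable.comp_snd.add hw.1.aemeasurable).prodMk hϕm.comp_snd)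
      exact (hcont.measurable.comp_aemeasurable hm).aestronglyMeasurable
    · refine (intervalIntegral.norm_integral_le_of_norm_le_const fun τ _ => hM _).trans ?_
      rw [add_sub_cancel_left]
      rfl
  have hζT : ζ T = 0 := image_eq_zero_of_notMem_tsupport fun h => lt_irrefl T (hζ.support h)
  have hconvex := integral_convexity_inequality (μ := volume.restrict Ω)
    (w := fun t x => u t x - u₀ x) (g := fun t x => g t x - g₂ t x)
    (Ψ := fun x r => ∫ τ in (u₀ x)..(u₀ x + r), S (φ τ - ϕ x))
    (ψ := fun x r => S (φ (u₀ x + r) - ϕ x)) hT hk.antitone₁ hk.nonneg₁ hk.int₁ hw (hg.sub hg₂)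
    (by
      filter_upwards [hk.ae_conv_eq_add hw, hWe, hWe₂,
        (Measure.quasiMeasurePreserving_snd.ae hg.prod_left_ae),
        (Measure.quasiMeasurePreserving_snd.ae hg₂.prod_left_ae),
        ae_fst_mem_Ioo]
        with z h1 h2 h3 h4 h5 h6
      have hint : ∀ {h : ℝ → ℝ}, Integrable h (volume.restrict (Ioo 0 T)) →
          IntervalIntegrable h volume 0 z.1 := fun hh =>
        (intervalIntegrable_iff_integrableOn_Ioo_of_le h6.1.le).2
          (IntegrableOn.mono_set hh (Ioo_subset_Ioo_right h6.2.le))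
      simp only [Pi.zero_apply, zero_add, conv] at h2 h3
      rw [intervalIntegral.integral_sub (hint (h := fun s => g s z.2) h4)
        (hint (h := fun s => g₂ s z.2) h5)]
      linarith)
    (fun x r => hasDerivAt_integral_add (hF _) _ _)
    (fun x => (hF (ϕ x)).comp (continuous_const.add continuous_id))
    (fun x r s hrs => hS.monotone (sub_le_sub_right
      (hφ.strictMono.monotone (add_le_add_right hrs _)) _))
    (fun x r => hM _) (fun x => by simp) hΨi
    (by simp only [add_sub_cancel]; exact hSm) (hζ.smooth.of_le (by norm_num)) hζT
    (fun t ht => hζ.nonneg t ⟨ht.1.le, ht.2⟩)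
  simp only [add_sub_cancel] at hconvex hΨi
  -- the equation, tested with `ζ S(v - ϕ)`.
  have htested : ∫ z, (ζ z.1 * (g z.1 z.2 - f z.1 z.2) * S (φ (u z.1 z.2) - ϕ z.2) + ζ z.1 *
      inner ℝ (Matrix.toEuclideanLin (A z.1 z.2) (G z.1 z.2))
        (deriv S (φ (u z.1 z.2) - ϕ z.2) • (G z.1 z.2 - Dϕ z.2)))
      ∂((volume.restrict (Ioo 0 T)).prod (volume.restrict Ω)) = 0 := by
    have hi := (hSi (h := fun t x => g t x - f t x) (hg.sub hf)).add hJi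
    refine (integral_prod _ hi).trans ?_
    refine (integral_congr_ae ?_).trans (integral_zero _ _)
    filter_upwards [hslice, hwS.slice] with t h1 h2
    have hb : MemLp (fun x => S (φ (u t x) - ϕ x)) ∞ (volume.restrict Ω) :=
      memLp_top_of_bound h2.1.1 M (Eventually.of_forall fun x => hM _)
    have h3 := h1 _ _ h2 hb
    rw [← mul_zero (ζ t), ← h3, ← integral_const_mul]
    congr 1 with x
    simp only [Pi.add_apply]
    ring
  have hgi := hSi hg
  have hg₂i := hSi hg₂
  have hfi := hSi hf
  have e1 : ∫ z, (ζ z.1 * (g z.1 z.2 - f z.1 z.2) * S (φ (u z.1 z.2) - ϕ z.2) + ζ z.1 *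
      inner ℝ (Matrix.toEuclideanLin (A z.1 z.2) (G z.1 z.2))
        (deriv S (φ (u z.1 z.2) - ϕ z.2) • (G z.1 z.2 - Dϕ z.2)))
      ∂((volume.restrict (Ioo 0 T)).prod (volume.restrict Ω)) =
      ((∫ z, ζ z.1 * g z.1 z.2 * S (φ (u z.1 z.2) - ϕ z.2)
        ∂((volume.restrict (Ioo 0 T)).prod (volume.restrict Ω))) -
      ∫ z, ζ z.1 * f z.1 z.2 * S (φ (u z.1 z.2) - ϕ z.2)
        ∂((volume.restrict (Ioo 0 T)).prod (volume.restrict Ω))) +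
      ∫ z, ζ z.1 * inner ℝ (Matrix.toEuclideanLin (A z.1 z.2) (G z.1 z.2))
        (deriv S (φ (u z.1 z.2) - ϕ z.2) • (G z.1 z.2 - Dϕ z.2))
        ∂((volume.restrict (Ioo 0 T)).prod (volume.restrict Ω)) := by
    rw [integral_add (hSi (h := fun t x => g t x - f t x) (hg.sub hf)) hJi,
      ← integral_sub hgi hfi]
    congr 2 with z
    ring
  have e2 : ∫ z, ζ z.1 * (g z.1 z.2 - g₂ z.1 z.2) * S (φ (u z.1 z.2) - ϕ z.2)
        ∂((volume.restrict (Ioo 0 T)).prod (volume.restrict Ω)) =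
      (∫ z, ζ z.1 * g z.1 z.2 * S (φ (u z.1 z.2) - ϕ z.2)
        ∂((volume.restrict (Ioo 0 T)).prod (volume.restrict Ω))) -
      ∫ z, ζ z.1 * g₂ z.1 z.2 * S (φ (u z.1 z.2) - ϕ z.2)
        ∂((volume.restrict (Ioo 0 T)).prod (volume.restrict Ω)) := by
    rw [← integral_sub hgi hg₂i]
    congr 1 with z
    ring
  refine ⟨integrable_time_mul (hζ.smooth.continuous_deriv (by norm_num))
    (integrable_conv hk.int₁ (w := fun t x => ∫ τ in (u₀ x)..(u t x), S (φ τ - ϕ x)) hΨi),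
    hg₂i, hJi, hfi, ?_⟩
  simp only [conv]
  linarith

end EntropyInequality

end FracPME

open FracPME in
theorem mainTheorem2 {d : ℕ} (hd : 0 < d) (T : ℝ) (hT : 0 < T)
    (Ω : Set (E d)) (hΩo : IsOpen Ω) (hΩc : IsConnected Ω) (hΩb : Bornology.IsBounded Ω)
    (k : ℝ → ℝ) (A : ℝ → E d → Matrix (Fin d) (Fin d) ℝ) (φ : ℝ → ℝ)
    (u₀ : E d → ℝ) (f : ℝ → E d → ℝ)
    (hk : HypKernel T k) (hA : HypCoeff T Ω A) (hφ : HypPhi φ) (hdata : HypData T Ω u₀ f)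
    (u : ℝ → E d → ℝ) (hu : IsWeakSolution T Ω k A φ u₀ f u)
    (hreg : ∃ g : ℝ → E d → ℝ, MemW11 1 T Ω (conv k (fun t x => u t x - u₀ x)) 0 g) :
    IsEntropySolution T Ω k A hφ u₀ f (fun t x => φ (u t x)) := by
  obtain ⟨hu2, -, G, hG, hweak⟩ := hu
  obtain ⟨g, hW⟩ := hreg
  have hfin : IsFiniteMeasure ((volume : Measure (E d)).restrict Ω) :=
    ⟨by rw [Measure.restrict_apply_univ]; exact hΩb.measure_lt_top⟩
  have hfin2 : IsFiniteMeasure ((volume : Measure (ℝ × E d)).restrict (cyl T Ω)) := by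
    rw [restrict_cyl]; infer_instance
  have hu1 : IntegrableOn (Function.uncurry u) (cyl T Ω) := hu2.integrable (by norm_num)
  have hslice := ae_slice_identity_of_weak hT hΩo hΩb hA hdata.source hG.memLp_grad hW hweak
  refine ⟨hG.memLp.1, ?_, G, fun K hK => memL2H10_trunc hG hK, ?_⟩
  · simp only [hφ.bInv_apply]
    exact hu1
  intro ϕ Dϕ ζ S k₁ k₂ hϕ _ hζ hS hsplit
  have hw : IntegrableOn (Function.uncurry fun t x => u t x - u₀ x) (cyl T Ω) := by
    have h0 := hdata.init
    rw [IntegrableOn, restrict_cyl] at hu1 ⊢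
    exact hu1.sub (Integrable.comp_snd h0 _)
  obtain ⟨c, hc⟩ := hsplit.finite
  obtain ⟨g₂, hW₂⟩ := exists_memW11_conv hT hsplit.antitone₂ hsplit.nonneg₂
    (le_of_antitoneOn_of_tendsto_nhdsGT hsplit.antitone₂ hc) hw
  have hdB : ∀ t x, ∫ σ in (φ (u₀ x))..(φ (u t x)), S (σ - ϕ x) ∂(dB hφ) =
      ∫ τ in (u₀ x)..(u t x), S (φ τ - ϕ x) := fun t x =>
    intervalIntegral_dB hφ (F := fun σ => S (σ - ϕ x))
      (hS.contDiff.continuous.comp (continuous_id.sub continuous_const)) _ _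
  refine ⟨fun t x => deriv S (φ (u t x) - ϕ x) • (G t x - Dϕ x), g₂, ?_⟩
  simp only [hφ.bInv_apply, hdB]
  exact ⟨(hG.sub_const hϕ).comp hS.chainRule hS.contDiff.continuous.measurable
    hS.continuous_deriv.measurable hS.abs_le_abs hS.abs_deriv_le_one, hW₂,
    entropy_inequality_of_slice_identity hT hA hφ hdata.init hdata.source hu1 hG hW hslice hϕ hζ
      hS hsplit hW₂⟩
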